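/- Let $k\ge 3$ be an integer. Let $P_l(G)$ be the polynomials of total degree at most $l$ on $G\subset\mathbb R^2$, $\mathbb S$ the symmetric real $2\times2$ matrices, and $P_l(G;\mathbb R^2)$, $P_l(G;\mathbb S)$ the vector- and $\mathbb S$-valued versions. Let $\mathrm{curl}\,\varphi=(-\partial_y\varphi,\partial_x\varphi)^{\intercal}$; for vector fields $\mathbf{curl}$, and for matrix fields $\mathbf{div}$, act row by row; $\mathrm{sym}\,A=\frac12(A+A^{\intercal})$. Let $RT=\{\mathbf c+b\mathbf x:\mathbf c\in\mathbb R^2,\ b\in\mathbb R\}$ be the lowest order Raviart–Thomas space. Write $(\cdot,\cdot)_e$ and $(\cdot,\cdot)_K$ for the $L^2$ products on an edge $e$ and on a triangle $K$. For a triangle $K$ consider the following vertex and edge degrees of freedom, where $a$ runs through the vertices and $e$ (with unit normal $\mathbf n$) through the edges of $K$: (V) for $\mathbf v\in P_{k+1}(K;\mathbb R^2)$: $\mathbf v(a)$, $\nabla\mathbf v(a)$; $(\mathbf v,\boldsymbol\phi)_e$ for $\boldsymbol\phi\in P_{k-3}(e;\mathbb R^2)$; $(\mathrm{div}\,\mathbf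 v,q)_e$ for $q\in P_{k-2}(e)$; (S) for $\boldsymbol\sigma\in P_k(K;\mathbb S)$: $\boldsymbol\sigma(a)$; $(\boldsymbol\sigma\mathbf n,\boldsymbol\phi)_e$ for $\boldsymbol\phi\in P_{k-2}(e;\mathbb R^2)$; $(\mathbf{div}\,\boldsymbol\sigma\cdot\mathbf n,q)_e$ for $q\in P_{k-1}(e)$. Let $\Omega\subset\mathbb R^2$ be a bounded, simply connected Lipschitz polygonal domain and $\mathcal T_h$ a conforming triangulation of $\Omega$, that is, a finite simplicial complex whose underlying space is $\overline\Omega$. Let - $V_h$ be the space of $\mathbf v\in H^1(\Omega;\mathbb R^2)$ with $\mathbf v|_K\in P_{k+1}(K;\mathbb R^2)$ for all triangles $K\in\mathcal T_h$ whose degrees of freedom (V) are single-valued (two triangles with a common vertex or a common edge $e$ give the same values there, for one fixed choice of the normal of $e$); - $\Sigma_{k,\triangle_2}$ be the space of $\boldsymbol\tau\in L^2(\Omega;\mathbb S)$ with $\mathrm{div}\,\mathbf{div}\,\boldsymbol\tau\in L^2(\Omega)$ in the weak sense, with $\boldsymbol\tau|_K\in P_k(K;\mathbb S)$ for all triangles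 $K\in\mathcal T_h$, and with single-valued degrees of freedom (S); - $P_{h,\triangle_2}=\{q\in L^2(\Omega): q|_K\in P_{k-2}(K)\text{ for all triangles }K\in\mathcal T_h\}$. Then: 1. The finite element sequence $$RT\xrightarrow{\ \subset\ }V_h\xrightarrow{\ \mathrm{sym}\,\mathbf{curl}\ }\Sigma_{k,\triangle_2}\xrightarrow{\ \mathrm{div}\,\mathbf{div}\ }P_{h,\triangle_2}\longrightarrow 0$$ is a well-defined complex and is exact. 2. For every triangle $K$ the polynomial complex $$RT\xrightarrow{\ \subset\ }P_{k+1}(K;\mathbb R^2)\xrightarrow{\ \mathrm{sym}\,\mathbf{curl}\ }P_k(K;\mathbb S)\xrightarrow{\ \mathrm{div}\,\mathbf{div}\ }P_{k-2}(K)\longrightarrow 0$$ is exact. 3. For every triangle $K$ the bubble complex $$0\longrightarrow\overset{\circ}{V}_{k+1}(K)\xrightarrow{\ \mathrm{sym}\,\mathbf{curl}\ }\overset{\circ}{\Sigma}_{k}(K)\xrightarrow{\ \mathrm{div}\,\mathbf{div}\ }\overset{\circ}{P}_{k-2}(K)\longrightarrow 0$$ is exact, where $\overset{\circ}{V}_{k+1}(K)\subset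 P_{k+1}(K;\mathbb R^2)$ and $\overset{\circ}{\Sigma}_{k}(K)\subset P_k(K;\mathbb S)$ are the subspaces on which all degrees of freedom (V), respectively (S), vanish, and $\overset{\circ}{P}_{k-2}(K)=\{q\in P_{k-2}(K):(q,p)_K=0\text{ for all }p\in P_1(K)\}$. -/

import Mathlib

open MeasureTheory Topology
open scoped Distributions ContDiff NNReal

noncomputable section

namespace DivDiv

/-- The Euclidean plane. -/
abbrev E := EuclideanSpace ℝ (Fin 2)

/-- Real polynomials in the two variables `x = X 0`, `y = X 1`. A polynomial function on a
nondegenerate triangle is identified with the polynomial that defines it. -/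
abbrev Poly := MvPolynomial (Fin 2) ℝ

/-- The value of a polynomial at a point of the plane. -/
def ev (x : E) (p : Poly) : ℝ := MvPolynomial.eval (fun i => x i) p

theorem ev_add (x : E) (p q : Poly) : ev x (p + q) = ev x p + ev x q := by simp [ev]

theorem ev_smul (x : E) (c : ℝ) (p : Poly) : ev x (c • p) = c * ev x p := by simp [ev]

theorem ev_zero (x : E) : ev x 0 = 0 := by simp [ev]

theorem continuous_ev (p : Poly) : Continuous fun x : E => ev x p := by
  have h : Continuous fun y : Fin 2 → ℝ => MvPolynomial.eval y p :=
    MvPolynomial.continuous_eval p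
  exact h.comp (PiLp.continuous_ofLp 2 _)

/-! ### Exactness of a complex `A → V → S → P → 0` whose first map is an inclusion -/

/-- Let `A, V ⊆ U`, `S ⊆ W`, `P ⊆ Z` be subspaces and `d₁`, `d₂` linear maps defined on `V` and on
`S`. The sequence `A → V → S → P → 0` (inclusion, `d₁`, `d₂`) is well defined and exact. -/
def IsExactSeq {U W Z : Type*} [AddCommGroup U] [Module ℝ U] [AddCommGroup W] [Module ℝ W]
    [AddCommGroup Z] [Module ℝ Z] (A V : Submodule ℝ U) (S : Submodule ℝ W) (P : Submodule ℝ Z)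
    (d₁ : V →ₗ[ℝ] W) (d₂ : S →ₗ[ℝ] Z) : Prop :=
  ∃ (hA : A ≤ V) (h₁ : ∀ v, d₁ v ∈ S) (h₂ : ∀ σ, d₂ σ ∈ P),
    Function.Exact (Submodule.inclusion hA) (d₁.codRestrict S h₁) ∧
    Function.Exact (d₁.codRestrict S h₁) (d₂.codRestrict P h₂) ∧
    Function.Surjective (d₂.codRestrict P h₂)

/-! ### Polynomial spaces and differential operators on polynomials -/

/-- `P_l`: polynomials of total degree at most `l`. -/
abbrev P (l : ℕ) : Submodule ℝ Poly := MvPolynomial.restrictTotalDegree (Fin 2) ℝ l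

/-- `P_l(ℝ²)`. -/
def PVec (l : ℕ) : Submodule ℝ (Fin 2 → Poly) := Submodule.pi Set.univ fun _ => P l

/-- `P_l(𝕊)`: symmetric matrices of polynomials of degree at most `l`. -/
def PSym (l : ℕ) : Submodule ℝ (Matrix (Fin 2) (Fin 2) Poly) where
  carrier := {σ | σ.IsSymm ∧ ∀ i j, σ i j ∈ P l}
  add_mem' h h' := ⟨h.1.add h'.1, fun i j => (P l).add_mem (h.2 i j) (h'.2 i j)⟩
  zero_mem' := ⟨Matrix.isSymm_zero, fun _ _ => (P l).zero_mem⟩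
  smul_mem' c _ h := ⟨h.1.smul c, fun i j => (P l).smul_mem c (h.2 i j)⟩

/-- `RT`, the lowest order Raviart-Thomas space `{c + b x : c ∈ ℝ², b ∈ ℝ}`, as polynomials. -/
def RTPoly : Submodule ℝ (Fin 2 → Poly) where
  carrier := {v | ∃ (c : Fin 2 → ℝ) (b : ℝ),
    ∀ i, v i = MvPolynomial.C (c i) + b • MvPolynomial.X i}
  add_mem' := by
    rintro v w ⟨c, b, h⟩ ⟨c', b', h'⟩
    exact ⟨c + c', b + b', fun i => by simp [h i, h' i, add_smul]; abel⟩
  zero_mem' := ⟨0, 0, fun i => by simp⟩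
  smul_mem' := by
    rintro r v ⟨c, b, h⟩
    exact ⟨r • c, r * b, fun i => by
      simp [h i, MvPolynomial.smul_eq_C_mul, mul_assoc]⟩

/-- The gradient of a polynomial vector field, row by row: `(∇v)ᵢⱼ = ∂ⱼ vᵢ`. -/
def gradP : (Fin 2 → Poly) →ₗ[ℝ] Matrix (Fin 2) (Fin 2) Poly where
  toFun v := Matrix.of fun i j => MvPolynomial.pderiv j (v i)
  map_add' v w := by ext1 i j; exact map_add (MvPolynomial.pderiv j) (v i) (w i)
  map_smul' c v := by ext1 i j; exact (MvPolynomial.pderiv j).map_smul c (v i)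

/-- The divergence of a polynomial vector field. -/
def divP : (Fin 2 → Poly) →ₗ[ℝ] Poly where
  toFun v := ∑ i, MvPolynomial.pderiv i (v i)
  map_add' v w := by simp [Finset.sum_add_distrib]
  map_smul' c v := by simp

/-- The row-wise divergence of a polynomial matrix field. -/
def rowDivP : Matrix (Fin 2) (Fin 2) Poly →ₗ[ℝ] (Fin 2 → Poly) where
  toFun σ := fun i => divP (σ i)
  map_add' σ τ := by ext1 i; exact map_add divP (σ i) (τ i)
  map_smul' c σ := by ext1 i; exact map_smul divP c (σ i)

/-- `div div` of a polynomial matrix field. -/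
def divDivP : Matrix (Fin 2) (Fin 2) Poly →ₗ[ℝ] Poly := divP ∘ₗ rowDivP

/-- Given a gradient matrix `G = ∇v` (rows `∇vᵢ`), the symmetric part of the matrix whose rows are
`curl vᵢ = (-∂_y vᵢ, ∂_x vᵢ)`. -/
def symRot (M : Type*) [AddCommGroup M] [Module ℝ M] :
    Matrix (Fin 2) (Fin 2) M →ₗ[ℝ] Matrix (Fin 2) (Fin 2) M where
  toFun G :=
    let curl : Matrix (Fin 2) (Fin 2) M := Matrix.of fun i => ![-(G i 1), G i 0]
    (1 / 2 : ℝ) • (curl + curl.transpose)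
  map_add' G H := by
    ext i j
    fin_cases i <;> fin_cases j <;> simp <;> module
  map_smul' c G := by
    ext i j
    fin_cases i <;> fin_cases j <;> simp <;> module

/-- `sym curl` of a polynomial vector field. -/
def symCurlP : (Fin 2 → Poly) →ₗ[ℝ] Matrix (Fin 2) (Fin 2) Poly := symRot Poly ∘ₗ gradP

/-! ### Degrees of freedom attached to vertices and edges -/

/-- The arc length integral of a polynomial over the segment from `a` to `b`. -/
def edgeInt (a b : E) : Poly →ₗ[ℝ] ℝ where
  toFun p := dist a b * ∫ s in (0 : ℝ)..1, ev (AffineMap.lineMap a b s) p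
  map_add' p q := by
    have hc : ∀ p : Poly, IntervalIntegrable
        (fun s : ℝ => ev (AffineMap.lineMap a b s : E) p) volume 0 1 := fun p =>
      ((continuous_ev p).comp (AffineMap.lineMap_continuous)).intervalIntegrable _ _
    simp only [ev_add]
    rw [intervalIntegral.integral_add (hc p) (hc q), mul_add]
  map_smul' c p := by
    simp only [ev_smul, intervalIntegral.integral_const_mul, RingHom.id_apply, smul_eq_mul]
    ring

/-- A unit normal of the segment from `a` to `b` (`a ≠ b`); it depends only on the segment and its
direction, not on an adjacent triangle. -/
def unitNormal (a b : E) : Fin 2 → ℝ :=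
  ![(b 1 - a 1) / dist a b, -(b 0 - a 0) / dist a b]

/-- `σ n` on the edge from `a` to `b`. -/
def normalTrace (a b : E) : Matrix (Fin 2) (Fin 2) Poly →ₗ[ℝ] (Fin 2 → Poly) where
  toFun σ := fun i => ∑ j, unitNormal a b j • σ i j
  map_add' σ τ := by ext1 i; simp [Finset.sum_add_distrib]
  map_smul' c σ := by ext1 i; simp [smul_smul, mul_comm]

/-- `div σ · n` on the edge from `a` to `b`. -/
def divNormalTrace (a b : E) : Matrix (Fin 2) (Fin 2) Poly →ₗ[ℝ] Poly where
  toFun σ := ∑ i, unitNormal a b i • rowDivP σ i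
  map_add' σ τ := by simp [Finset.sum_add_distrib]
  map_smul' c σ := by simp [smul_smul, mul_comm]

/-- The vector fields `v` and `w` have the same degrees of freedom
* `v(a)`, `∇v(a)` for the vertices `a ∈ S`,
* `(v, φ)_e`, `φ ∈ P_{k-3}(e; ℝ²)`, and `(div v, q)_e`, `q ∈ P_{k-2}(e)`, for the edges `e = ab`
  with `a, b ∈ S`. -/
def VDofsAgree (k : ℕ) (S : Set E) (v w : Fin 2 → Poly) : Prop :=
  (∀ a ∈ S, ∀ i, ev a (v i) = ev a (w i) ∧ ∀ j, ev a (gradP v i j) = ev a (gradP w i j)) ∧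
  ∀ a ∈ S, ∀ b ∈ S, a ≠ b →
    (∀ φ ∈ PVec (k - 3), ∑ i, edgeInt a b (v i * φ i) = ∑ i, edgeInt a b (w i * φ i)) ∧
    (∀ q ∈ P (k - 2), edgeInt a b (divP v * q) = edgeInt a b (divP w * q))

/-- The matrix fields `σ` and `τ` have the same degrees of freedom
* `σ(a)` for the vertices `a ∈ S`,
* `(σ n, φ)_e`, `φ ∈ P_{k-2}(e; ℝ²)`, and `(div σ · n, q)_e`, `q ∈ P_{k-1}(e)`, for the edges
  `e = ab` with `a, b ∈ S`. -/
def SDofsAgree (k : ℕ) (S : Set E) (σ τ : Matrix (Fin 2) (Fin 2) Poly) : Prop :=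
  (∀ a ∈ S, ∀ i j, ev a (σ i j) = ev a (τ i j)) ∧
  ∀ a ∈ S, ∀ b ∈ S, a ≠ b →
    (∀ φ ∈ PVec (k - 2), ∑ i, edgeInt a b (normalTrace a b σ i * φ i) =
      ∑ i, edgeInt a b (normalTrace a b τ i * φ i)) ∧
    (∀ q ∈ P (k - 1), edgeInt a b (divNormalTrace a b σ * q) =
      edgeInt a b (divNormalTrace a b τ * q))

theorem VDofsAgree.add {k : ℕ} {S : Set E} {v w v' w' : Fin 2 → Poly}
    (h : VDofsAgree k S v w) (h' : VDofsAgree k S v' w') :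
    VDofsAgree k S (v + v') (w + w') := by
  refine ⟨fun a ha i => ⟨?_, fun j => ?_⟩, fun a ha b hb hab => ⟨fun φ hφ => ?_, fun q hq => ?_⟩⟩
  · simp only [Pi.add_apply, ev_add, (h.1 a ha i).1, (h'.1 a ha i).1]
  · simp only [map_add, Matrix.add_apply, ev_add, (h.1 a ha i).2 j, (h'.1 a ha i).2 j]
  · simp only [Pi.add_apply, add_mul, map_add, Finset.sum_add_distrib,
      (h.2 a ha b hb hab).1 φ hφ, (h'.2 a ha b hb hab).1 φ hφ]
  · simp only [add_mul, map_add, (h.2 a ha b hb hab).2 q hq, (h'.2 a ha b hb hab).2 q hq]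

theorem VDofsAgree.smul {k : ℕ} {S : Set E} {v w : Fin 2 → Poly} (c : ℝ)
    (h : VDofsAgree k S v w) : VDofsAgree k S (c • v) (c • w) := by
  refine ⟨fun a ha i => ⟨?_, fun j => ?_⟩, fun a ha b hb hab => ⟨fun φ hφ => ?_, fun q hq => ?_⟩⟩
  · simp only [Pi.smul_apply, ev_smul, (h.1 a ha i).1]
  · simp only [map_smul, Matrix.smul_apply, ev_smul, (h.1 a ha i).2 j]
  · simp only [Pi.smul_apply, smul_mul_assoc, map_smul, ← Finset.smul_sum,
      (h.2 a ha b hb hab).1 φ hφ]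
  · simp only [smul_mul_assoc, map_smul, (h.2 a ha b hb hab).2 q hq]

theorem SDofsAgree.add {k : ℕ} {S : Set E} {v w v' w' : Matrix (Fin 2) (Fin 2) Poly}
    (h : SDofsAgree k S v w) (h' : SDofsAgree k S v' w') :
    SDofsAgree k S (v + v') (w + w') := by
  refine ⟨fun a ha i j => ?_, fun a ha b hb hab => ⟨fun φ hφ => ?_, fun q hq => ?_⟩⟩
  · simp only [Matrix.add_apply, ev_add, h.1 a ha i j, h'.1 a ha i j]
  · simp only [map_add, Pi.add_apply, add_mul, Finset.sum_add_distrib,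
      (h.2 a ha b hb hab).1 φ hφ, (h'.2 a ha b hb hab).1 φ hφ]
  · simp only [add_mul, map_add, (h.2 a ha b hb hab).2 q hq, (h'.2 a ha b hb hab).2 q hq]

theorem SDofsAgree.smul {k : ℕ} {S : Set E} {v w : Matrix (Fin 2) (Fin 2) Poly} (c : ℝ)
    (h : SDofsAgree k S v w) : SDofsAgree k S (c • v) (c • w) := by
  refine ⟨fun a ha i j => ?_, fun a ha b hb hab => ⟨fun φ hφ => ?_, fun q hq => ?_⟩⟩
  · simp only [Matrix.smul_apply, ev_smul, h.1 a ha i j]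
  · simp only [map_smul, Pi.smul_apply, smul_mul_assoc, ← Finset.smul_sum,
      (h.2 a ha b hb hab).1 φ hφ]
  · simp only [smul_mul_assoc, map_smul, (h.2 a ha b hb hab).2 q hq]

theorem VDofsAgree.refl (k : ℕ) (S : Set E) (v : Fin 2 → Poly) : VDofsAgree k S v v :=
  ⟨fun _ _ _ => ⟨rfl, fun _ => rfl⟩, fun _ _ _ _ _ => ⟨fun _ _ => rfl, fun _ _ => rfl⟩⟩

theorem SDofsAgree.refl (k : ℕ) (S : Set E) (σ : Matrix (Fin 2) (Fin 2) Poly) :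
    SDofsAgree k S σ σ :=
  ⟨fun _ _ _ _ => rfl, fun _ _ _ _ _ => ⟨fun _ _ => rfl, fun _ _ => rfl⟩⟩

/-! ### Local bubble spaces on a triangle, given by its set `T` of vertices -/

/-- `T` is the set of vertices of a nondegenerate triangle `convexHull ℝ T`. -/
def IsTriangle (T : Finset E) : Prop :=
  T.card = 3 ∧ AffineIndependent ℝ ((↑) : T → E)

/-- The fields in `P_{k+1}(K; ℝ²)` all of whose vertex and edge degrees of freedom vanish. -/
def bubbleV (k : ℕ) (T : Finset E) : Submodule ℝ (Fin 2 → Poly) where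
  carrier := {v | v ∈ PVec (k + 1) ∧ VDofsAgree k (T : Set E) v 0}
  add_mem' h h' := ⟨(PVec (k + 1)).add_mem h.1 h'.1, by simpa using h.2.add h'.2⟩
  zero_mem' := ⟨(PVec (k + 1)).zero_mem, VDofsAgree.refl _ _ _⟩
  smul_mem' c _ h := ⟨(PVec (k + 1)).smul_mem c h.1, by simpa using h.2.smul c⟩

/-- The fields in `P_k(K; 𝕊)` all of whose vertex and edge degrees of freedom vanish. -/
def bubbleS (k : ℕ) (T : Finset E) : Submodule ℝ (Matrix (Fin 2) (Fin 2) Poly) where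
  carrier := {σ | σ ∈ PSym k ∧ SDofsAgree k (T : Set E) σ 0}
  add_mem' h h' := ⟨(PSym k).add_mem h.1 h'.1, by simpa using h.2.add h'.2⟩
  zero_mem' := ⟨(PSym k).zero_mem, SDofsAgree.refl _ _ _⟩
  smul_mem' c _ h := ⟨(PSym k).smul_mem c h.1, by simpa using h.2.smul c⟩

theorem integrableOn_ev (T : Finset E) (p : Poly) :
    IntegrableOn (fun x : E => ev x p) (convexHull ℝ (T : Set E)) volume :=
  (continuous_ev p).continuousOn.integrableOn_compact (T.finite_toSet.isCompact_convexHull (𝕜 := ℝ))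

/-- `P_{k-2}(K)/P₁(K)`, realized as the `L²(K)`-orthogonal complement of `P₁(K)` in
`P_{k-2}(K)`. -/
def bubbleP (k : ℕ) (T : Finset E) : Submodule ℝ Poly where
  carrier := {q | q ∈ P (k - 2) ∧
    ∀ p ∈ P 1, ∫ x in convexHull ℝ (T : Set E), ev x (q * p) = 0}
  add_mem' h h' := ⟨(P (k - 2)).add_mem h.1 h'.1, fun p hp => by
    simp only [add_mul, ev_add]
    rw [integral_add (integrableOn_ev T _) (integrableOn_ev T _), h.2 p hp, h'.2 p hp, add_zero]⟩
  zero_mem' := ⟨(P (k - 2)).zero_mem, fun p _ => by simp [ev_zero]⟩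
  smul_mem' c _ h := ⟨(P (k - 2)).smul_mem c h.1, fun p hp => by
    simp only [smul_mul_assoc, ev_smul]
    rw [integral_const_mul, h.2 p hp, mul_zero]⟩

/-! ### Weak derivatives -/

/-- `L²(Ω)`. Vector and matrix fields in `L²` are vectors and matrices over this space. -/
abbrev L2 (Ω : TopologicalSpace.Opens E) : Type := Lp ℝ 2 ((volume : Measure E).restrict Ω)

/-- The classical `i`-th partial derivative. -/
def pd (i : Fin 2) (f : E → ℝ) : E → ℝ := fun x => fderiv ℝ f x (EuclideanSpace.single i 1)

/-- `∫_Ω u f`. -/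
def pairing {Ω : TopologicalSpace.Opens E} (u : L2 Ω) (f : E → ℝ) : ℝ := ∫ x in Ω, u x * f x

/-- `w ∈ L²(Ω)` is the weak `i`-th partial derivative of `u ∈ L²(Ω)`. -/
def HasWeakDeriv {Ω : TopologicalSpace.Opens E} (i : Fin 2) (u w : L2 Ω) : Prop :=
  ∀ φ : 𝓓(Ω, ℝ), pairing u (pd i φ) = -pairing w φ

/-- `f ∈ L²(Ω)` is the weak `div div` of the matrix field `τ` with entries in `L²(Ω)`:
`∫ τ : ∇²φ = ∫ f φ` for all test functions `φ`. -/
def HasWeakDivDiv {Ω : TopologicalSpace.Opens E} (τ : Matrix (Fin 2) (Fin 2) (L2 Ω))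
    (f : L2 Ω) : Prop :=
  ∀ φ : 𝓓(Ω, ℝ), ∑ i, ∑ j, pairing (τ i j) (pd i (pd j φ)) = pairing f φ

theorem contDiff_pd {i : Fin 2} {f : E → ℝ} (hf : ContDiff ℝ ∞ f) : ContDiff ℝ ∞ (pd i f) :=
  (hf.fderiv_right (m := ∞) (by simp)).clm_apply contDiff_const

theorem hasCompactSupport_pd {i : Fin 2} {f : E → ℝ} (hf : HasCompactSupport f) :
    HasCompactSupport (pd i f) :=
  hf.fderiv_apply (𝕜 := ℝ) (EuclideanSpace.single i 1)

section pairing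

variable {Ω : TopologicalSpace.Opens E}

theorem integrable_pairing (u : L2 Ω) {f : E → ℝ} (hf : Continuous f)
    (hs : HasCompactSupport f) :
    Integrable (fun x => u x * f x) ((volume : Measure E).restrict Ω) :=
  MemLp.integrable_mul (Lp.memLp u) ((hf.memLp_of_hasCompactSupport (p := 2) hs).restrict Ω)

theorem pairing_add (u w : L2 Ω) {f : E → ℝ} (hf : Continuous f) (hs : HasCompactSupport f) :
    pairing (u + w) f = pairing u f + pairing w f := by
  unfold pairing
  rw [← integral_add (integrable_pairing u hf hs) (integrable_pairing w hf hs)]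
  refine integral_congr_ae ?_
  filter_upwards [Lp.coeFn_add u w] with x hx
  rw [hx, Pi.add_apply, add_mul]

theorem pairing_smul (c : ℝ) (u : L2 Ω) (f : E → ℝ) :
    pairing (c • u) f = c * pairing u f := by
  unfold pairing
  rw [← integral_const_mul]
  refine integral_congr_ae ?_
  filter_upwards [Lp.coeFn_smul c u] with x hx
  rw [hx, Pi.smul_apply, smul_eq_mul, mul_assoc]

theorem pairing_zero (f : E → ℝ) : pairing (0 : L2 Ω) f = 0 := by
  simpa using pairing_smul (0 : ℝ) (0 : L2 Ω) f

theorem eq_of_pairing_eq {u w : L2 Ω} (h : ∀ φ : 𝓓(Ω, ℝ), pairing u φ = pairing w φ) :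
    u = w := by
  have key : ∀ᵐ x ∂(volume : Measure E), x ∈ (Ω : Set E) → (u x - w x) = 0 := by
    refine Ω.isOpen.ae_eq_zero_of_integral_contDiff_smul_eq_zero ?_ ?_
    · have h1 : LocallyIntegrable (fun x => u x - w x) ((volume : Measure E).restrict Ω) :=
        ((Lp.memLp u).sub (Lp.memLp w)).locallyIntegrable (by norm_num)
      exact locallyIntegrableOn_of_locallyIntegrable_restrict h1
    · intro g hg hc hsub
      have := h ⟨g, hg, hc, hsub⟩
      have e : ∫ x in (Ω : Set E), g x • (u x - w x) = 0 := by
        have e1 : ∀ x, g x • (u x - w x) = u x * g x - w x * g x := fun x => by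
          simp only [smul_eq_mul]; ring
        simp only [e1]
        rw [integral_sub (integrable_pairing u hg.continuous hc)
          (integrable_pairing w hg.continuous hc), sub_eq_zero]
        exact this
      rw [← e]
      refine (setIntegral_eq_integral_of_forall_compl_eq_zero fun x hx => ?_).symm
      have : g x = 0 := by
        by_contra hne
        exact hx (hsub (subset_tsupport g hne))
      simp [this]
  refine Lp.ext ?_
  rw [Filter.EventuallyEq, ae_restrict_iff' Ω.isOpen.measurableSet]
  filter_upwards [key] with x hx hxΩ
  exact sub_eq_zero.mp (hx hxΩ)

theorem HasWeakDeriv.unique {i : Fin 2} {u w w' : L2 Ω} (h : HasWeakDeriv i u w)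
    (h' : HasWeakDeriv i u w') : w = w' :=
  eq_of_pairing_eq fun φ => neg_injective ((h φ).symm.trans (h' φ))

theorem HasWeakDeriv.add {i : Fin 2} {u w u' w' : L2 Ω} (h : HasWeakDeriv i u w)
    (h' : HasWeakDeriv i u' w') : HasWeakDeriv i (u + u') (w + w') := fun φ => by
  rw [pairing_add u u' (contDiff_pd φ.contDiff).continuous
      (hasCompactSupport_pd φ.hasCompactSupport),
    pairing_add w w' φ.continuous φ.hasCompactSupport, h φ, h' φ, neg_add]

theorem HasWeakDeriv.smul {i : Fin 2} {u w : L2 Ω} (c : ℝ) (h : HasWeakDeriv i u w) :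
    HasWeakDeriv i (c • u) (c • w) := fun φ => by
  rw [pairing_smul, pairing_smul, h φ, mul_neg]

theorem HasWeakDeriv.zero {i : Fin 2} : HasWeakDeriv i (0 : L2 Ω) 0 := fun φ => by
  rw [pairing_zero, pairing_zero, neg_zero]

theorem HasWeakDivDiv.unique {τ : Matrix (Fin 2) (Fin 2) (L2 Ω)} {f f' : L2 Ω}
    (h : HasWeakDivDiv τ f) (h' : HasWeakDivDiv τ f') : f = f' :=
  eq_of_pairing_eq fun φ => (h φ).symm.trans (h' φ)

theorem HasWeakDivDiv.add {τ τ' : Matrix (Fin 2) (Fin 2) (L2 Ω)} {f f' : L2 Ω}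
    (h : HasWeakDivDiv τ f) (h' : HasWeakDivDiv τ' f') :
    HasWeakDivDiv (τ + τ') (f + f') := fun φ => by
  rw [pairing_add f f' φ.continuous φ.hasCompactSupport, ← h φ, ← h' φ]
  simp only [← Finset.sum_add_distrib]
  refine Finset.sum_congr rfl fun i _ => Finset.sum_congr rfl fun j _ => ?_
  exact pairing_add _ _ (contDiff_pd (contDiff_pd φ.contDiff)).continuous
    (hasCompactSupport_pd (hasCompactSupport_pd φ.hasCompactSupport))

theorem HasWeakDivDiv.smul {τ : Matrix (Fin 2) (Fin 2) (L2 Ω)} {f : L2 Ω} (c : ℝ)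
    (h : HasWeakDivDiv τ f) : HasWeakDivDiv (c • τ) (c • f) := fun φ => by
  rw [pairing_smul, ← h φ]
  simp only [Finset.mul_sum]
  exact Finset.sum_congr rfl fun i _ => Finset.sum_congr rfl fun j _ => pairing_smul _ _ _

theorem HasWeakDivDiv.zero :
    HasWeakDivDiv (0 : Matrix (Fin 2) (Fin 2) (L2 Ω)) 0 := fun φ => by
  simp [pairing_zero]

end pairing

/-- The Sobolev space `H¹(Ω; ℝ²)`. -/
def H1Vec (Ω : TopologicalSpace.Opens E) : Submodule ℝ (Fin 2 → L2 Ω) where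
  carrier := {v | ∀ i j, ∃ w, HasWeakDeriv j (v i) w}
  add_mem' h h' i j := ⟨_, (h i j).choose_spec.add (h' i j).choose_spec⟩
  zero_mem' _ _ := ⟨0, HasWeakDeriv.zero⟩
  smul_mem' c _ h i j := ⟨_, (h i j).choose_spec.smul c⟩

/-- The weak gradient on `H¹(Ω; ℝ²)`: `(∇v)ᵢⱼ = ∂ⱼ vᵢ`. -/
def weakGrad (Ω : TopologicalSpace.Opens E) :
    H1Vec Ω →ₗ[ℝ] Matrix (Fin 2) (Fin 2) (L2 Ω) where
  toFun v := Matrix.of fun i j => (v.2 i j).choose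
  map_add' v w := by
    ext1 i j
    exact ((v + w).2 i j).choose_spec.unique ((v.2 i j).choose_spec.add (w.2 i j).choose_spec)
  map_smul' c v := by
    ext1 i j
    exact ((c • v).2 i j).choose_spec.unique ((v.2 i j).choose_spec.smul c)

/-- `sym curl` on `H¹(Ω; ℝ²)`. -/
def symCurl (Ω : TopologicalSpace.Opens E) :
    H1Vec Ω →ₗ[ℝ] Matrix (Fin 2) (Fin 2) (L2 Ω) := symRot (L2 Ω) ∘ₗ weakGrad Ω

/-- `H(div div, Ω; 𝕊)`. -/
def HDivDiv (Ω : TopologicalSpace.Opens E) : Submodule ℝ (Matrix (Fin 2) (Fin 2) (L2 Ω)) where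
  carrier := {τ | τ.IsSymm ∧ ∃ f, HasWeakDivDiv τ f}
  add_mem' h h' := ⟨h.1.add h'.1, _, h.2.choose_spec.add h'.2.choose_spec⟩
  zero_mem' := ⟨Matrix.isSymm_zero, 0, HasWeakDivDiv.zero⟩
  smul_mem' c _ h := ⟨h.1.smul c, _, h.2.choose_spec.smul c⟩

/-- The operator `div div` on `H(div div, Ω; 𝕊)`. -/
def divDiv (Ω : TopologicalSpace.Opens E) : HDivDiv Ω →ₗ[ℝ] L2 Ω where
  toFun τ := τ.2.2.choose
  map_add' σ τ := (σ + τ).2.2.choose_spec.unique (σ.2.2.choose_spec.add τ.2.2.choose_spec)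
  map_smul' c τ := (c • τ).2.2.choose_spec.unique (τ.2.2.choose_spec.smul c)

/-! ### Domain and triangulation -/

/-- A bounded Lipschitz domain in the plane: a bounded connected open set that, near each boundary
point and in suitable Cartesian coordinates, lies below the graph of a Lipschitz function. -/
structure IsLipschitzDomain (Ω : TopologicalSpace.Opens E) : Prop where
  isConnected : IsConnected (Ω : Set E)
  isBounded : Bornology.IsBounded (Ω : Set E)
  boundary : ∀ x ∈ frontier (Ω : Set E), ∃ U ∈ 𝓝 x, ∃ (Φ : E ≃ᵃⁱ[ℝ] E) (g : ℝ → ℝ) (L : ℝ≥0),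
    LipschitzWith L g ∧ ∀ y ∈ U, y ∈ Ω ↔ (Φ y) 1 < g ((Φ y) 0)

/-- A (conforming) triangulation of `Ω`: a finite simplicial complex in the plane with underlying
space the closure of `Ω`. -/
structure Triangulation (Ω : TopologicalSpace.Opens E) where
  complex : Geometry.SimplicialComplex ℝ E
  finite_faces : complex.faces.Finite
  space_eq : complex.space = closure (Ω : Set E)

namespace Triangulation

variable {Ω : TopologicalSpace.Opens E}

/-- The triangles of the triangulation, given by their vertices. -/
def triangles (𝒯 : Triangulation Ω) : Set (Finset E) := {T ∈ 𝒯.complex.faces | T.card = 3}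

end Triangulation

/-! ### The finite element spaces -/

section spaces

variable {Ω : TopologicalSpace.Opens E}

/-- The restriction of `u ∈ L²(Ω)` to the triangle with vertices `T` is the polynomial `p`. -/
def EqOn (T : Finset E) (u : L2 Ω) (p : Poly) : Prop :=
  ∀ᵐ x ∂((volume : Measure E).restrict Ω), x ∈ convexHull ℝ (T : Set E) → u x = ev x p

theorem EqOn.add {T : Finset E} {u w : L2 Ω} {p q : Poly} (h : EqOn T u p) (h' : EqOn T w q) :
    EqOn T (u + w) (p + q) := by
  filter_upwards [h, h', Lp.coeFn_add u w] with x hx hx' hs hT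
  rw [hs, Pi.add_apply, hx hT, hx' hT, ev_add]

theorem EqOn.smul {T : Finset E} {u : L2 Ω} {p : Poly} (c : ℝ) (h : EqOn T u p) :
    EqOn T (c • u) (c • p) := by
  filter_upwards [h, Lp.coeFn_smul c u] with x hx hs hT
  rw [hs, Pi.smul_apply, hx hT, ev_smul, smul_eq_mul]

theorem EqOn.zero {T : Finset E} : EqOn T (0 : L2 Ω) 0 := by
  filter_upwards [Lp.coeFn_zero ℝ 2 ((volume : Measure E).restrict Ω)] with x hx _
  rw [hx, Pi.zero_apply, ev_zero]

/-- `RT`, the lowest order Raviart-Thomas space `{c + b x : c ∈ ℝ², b ∈ ℝ}` on `Ω`. -/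
def RT (Ω : TopologicalSpace.Opens E) : Submodule ℝ (Fin 2 → L2 Ω) where
  carrier := {v | ∃ (c : Fin 2 → ℝ) (b : ℝ),
    ∀ i, ∀ᵐ x ∂((volume : Measure E).restrict Ω), v i x = c i + b * x i}
  add_mem' := by
    rintro v w ⟨c, b, h⟩ ⟨c', b', h'⟩
    refine ⟨c + c', b + b', fun i => ?_⟩
    filter_upwards [h i, h' i, Lp.coeFn_add (v i) (w i)] with x hx hx' hs
    rw [Pi.add_apply, hs, Pi.add_apply, hx, hx', Pi.add_apply]
    ring
  zero_mem' := by
    refine ⟨0, 0, fun i => ?_⟩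
    filter_upwards [Lp.coeFn_zero ℝ 2 ((volume : Measure E).restrict Ω)] with x hx
    rw [Pi.zero_apply, hx]
    simp
  smul_mem' := by
    rintro r v ⟨c, b, h⟩
    refine ⟨r • c, r * b, fun i => ?_⟩
    filter_upwards [h i, Lp.coeFn_smul r (v i)] with x hx hs
    rw [Pi.smul_apply, hs, Pi.smul_apply, hx, Pi.smul_apply, smul_eq_mul, smul_eq_mul]
    ring

/-- `V_h`: the fields `v ∈ H¹(Ω; ℝ²)` that are polynomials of degree at most `k + 1` on each triangle
and have single-valued degrees of freedom: at a common vertex or on a common edge of two triangles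
the degrees of freedom taken from both sides agree. (The degrees of freedom in the interior of a
triangle belong to one triangle only and are always single-valued.) -/
def Vh (k : ℕ) (𝒯 : Triangulation Ω) : Submodule ℝ (Fin 2 → L2 Ω) where
  carrier := {v | v ∈ H1Vec Ω ∧ ∃ p : Finset E → Fin 2 → Poly,
    (∀ T ∈ 𝒯.triangles, p T ∈ PVec (k + 1) ∧ ∀ i, EqOn T (v i) (p T i)) ∧
    ∀ T ∈ 𝒯.triangles, ∀ T' ∈ 𝒯.triangles, VDofsAgree k ((T : Set E) ∩ T') (p T) (p T')}
  add_mem' := by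
    rintro v w ⟨hv, p, hp, hd⟩ ⟨hw, q, hq, he⟩
    exact ⟨(H1Vec Ω).add_mem hv hw, p + q,
      fun T hT => ⟨(PVec (k + 1)).add_mem (hp T hT).1 (hq T hT).1,
        fun i => ((hp T hT).2 i).add ((hq T hT).2 i)⟩,
      fun T hT T' hT' => (hd T hT T' hT').add (he T hT T' hT')⟩
  zero_mem' := ⟨(H1Vec Ω).zero_mem, 0,
    fun _ _ => ⟨(PVec (k + 1)).zero_mem, fun _ => EqOn.zero⟩,
    fun _ _ _ _ => VDofsAgree.refl _ _ _⟩
  smul_mem' := by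
    rintro c v ⟨hv, p, hp, hd⟩
    exact ⟨(H1Vec Ω).smul_mem c hv, c • p,
      fun T hT => ⟨(PVec (k + 1)).smul_mem c (hp T hT).1, fun i => ((hp T hT).2 i).smul c⟩,
      fun T hT T' hT' => (hd T hT T' hT').smul c⟩

/-- `Σ_k`: the fields `τ ∈ H(div div, Ω; 𝕊)` that are polynomials of degree at most `k` on each
triangle and have single-valued degrees of freedom (as for `Vh`). -/
def Sh (k : ℕ) (𝒯 : Triangulation Ω) : Submodule ℝ (Matrix (Fin 2) (Fin 2) (L2 Ω)) where
  carrier := {τ | τ ∈ HDivDiv Ω ∧ ∃ p : Finset E → Matrix (Fin 2) (Fin 2) Poly,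
    (∀ T ∈ 𝒯.triangles, p T ∈ PSym k ∧ ∀ i j, EqOn T (τ i j) (p T i j)) ∧
    ∀ T ∈ 𝒯.triangles, ∀ T' ∈ 𝒯.triangles, SDofsAgree k ((T : Set E) ∩ T') (p T) (p T')}
  add_mem' := by
    rintro v w ⟨hv, p, hp, hd⟩ ⟨hw, q, hq, he⟩
    exact ⟨(HDivDiv Ω).add_mem hv hw, p + q,
      fun T hT => ⟨(PSym k).add_mem (hp T hT).1 (hq T hT).1,
        fun i j => ((hp T hT).2 i j).add ((hq T hT).2 i j)⟩,
      fun T hT T' hT' => (hd T hT T' hT').add (he T hT T' hT')⟩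
  zero_mem' := ⟨(HDivDiv Ω).zero_mem, 0,
    fun _ _ => ⟨(PSym k).zero_mem, fun _ _ => EqOn.zero⟩,
    fun _ _ _ _ => SDofsAgree.refl _ _ _⟩
  smul_mem' := by
    rintro c v ⟨hv, p, hp, hd⟩
    exact ⟨(HDivDiv Ω).smul_mem c hv, c • p,
      fun T hT => ⟨(PSym k).smul_mem c (hp T hT).1, fun i j => ((hp T hT).2 i j).smul c⟩,
      fun T hT T' hT' => (hd T hT T' hT').smul c⟩

/-- `P_h`: the functions in `L²(Ω)` that are polynomials of degree at most `k - 2` on each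
triangle. -/
def Ph (k : ℕ) (𝒯 : Triangulation Ω) : Submodule ℝ (L2 Ω) where
  carrier := {q | ∀ T ∈ 𝒯.triangles, ∃ p ∈ P (k - 2), EqOn T q p}
  add_mem' h h' T hT := by
    obtain ⟨p, hp, hq⟩ := h T hT
    obtain ⟨p', hp', hq'⟩ := h' T hT
    exact ⟨_, (P (k - 2)).add_mem hp hp', hq.add hq'⟩
  zero_mem' _ _ := ⟨0, (P (k - 2)).zero_mem, EqOn.zero⟩
  smul_mem' c _ h T hT := by
    obtain ⟨p, hp, hq⟩ := h T hT
    exact ⟨_, (P (k - 2)).smul_mem c hp, hq.smul c⟩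

theorem Vh_le (k : ℕ) (𝒯 : Triangulation Ω) : Vh k 𝒯 ≤ H1Vec Ω := fun _ h => h.1

theorem Sh_le (k : ℕ) (𝒯 : Triangulation Ω) : Sh k 𝒯 ≤ HDivDiv Ω := fun _ h => h.1

/-- `sym curl` on `V_h`. -/
def symCurlVh (k : ℕ) (𝒯 : Triangulation Ω) : Vh k 𝒯 →ₗ[ℝ] Matrix (Fin 2) (Fin 2) (L2 Ω) :=
  symCurl Ω ∘ₗ Submodule.inclusion (Vh_le k 𝒯)

/-- `div div` on `Σ_k`. -/
def divDivSh (k : ℕ) (𝒯 : Triangulation Ω) : Sh k 𝒯 →ₗ[ℝ] L2 Ω :=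
  divDiv Ω ∘ₗ Submodule.inclusion (Sh_le k 𝒯)

end spaces

end DivDiv

end

noncomputable section

namespace DivDiv

/-! The polynomial complex is exact by explicit integration. If `div div σ = 0`, then `div σ` is the
curl of some `ψ`; adding to `σ` a skew matrix built from `ψ` makes both rows divergence free, hence
curls, and taking the symmetric part removes the skew matrix again (`exists_symCurlP_eq`).

The degrees of freedom matter only through traces. A degree count shows that they vanish exactly
when `v`, `∇v` (respectively `σ`) vanish at the vertices and `v`, `div v` (respectively `σn`, `div σ
· n`) vanish on the edges (`VDofsAgree_zero_iff`, `SDofsAgree_zero_iff`). On an edge with tangent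
`t`, up to the length of the edge, `(sym curl v) n = -∂ₜ v + ½ (div v) t` and `div (sym curl v) · n
= -½ ∂ₜ div v`. So the traces of `v` control those of `sym curl v`. Conversely, if the traces of
`sym curl w` vanish, then `w` agrees on the edge, together with its divergence, with one
Raviart–Thomas field, its `germ`. Subtracting this field turns a local potential of a bubble tensor
into a bubble.

Surjectivity onto the bubbles orthogonal to `P₁` takes two steps, `q = div w` and `w = div σ`. In
both, a second order operator weighted by the edge bubbles `bᵢ` is injective on a finite-dimensional
space by an energy argument, hence bijective: a weighted Laplacian `∑ ∂ᵢ (bᵢ ∂ᵢ r)` on mean-free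
polynomials, and a weighted elasticity operator on fields orthogonal to the rigid motions
(`exists_sum_dE_eq`, `exists_rowDivP_tangentTensor_eq`). In between, a multiple of the curl of the
cubic bubble adjusts the rotational moment. The resulting tensor `∑ bᵢ pᵢ tᵢ tᵢᵀ` has no normal
traces.

On the mesh, the kernel of `sym curl` is Raviart–Thomas on each triangle, and agreement at the two
ends of a common edge makes neighbours equal. For exactness in the middle, local potentials differ
on intersections of triangles by Raviart–Thomas fields with three real parameters. Each parameter is
a cocycle, and on a simply connected domain it becomes trivial after subtracting one constant per
triangle (`exists_shift`): the values are expanded in a basis of the finitely generated subgroup of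
`ℝ` they span, and the integer coordinates define maps to the circle `ℝ/ℤ`, which lift to `ℝ`.

For surjectivity of the global `div div`, an element of `P_h` orthogonal to the range is shown to
vanish. Bubble tensors force it to be affine on each triangle; cubic edge tensors supported on two
neighbours force its jump across their edge to vanish together with the normal derivative, so it is
one affine function; a global cubic tensor with this `div div` finally shows that its norm is zero.
-/

/-! ### Evaluation, degrees, derivatives and antiderivatives of polynomials -/

open MvPolynomial in
theorem ev_C (x : E) (c : ℝ) : ev x (C c) = c := by simp [ev]

open MvPolynomial in
theorem ev_X (x : E) (i : Fin 2) : ev x (X i) = x i := by simp [ev]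

theorem ev_one (x : E) : ev x 1 = 1 := by simp [ev]

theorem ev_neg (x : E) (p : Poly) : ev x (-p) = -ev x p := by simp [ev]

theorem ev_sub (x : E) (p q : Poly) : ev x (p - q) = ev x p - ev x q := by simp [ev]

theorem ev_mul (x : E) (p q : Poly) : ev x (p * q) = ev x p * ev x q := by simp [ev]

theorem ev_sum (x : E) {ι : Type*} (s : Finset ι) (f : ι → Poly) :
    ev x (∑ i ∈ s, f i) = ∑ i ∈ s, ev x (f i) := by simp [ev]

theorem mem_P {l : ℕ} {p : Poly} : p ∈ P l ↔ p.totalDegree ≤ l :=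
  MvPolynomial.mem_restrictTotalDegree _ _ _

theorem mem_P_iff_coeff {l : ℕ} {p : Poly} :
    p ∈ P l ↔ ∀ m : Fin 2 →₀ ℕ, l < m 0 + m 1 → p.coeff m = 0 := by
  have hs : ∀ m : Fin 2 →₀ ℕ, (m.sum fun _ e => e) = m 0 + m 1 := fun m => by
    rw [Finsupp.sum_fintype _ _ (fun _ => rfl), Fin.sum_univ_two]
  rw [mem_P, MvPolynomial.totalDegree, Finset.sup_le_iff]
  simp only [hs, MvPolynomial.mem_support_iff]
  exact forall_congr' fun m => by rw [← not_lt]; tauto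

theorem monomial_mem_P {l : ℕ} {m : Fin 2 →₀ ℕ} (c : ℝ) (h : m 0 + m 1 ≤ l) :
    (MvPolynomial.monomial m c : Poly) ∈ P l := by
  rw [mem_P_iff_coeff]
  intro n hn
  rw [MvPolynomial.coeff_monomial, if_neg]
  rintro rfl
  omega

theorem pderiv_mem_P {l : ℕ} {p : Poly} (i : Fin 2) (hp : p ∈ P (l + 1)) :
    MvPolynomial.pderiv i p ∈ P l := by
  rw [mem_P_iff_coeff] at hp ⊢
  intro m hm
  rw [MvPolynomial.coeff_pderiv, hp, zero_mul]
  fin_cases i <;> simp <;> omega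

theorem P_mono {l m : ℕ} (h : l ≤ m) : P l ≤ P m := fun _ hp =>
  mem_P.2 ((mem_P.1 hp).trans h)

theorem mul_mem_P {l m : ℕ} {p q : Poly} (hp : p ∈ P l) (hq : q ∈ P m) : p * q ∈ P (l + m) :=
  mem_P.2 ((MvPolynomial.totalDegree_mul _ _).trans (add_le_add (mem_P.1 hp) (mem_P.1 hq)))

theorem C_mem_P (l : ℕ) (c : ℝ) : (MvPolynomial.C c : Poly) ∈ P l := mem_P.2 (by simp)

theorem X_mem_P (i : Fin 2) : (MvPolynomial.X i : Poly) ∈ P 1 := mem_P.2 (by simp)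

theorem pderiv_pderiv_comm (i j : Fin 2) (p : Poly) :
    MvPolynomial.pderiv i (MvPolynomial.pderiv j p) =
      MvPolynomial.pderiv j (MvPolynomial.pderiv i p) := by
  ext m
  simp only [MvPolynomial.coeff_pderiv]
  fin_cases i <;> fin_cases j <;> simp [add_right_comm] <;> ring

/-- A polynomial whose partial derivatives vanish is constant. -/
theorem eq_C_of_pderiv_eq_zero {p : Poly} (h : ∀ i, MvPolynomial.pderiv i p = 0) :
    ∃ c, p = MvPolynomial.C c := by
  refine ⟨p.coeff 0, ?_⟩
  ext m
  rw [MvPolynomial.coeff_C]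
  split_ifs with hm
  · rw [← hm]
  · obtain ⟨i, hi⟩ : ∃ i, m i ≠ 0 := by
      by_contra! hc
      exact hm (by ext i; simp [hc i])
    have := congrArg (MvPolynomial.coeff (m - Finsupp.single i 1)) (h i)
    rw [MvPolynomial.coeff_pderiv, tsub_add_cancel_of_le
      (by simpa [Finsupp.single_le_iff] using Nat.one_le_iff_ne_zero.2 hi)] at this
    simp only [MvPolynomial.coeff_zero, mul_eq_zero] at this
    refine this.resolve_right ?_
    positivity

/-- The antiderivative of a polynomial with respect to the `i`-th variable. -/
def anti (i : Fin 2) : Poly →ₗ[ℝ] Poly :=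
  (MvPolynomial.basisMonomials (Fin 2) ℝ).constr ℝ fun m =>
    MvPolynomial.monomial (m + Finsupp.single i 1) ((m i + 1 : ℝ)⁻¹)

theorem anti_monomial (i : Fin 2) (m : Fin 2 →₀ ℕ) (c : ℝ) :
    anti i (MvPolynomial.monomial m c) =
      MvPolynomial.monomial (m + Finsupp.single i 1) (c * (m i + 1 : ℝ)⁻¹) := by
  have h := (MvPolynomial.basisMonomials (Fin 2) ℝ).constr_basis ℝ (fun m =>
    MvPolynomial.monomial (m + Finsupp.single i 1) ((m i + 1 : ℝ)⁻¹)) m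
  rw [MvPolynomial.coe_basisMonomials] at h
  have h2 : (MvPolynomial.monomial m c : Poly) = c • MvPolynomial.monomial m 1 := by
    simp [MvPolynomial.smul_monomial]
  rw [h2, map_smul]
  unfold anti
  rw [h, MvPolynomial.smul_monomial, smul_eq_mul]

theorem pderiv_anti_self (i : Fin 2) (p : Poly) : MvPolynomial.pderiv i (anti i p) = p := by
  induction p using MvPolynomial.induction_on' with
  | monomial m c =>
    rw [anti_monomial, MvPolynomial.pderiv_monomial]
    have : (m i + 1 : ℝ) ≠ 0 := by positivity
    simp [this]
  | add p q hp hq => rw [map_add, map_add, hp, hq]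

theorem pderiv_anti_of_ne {i j : Fin 2} (hij : i ≠ j) (p : Poly) :
    MvPolynomial.pderiv j (anti i p) = anti i (MvPolynomial.pderiv j p) := by
  induction p using MvPolynomial.induction_on' with
  | monomial m c =>
    rw [anti_monomial, MvPolynomial.pderiv_monomial, MvPolynomial.pderiv_monomial, anti_monomial]
    by_cases hj : m j = 0
    · simp [hj, hij]
    · have e : m + Finsupp.single i 1 - Finsupp.single j 1 =
          m - Finsupp.single j 1 + Finsupp.single i 1 := by
        ext l
        by_cases hl : l = j
        · subst hl; simp [hij]
        · by_cases hl' : l = i <;> simp [Ne.symm hl, hl', hij.symm]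
      rw [e]
      simp [hij, hij.symm]
      ring_nf
  | add p q hp hq => simp only [map_add, hp, hq]

theorem anti_mem_P {l : ℕ} {p : Poly} (i : Fin 2) (hp : p ∈ P l) : anti i p ∈ P (l + 1) := by
  rw [p.as_sum, map_sum]
  refine Submodule.sum_mem _ fun m hm => ?_
  rw [anti_monomial]
  refine monomial_mem_P _ ?_
  have hm' : m 0 + m 1 ≤ l := by
    by_contra! hc
    exact (MvPolynomial.mem_support_iff.1 hm) (mem_P_iff_coeff.1 hp m hc)
  fin_cases i <;> simp <;> omega

/-- Unpacks the restrictions of domains and codomains once, so that each of the three sequences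
needs only pointwise statements. -/
theorem isExactSeq_of {U W Z : Type*} [AddCommGroup U] [Module ℝ U] [AddCommGroup W] [Module ℝ W]
    [AddCommGroup Z] [Module ℝ Z] {A V : Submodule ℝ U} {S : Submodule ℝ W} {P : Submodule ℝ Z}
    {d₁ : V →ₗ[ℝ] W} {d₂ : S →ₗ[ℝ] Z} (hA : A ≤ V) (h₁ : ∀ v, d₁ v ∈ S) (h₂ : ∀ σ, d₂ σ ∈ P)
    (hker : ∀ v : V, d₁ v = 0 ↔ (v : U) ∈ A) (hcomp : ∀ v, d₂ ⟨d₁ v, h₁ v⟩ = 0)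
    (hex : ∀ σ : S, d₂ σ = 0 → ∃ v, d₁ v = σ) (hsurj : ∀ q ∈ P, ∃ σ, d₂ σ = q) :
    IsExactSeq A V S P d₁ d₂ := by
  refine ⟨hA, h₁, h₂, fun v => ?_, fun σ => ?_, fun q => ?_⟩
  · rw [Subtype.ext_iff, LinearMap.codRestrict_apply, ZeroMemClass.coe_zero, hker]
    constructor
    · exact fun h => ⟨⟨v, h⟩, rfl⟩
    · rintro ⟨w, rfl⟩
      exact w.2
  · rw [Subtype.ext_iff, LinearMap.codRestrict_apply, ZeroMemClass.coe_zero]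
    constructor
    · intro h
      obtain ⟨v, hv⟩ := hex σ h
      exact ⟨v, Subtype.ext hv⟩
    · rintro ⟨v, rfl⟩
      exact hcomp v
  · obtain ⟨σ, hσ⟩ := hsurj q q.2
    exact ⟨σ, Subtype.ext hσ⟩

/-! ### Differential identities and the exact polynomial complex -/

section operators

open MvPolynomial

theorem symCurlP_zero_zero (v : Fin 2 → Poly) : symCurlP v 0 0 = -pderiv 1 (v 0) := by
  simp [symCurlP, symRot, gradP]
  module

theorem symCurlP_one_one (v : Fin 2 → Poly) : symCurlP v 1 1 = pderiv 0 (v 1) := by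
  simp [symCurlP, symRot, gradP]
  module

theorem symCurlP_zero_one (v : Fin 2 → Poly) :
    symCurlP v 0 1 = (1 / 2 : ℝ) • (pderiv 0 (v 0) - pderiv 1 (v 1)) := by
  simp [symCurlP, symRot, gradP]
  module

theorem symCurlP_one_zero (v : Fin 2 → Poly) :
    symCurlP v 1 0 = (1 / 2 : ℝ) • (pderiv 0 (v 0) - pderiv 1 (v 1)) := by
  simp [symCurlP, symRot, gradP]
  module

theorem divP_apply (v : Fin 2 → Poly) : divP v = pderiv 0 (v 0) + pderiv 1 (v 1) := by
  simp [divP]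

theorem rowDivP_apply (σ : Matrix (Fin 2) (Fin 2) Poly) (i : Fin 2) :
    rowDivP σ i = pderiv 0 (σ i 0) + pderiv 1 (σ i 1) := divP_apply _

theorem divDivP_apply (σ : Matrix (Fin 2) (Fin 2) Poly) :
    divDivP σ = pderiv 0 (pderiv 0 (σ 0 0) + pderiv 1 (σ 0 1)) +
      pderiv 1 (pderiv 0 (σ 1 0) + pderiv 1 (σ 1 1)) := by
  simp only [divDivP, LinearMap.comp_apply, divP_apply, rowDivP_apply]

theorem matrix_ext_fin_two {M : Type*} {A B : Matrix (Fin 2) (Fin 2) M} (h00 : A 0 0 = B 0 0)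
    (h01 : A 0 1 = B 0 1) (h10 : A 1 0 = B 1 0) (h11 : A 1 1 = B 1 1) : A = B := by
  ext i j
  fin_cases i <;> fin_cases j <;> assumption

theorem pderiv_smul (i : Fin 2) (c : ℝ) (p : Poly) : pderiv i (c • p) = c • pderiv i p :=
  (pderiv i : Derivation ℝ Poly Poly).map_smul c p

/-- `div sym curl = ½ curl div` -/
theorem rowDivP_symCurlP_zero (v : Fin 2 → Poly) :
    rowDivP (symCurlP v) 0 = -((1 / 2 : ℝ) • pderiv 1 (divP v)) := by
  rw [rowDivP_apply, symCurlP_zero_zero, symCurlP_zero_one, divP_apply]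
  simp only [map_neg, map_add, map_sub, pderiv_smul]
  rw [pderiv_pderiv_comm 1 0]
  module

theorem rowDivP_symCurlP_one (v : Fin 2 → Poly) :
    rowDivP (symCurlP v) 1 = (1 / 2 : ℝ) • pderiv 0 (divP v) := by
  rw [rowDivP_apply, symCurlP_one_zero, symCurlP_one_one, divP_apply]
  simp only [map_add, map_sub, pderiv_smul]
  rw [pderiv_pderiv_comm 1 0]
  module

/-- Since `div sym curl` is half of `curl div`, what remains is a divergence of a curl. -/
theorem divDivP_symCurlP (v : Fin 2 → Poly) : divDivP (symCurlP v) = 0 := by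
  have : divDivP (symCurlP v) = divP (rowDivP (symCurlP v)) := rfl
  rw [this, divP_apply, rowDivP_symCurlP_zero, rowDivP_symCurlP_one]
  simp only [map_neg, pderiv_smul]
  rw [pderiv_pderiv_comm 1 0]
  module

theorem mem_RTPoly {v : Fin 2 → Poly} :
    v ∈ RTPoly ↔ ∃ (c : Fin 2 → ℝ) (b : ℝ), ∀ i, v i = C (c i) + b • X i := Iff.rfl

/-- The equations are `∂_y v₀ = 0`, `∂_x v₁ = 0`, `∂_x v₀ = ∂_y v₁`. The common value of the last
two derivatives depends on neither variable, so it is a constant `b`, and `v - b x` has zero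
gradient. -/
theorem symCurlP_eq_zero_iff (v : Fin 2 → Poly) : symCurlP v = 0 ↔ v ∈ RTPoly := by
  rw [mem_RTPoly]
  constructor
  · intro h
    have h00 : pderiv 1 (v 0) = 0 := by
      simpa [symCurlP_zero_zero] using congrFun (congrFun h 0) 0
    have h11 : pderiv 0 (v 1) = 0 := by
      simpa [symCurlP_one_one] using congrFun (congrFun h 1) 1
    have h01 : pderiv 0 (v 0) = pderiv 1 (v 1) := by
      simpa [symCurlP_zero_one, sub_eq_zero] using congrFun (congrFun h 0) 1
    obtain ⟨b, hb⟩ : ∃ b, pderiv 0 (v 0) = C b := by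
      refine eq_C_of_pderiv_eq_zero fun i => ?_
      fin_cases i
      · simp only [Fin.zero_eta]
        rw [h01, pderiv_pderiv_comm, h11, map_zero]
      · simp only [Fin.mk_one]
        rw [pderiv_pderiv_comm, h00, map_zero]
    have key : ∀ i, ∃ c, v i - b • X i = C c := fun i => by
      refine eq_C_of_pderiv_eq_zero fun j => ?_
      rw [map_sub, pderiv_smul]
      fin_cases i <;> fin_cases j
      · simp [hb, smul_eq_C_mul]
      · simp [h00]
      · simp [h11]
      · simp [← h01, hb, smul_eq_C_mul]
    choose c hc using key
    exact ⟨c, b, fun i => by rw [← hc i]; abel⟩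
  · rintro ⟨c, b, h⟩
    refine matrix_ext_fin_two ?_ ?_ ?_ ?_
    · simp [symCurlP_zero_zero, h]
    · simp [symCurlP_zero_one, h]
    · simp [symCurlP_one_zero, h]
    · simp [symCurlP_one_one, h]

/-- A divergence free polynomial vector field is a curl. -/
theorem exists_curl_eq {l : ℕ} {w₀ w₁ : Poly} (h₀ : w₀ ∈ P l) (h₁ : w₁ ∈ P l)
    (h : pderiv 0 w₀ + pderiv 1 w₁ = 0) :
    ∃ ψ ∈ P (l + 1), -pderiv 1 ψ = w₀ ∧ pderiv 0 ψ = w₁ := by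
  -- `anti 0 w₁` already solves the second equation. The defect `r` in the first does not depend on
  -- `x`, so integrating it in `y` repairs the first equation without disturbing the second.
  set r := -pderiv 1 (anti 0 w₁) - w₀ with hr
  have hr0 : pderiv 0 r = 0 := by
    rw [hr, map_sub, map_neg, pderiv_pderiv_comm, pderiv_anti_self]
    linear_combination -h
  refine ⟨anti 0 w₁ + anti 1 r, ?_, ?_, ?_⟩
  · refine (P _).add_mem (anti_mem_P 0 h₁) (anti_mem_P 1 ?_)
    exact (P _).sub_mem ((P _).neg_mem (pderiv_mem_P 1 (anti_mem_P 0 h₁))) h₀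
  · rw [map_add, pderiv_anti_self, hr]
    ring
  · rw [map_add, pderiv_anti_self, pderiv_anti_of_ne (by decide), hr0, map_zero, add_zero]

theorem mem_PVec {l : ℕ} {v : Fin 2 → Poly} : v ∈ PVec l ↔ ∀ i, v i ∈ P l := by
  simp [PVec, Submodule.mem_pi]

theorem symCurlP_mem_PSym {l : ℕ} {v : Fin 2 → Poly} (hv : v ∈ PVec (l + 1)) :
    symCurlP v ∈ PSym l := by
  have h : ∀ i j, pderiv j (v i) ∈ P l := fun i j => pderiv_mem_P j (mem_PVec.1 hv i)
  refine ⟨?_, fun i j => ?_⟩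
  · refine matrix_ext_fin_two rfl ?_ ?_ rfl <;>
      simp only [Matrix.transpose_apply, symCurlP_zero_one, symCurlP_one_zero]
  · fin_cases i <;> fin_cases j
    · exact symCurlP_zero_zero v ▸ (P l).neg_mem (h 0 1)
    · exact symCurlP_zero_one v ▸ (P l).smul_mem _ ((P l).sub_mem (h 0 0) (h 1 1))
    · exact symCurlP_one_zero v ▸ (P l).smul_mem _ ((P l).sub_mem (h 0 0) (h 1 1))
    · exact symCurlP_one_one v ▸ h 1 0

theorem rowDivP_mem {l : ℕ} {σ : Matrix (Fin 2) (Fin 2) Poly} (h : ∀ i j, σ i j ∈ P (l + 1)) :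
    rowDivP σ ∈ PVec l :=
  mem_PVec.2 fun i => rowDivP_apply σ i ▸
    (P l).add_mem (pderiv_mem_P 0 (h i 0)) (pderiv_mem_P 1 (h i 1))

theorem divP_mem {l : ℕ} {v : Fin 2 → Poly} (h : v ∈ PVec (l + 1)) : divP v ∈ P l :=
  divP_apply v ▸ (P l).add_mem (pderiv_mem_P 0 (mem_PVec.1 h 0)) (pderiv_mem_P 1 (mem_PVec.1 h 1))

theorem divDivP_mem {l : ℕ} {σ : Matrix (Fin 2) (Fin 2) Poly} (h : ∀ i j, σ i j ∈ P (l + 2)) :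
    divDivP σ ∈ P l := divP_mem (rowDivP_mem h)

/-- With `div σ = curl ψ`, the matrix with off-diagonal entries `σ₀₁ + ψ` and `σ₁₀ - ψ` has
divergence-free rows. These are curls of some `v₀`, `v₁`, and the symmetric part of the matrix is
`σ`. -/
theorem exists_symCurlP_eq {l : ℕ} {σ : Matrix (Fin 2) (Fin 2) Poly} (hσ : σ ∈ PSym (l + 1))
    (h : divDivP σ = 0) : ∃ v ∈ PVec (l + 2), symCurlP v = σ := by
  have hrow := mem_PVec.1 (rowDivP_mem hσ.2)
  rw [divDivP_apply, ← rowDivP_apply, ← rowDivP_apply] at h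
  obtain ⟨ψ, hψ, h0, h1⟩ := exists_curl_eq (hrow 0) (hrow 1) h
  rw [rowDivP_apply] at h0 h1
  obtain ⟨v₀, hv₀, e00, e01⟩ := exists_curl_eq (hσ.2 0 0) ((P _).add_mem (hσ.2 0 1) hψ)
    (by rw [map_add]; linear_combination -h0)
  obtain ⟨v₁, hv₁, e10, e11⟩ := exists_curl_eq ((P _).sub_mem (hσ.2 1 0) hψ) (hσ.2 1 1)
    (by rw [map_sub]; linear_combination -h1)
  have hs : σ 1 0 = σ 0 1 := hσ.1.apply 0 1
  have e : pderiv 0 v₀ - pderiv 1 v₁ = (2 : ℝ) • σ 0 1 := by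
    rw [e01, sub_eq_add_neg, e10, hs, two_smul]
    ring
  refine ⟨![v₀, v₁], mem_PVec.2 fun i => by fin_cases i <;> assumption, ?_⟩
  refine matrix_ext_fin_two ?_ ?_ ?_ ?_
  · simpa [symCurlP_zero_zero] using e00
  · simp [symCurlP_zero_one, e, smul_smul]
  · simp [symCurlP_one_zero, e, smul_smul, hs]
  · simpa [symCurlP_one_one] using e11

theorem exists_divDivP_eq {l : ℕ} {q : Poly} (hq : q ∈ P l) :
    ∃ σ ∈ PSym (l + 2), divDivP σ = q := by
  refine ⟨!![anti 0 (anti 0 q), 0; 0, 0], ⟨matrix_ext_fin_two rfl rfl rfl rfl, fun i j => ?_⟩, ?_⟩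
  · fin_cases i <;> fin_cases j
    · exact anti_mem_P 0 (anti_mem_P 0 hq)
    all_goals exact (P _).zero_mem
  · simp [divDivP_apply, pderiv_anti_self]

theorem RTPoly_le_PVec (l : ℕ) : RTPoly ≤ PVec (l + 1) := by
  rintro v ⟨c, b, h⟩
  refine mem_PVec.2 fun i => h i ▸ (P _).add_mem (C_mem_P _ _) ((P _).smul_mem _ ?_)
  exact P_mono (by omega) (X_mem_P i)

theorem isExactSeq_polynomial {k : ℕ} (hk : 3 ≤ k) :
    IsExactSeq RTPoly (PVec (k + 1)) (PSym k) (P (k - 2)) (symCurlP.domRestrict (PVec (k + 1)))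
      (divDivP.domRestrict (PSym k)) := by
  obtain ⟨l, rfl⟩ : ∃ l, k = l + 2 := ⟨k - 2, by omega⟩
  refine isExactSeq_of (RTPoly_le_PVec _) (fun v => symCurlP_mem_PSym v.2)
    (fun σ => divDivP_mem σ.2.2) (fun v => symCurlP_eq_zero_iff _) (fun v => divDivP_symCurlP _)
    (fun σ h => ?_) fun q hq => ?_
  · obtain ⟨v, hv, e⟩ := exists_symCurlP_eq σ.2 h
    exact ⟨⟨v, hv⟩, e⟩
  · obtain ⟨σ, hσ, e⟩ := exists_divDivP_eq hq
    exact ⟨⟨σ, hσ⟩, e⟩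

end operators

/-! ### Traces on an edge and their moments -/

section edges

open Polynomial

/-- The restriction of a polynomial to the line through `a` and `b`, parametrized by `lineMap a b`. -/
def res (a b : E) : Poly →ₐ[ℝ] ℝ[X] :=
  MvPolynomial.aeval fun i => C (a i) + X * C (b i - a i)

theorem eval_res (a b : E) (s : ℝ) (p : Poly) :
    (res a b p).eval s = ev (AffineMap.lineMap a b s) p := by
  have h : ((Polynomial.aeval s).comp (res a b) : Poly →ₐ[ℝ] ℝ) =
      MvPolynomial.aeval fun i => (AffineMap.lineMap a b s : E) i := by
    refine MvPolynomial.algHom_ext fun i => ?_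
    simp [res, AffineMap.lineMap_apply]
    ring
  have h2 := DFunLike.congr_fun h p
  simpa [ev, MvPolynomial.aeval_eq_eval] using h2

theorem eval_zero_res (a b : E) (p : Poly) : (res a b p).eval 0 = ev a p := by simp [eval_res]

theorem eval_one_res (a b : E) (p : Poly) : (res a b p).eval 1 = ev b p := by simp [eval_res]

theorem natDegree_res_le {l : ℕ} {p : Poly} (a b : E) (hp : p ∈ P l) :
    (res a b p).natDegree ≤ l := by
  have h1 : ∀ i, (C (a i) + X * C (b i - a i) : ℝ[X]).natDegree ≤ 1 := fun i =>
    (natDegree_add_le _ _).trans (max_le (by simp) ((natDegree_mul_C_le _ _).trans natDegree_X_le))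
  exact (MvPolynomial.aeval_natDegree_le p (mem_P.1 hp) _ h1).trans (mul_one l).le

/-- The directional derivative `t₀ ∂₀ + t₁ ∂₁`. -/
def dirD (t : Fin 2 → ℝ) : Derivation ℝ Poly Poly :=
  t 0 • MvPolynomial.pderiv 0 + t 1 • MvPolynomial.pderiv 1

theorem dirD_apply (t : Fin 2 → ℝ) (p : Poly) :
    dirD t p = t 0 • MvPolynomial.pderiv 0 p + t 1 • MvPolynomial.pderiv 1 p := rfl

theorem derivative_res (a b : E) (p : Poly) :
    derivative (res a b p) = res a b (dirD (fun i => b i - a i) p) := by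
  induction p using MvPolynomial.induction_on with
  | C c => simp [res]
  | add p q hp hq => simp only [map_add, hp, hq]
  | mul_X p i hp =>
    rw [map_mul, derivative_mul, hp, Derivation.leibniz]
    have h : derivative (res a b (MvPolynomial.X i)) =
        res a b (dirD (fun i => b i - a i) (MvPolynomial.X i)) := by
      fin_cases i <;> simp [res, dirD_apply, smul_eq_C_mul]
    rw [h, map_add, smul_eq_mul, smul_eq_mul, map_mul, map_mul]
    ring

/-- Some coordinate is not constant along the edge; normalised, it restricts to the edge parameter.
Hence testing with bivariate polynomials on an edge is as strong as testing with all univariate ones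
of the same degree. -/
theorem exists_res_eq {a b : E} (hab : a ≠ b) {l : ℕ} {q : ℝ[X]} (hq : q.natDegree ≤ l) :
    ∃ p ∈ P l, res a b p = q := by
  obtain ⟨ℓ, hℓ, e⟩ : ∃ ℓ ∈ P 1, res a b ℓ = X := by
    obtain ⟨i, hi⟩ : ∃ i, b i - a i ≠ 0 := by
      by_contra! h
      exact hab (by ext i; linarith [h i])
    refine ⟨(b i - a i)⁻¹ • (MvPolynomial.X i - MvPolynomial.C (a i)),
      (P 1).smul_mem _ ((P 1).sub_mem (X_mem_P i) (C_mem_P _ _)), ?_⟩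
    rw [map_smul, map_sub]
    simp only [res, MvPolynomial.aeval_X, MvPolynomial.aeval_C, algebraMap_eq]
    rw [add_sub_cancel_left, mul_comm, smul_eq_C_mul, ← mul_assoc, ← C_mul,
      inv_mul_cancel₀ hi, C_1, one_mul]
  refine ⟨Polynomial.aeval ℓ q, ?_, ?_⟩
  · rw [Polynomial.aeval_eq_sum_range]
    refine Submodule.sum_mem _ fun i hi => (P l).smul_mem _ (mem_P.2 ?_)
    refine (MvPolynomial.totalDegree_pow _ _).trans ?_
    have h1 := mem_P.1 hℓ
    have h2 : i ≤ l := by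
      have := Finset.mem_range.1 hi
      omega
    nlinarith
  · rw [← Polynomial.aeval_algHom_apply, e, Polynomial.aeval_X_left_apply]

theorem edgeInt_eq (a b : E) (p : Poly) :
    edgeInt a b p = dist a b * ∫ s in (0 : ℝ)..1, (res a b p).eval s := by
  simp only [eval_res]
  rfl

/-- A polynomial `wt g`, with `wt > 0` on `(0, 1)`, that is orthogonal to `g` is zero. -/
theorem eq_zero_of_integral_weight_mul_sq {wt g : ℝ[X]} (hwt : ∀ s ∈ Set.Ioo (0 : ℝ) 1, 0 < wt.eval s)
    (h : ∫ s in (0 : ℝ)..1, (wt * g * g).eval s = 0) : g = 0 := by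
  by_contra hg
  have hcont : Continuous fun s : ℝ => (wt * g * g).eval s := (wt * g * g).continuous
  have hnn : ∀ s ∈ Set.Icc (0 : ℝ) 1, 0 ≤ (wt * g * g).eval s := by
    rw [← closure_Ioo (zero_ne_one' ℝ)]
    refine fun s hs => (isClosed_le continuous_const hcont).closure_subset_iff.2 ?_ hs
    intro s hs
    simp only [Set.mem_ofPred_eq, eval_mul]
    have := (hwt s hs).le
    rw [mul_assoc]
    exact mul_nonneg this (mul_self_nonneg _)
  refine h.not_gt (intervalIntegral.integral_pos zero_lt_one hcont.continuousOn
    (fun s hs => hnn s ⟨hs.1.le, hs.2⟩) ?_)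
  obtain ⟨s, hs, hgs⟩ : ∃ s ∈ Set.Ioo (0 : ℝ) 1, g.eval s ≠ 0 := by
    by_contra! hc
    exact hg (Polynomial.eq_zero_of_infinite_isRoot g
      ((Set.Ioo_infinite zero_lt_one).mono fun s hs => hc s hs))
  refine ⟨s, ⟨hs.1.le, hs.2.le⟩, ?_⟩
  rw [eval_mul, eval_mul, mul_assoc]
  have := hwt s hs
  have := mul_self_pos.2 hgs
  positivity

/-- The trace is `Xⁿ (X - 1)ⁿ g`, and the degree bound leaves `g` with degree at most `l`, so `g` is
itself an admissible test function. Up to the sign `(-1)ⁿ` the weight is positive on `(0, 1)`. The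
number `n` is the order of vanishing known at the endpoints: `0` serves `div σ · n`, `1` serves `σn`
and `div v`, and `2` serves `v`. -/
theorem res_eq_zero_of_moments {a b : E} (hab : a ≠ b) {l n : ℕ} {p : Poly}
    (hp : p ∈ P (l + 2 * n)) (hd : X ^ n * (X - C 1) ^ n ∣ res a b p)
    (h : ∀ φ ∈ P l, edgeInt a b (p * φ) = 0) : res a b p = 0 := by
  obtain ⟨g, hg⟩ := hd
  have hwt : X ^ n * (X - C 1 : ℝ[X]) ^ n = C ((-1) ^ n) * (X ^ n * (1 - X) ^ n) := by
    have h1 : (X - C 1 : ℝ[X]) = C (-1) * (1 - X) := by simp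
    rw [h1, mul_pow, C_pow]
    ring
  rw [hwt] at hg
  by_cases hg0 : g = 0
  · rw [hg, hg0, mul_zero]
  refine absurd ?_ hg0
  have hdeg : g.natDegree ≤ l := by
    have h1 := natDegree_res_le a b hp
    rw [hg, ← hwt] at h1
    rw [natDegree_mul (mul_ne_zero (by simp) (pow_ne_zero _ (X_sub_C_ne_zero _))) hg0, natDegree_mul (by simp)
      (pow_ne_zero _ (X_sub_C_ne_zero _)), natDegree_X_pow, natDegree_pow, natDegree_X_sub_C] at h1
    omega
  obtain ⟨φ, hφ, e⟩ := exists_res_eq hab hdeg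
  have h2 := h φ hφ
  rw [edgeInt_eq, map_mul, hg, e, mul_eq_zero, dist_eq_zero] at h2
  have h3 := h2.resolve_left hab
  have h4 : ∀ s : ℝ, (C ((-1) ^ n) * (X ^ n * (1 - X) ^ n) * g * g : ℝ[X]).eval s =
      (-1) ^ n * (X ^ n * (1 - X) ^ n * g * g : ℝ[X]).eval s := fun s => by simp; ring
  simp only [h4, intervalIntegral.integral_const_mul] at h3
  refine eq_zero_of_integral_weight_mul_sq (wt := X ^ n * (1 - X) ^ n) (fun s hs => ?_)
    ((mul_eq_zero.1 h3).resolve_left (by simp))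
  simp only [eval_mul, eval_pow, eval_X, eval_sub, eval_one]
  have := hs.1
  have := sub_pos.2 hs.2
  positivity

theorem X_pow_mul_dvd {r : ℝ[X]} {n : ℕ} (h₀ : (X - C 0) ^ n ∣ r) (h₁ : (X - C 1) ^ n ∣ r) :
    X ^ n * (X - C 1) ^ n ∣ r := by
  have hc : IsCoprime ((X - C 0 : ℝ[X]) ^ n) ((X - C 1) ^ n) :=
    (isCoprime_X_sub_C_of_isUnit_sub (by simp)).pow
  simpa using hc.mul_dvd h₀ h₁

theorem X_sub_C_sq_dvd {r : ℝ[X]} {t : ℝ} (h₀ : r.eval t = 0) (h₁ : (derivative r).eval t = 0) :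
    (X - C t) ^ 2 ∣ r := by
  by_cases hr : r = 0
  · exact hr ▸ dvd_zero _
  · exact (le_rootMultiplicity_iff hr).1 ((one_lt_rootMultiplicity_iff_isRoot hr).2 ⟨h₀, h₁⟩)

theorem res_eq_zero_of_moments_zero {a b : E} (hab : a ≠ b) {l : ℕ} {p : Poly}
    (hp : p ∈ P l) (h : ∀ φ ∈ P l, edgeInt a b (p * φ) = 0) : res a b p = 0 :=
  res_eq_zero_of_moments (n := 0) hab hp (by simp) h

theorem res_eq_zero_of_moments_one {a b : E} (hab : a ≠ b) {l : ℕ} {p : Poly}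
    (hp : p ∈ P (l + 2)) (ha : ev a p = 0) (hb : ev b p = 0)
    (h : ∀ φ ∈ P l, edgeInt a b (p * φ) = 0) : res a b p = 0 := by
  refine res_eq_zero_of_moments (n := 1) hab hp (X_pow_mul_dvd ?_ ?_) h
  · rw [pow_one, dvd_iff_isRoot, IsRoot, eval_zero_res, ha]
  · rw [pow_one, dvd_iff_isRoot, IsRoot, eval_one_res, hb]

theorem ev_dirD (x : E) (t : Fin 2 → ℝ) (p : Poly) : ev x (dirD t p) =
    t 0 * ev x (MvPolynomial.pderiv 0 p) + t 1 * ev x (MvPolynomial.pderiv 1 p) := by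
  rw [dirD_apply, ev_add, ev_smul, ev_smul]

theorem res_eq_zero_of_moments_two {a b : E} (hab : a ≠ b) {l : ℕ} {p : Poly}
    (hp : p ∈ P (l + 4)) (ha : ev a p = 0) (hb : ev b p = 0)
    (ha' : ∀ i, ev a (MvPolynomial.pderiv i p) = 0) (hb' : ∀ i, ev b (MvPolynomial.pderiv i p) = 0)
    (h : ∀ φ ∈ P l, edgeInt a b (p * φ) = 0) : res a b p = 0 := by
  refine res_eq_zero_of_moments (n := 2) hab hp (X_pow_mul_dvd ?_ ?_) h
  · refine X_sub_C_sq_dvd (by rw [eval_zero_res, ha]) ?_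
    rw [derivative_res, eval_zero_res, ev_dirD, ha', ha', mul_zero, mul_zero, add_zero]
  · refine X_sub_C_sq_dvd (by rw [eval_one_res, hb]) ?_
    rw [derivative_res, eval_one_res, ev_dirD, hb', hb', mul_zero, mul_zero, add_zero]

end edges

/-! ### Degrees of freedom as conditions on traces -/

theorem edgeInt_eq_zero {a b : E} {p : Poly} (h : res a b p = 0) (q : Poly) :
    edgeInt a b (p * q) = 0 := by
  rw [edgeInt_eq, map_mul, h]
  simp

/-- Linearity reduces single-valuedness to a jump with vanishing degrees of freedom, the form used
in all later arguments. -/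
theorem VDofsAgree_sub_iff {k : ℕ} {S : Set E} {v w : Fin 2 → Poly} :
    VDofsAgree k S (v - w) 0 ↔ VDofsAgree k S v w := by
  simp only [VDofsAgree, map_sub, Pi.sub_apply, Matrix.sub_apply, ev_sub, sub_mul, map_zero,
    Pi.zero_apply, Matrix.zero_apply, ev_zero, zero_mul, Finset.sum_const_zero, sub_eq_zero,
    Finset.sum_sub_distrib]

theorem SDofsAgree_sub_iff {k : ℕ} {S : Set E} {σ τ : Matrix (Fin 2) (Fin 2) Poly} :
    SDofsAgree k S (σ - τ) 0 ↔ SDofsAgree k S σ τ := by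
  simp only [SDofsAgree, map_sub, Pi.sub_apply, Matrix.sub_apply, ev_sub, sub_mul, map_zero,
    Pi.zero_apply, Matrix.zero_apply, ev_zero, zero_mul, Finset.sum_const_zero, sub_eq_zero,
    Finset.sum_sub_distrib]

theorem edgeInt_apply_eq_zero_of_sum {a b : E} {l : ℕ} {v : Fin 2 → Poly}
    (h : ∀ φ ∈ PVec l, ∑ i, edgeInt a b (v i * φ i) = 0) (i : Fin 2) :
    ∀ φ ∈ P l, edgeInt a b (v i * φ) = 0 := fun φ hφ => by
  have := h (Pi.single i φ) (mem_PVec.2 fun j => by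
    by_cases hj : j = i
    · subst hj; simpa using hφ
    · simp [hj])
  rw [Finset.sum_eq_single i (fun j _ hj => by simp [hj]) (by simp)] at this
  simpa using this

theorem gradP_apply (v : Fin 2 → Poly) (i j : Fin 2) : gradP v i j = MvPolynomial.pderiv j (v i) :=
  rfl

theorem ev_divP_eq_zero {x : E} {v : Fin 2 → Poly} (h : ∀ i j, ev x (gradP v i j) = 0) :
    ev x (divP v) = 0 := by
  rw [divP_apply, ev_add, ← gradP_apply, ← gradP_apply, h, h, add_zero]

/-- The vertex data make the trace of `v`, of degree `k + 1 = (k - 3) + 4`, vanish to second order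
at both ends, and the trace of `div v`, of degree `k = (k - 2) + 2`, to first order. The moments are
exactly enough for what remains. -/
theorem VDofsAgree_zero_iff {k : ℕ} (hk : 3 ≤ k) {S : Set E} {v : Fin 2 → Poly}
    (hv : v ∈ PVec (k + 1)) : VDofsAgree k S v 0 ↔
      (∀ a ∈ S, ∀ i, ev a (v i) = 0 ∧ ∀ j, ev a (gradP v i j) = 0) ∧
      ∀ a ∈ S, ∀ b ∈ S, a ≠ b → (∀ i, res a b (v i) = 0) ∧ res a b (divP v) = 0 := by
  simp only [VDofsAgree, map_zero, Pi.zero_apply, Matrix.zero_apply, ev_zero, zero_mul,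
    Finset.sum_const_zero]
  refine and_congr_right fun h => forall₂_congr fun a ha => forall₂_congr fun b hb =>
    forall_congr' fun hab => ⟨fun ⟨h₁, h₂⟩ => ⟨fun i => ?_, ?_⟩, fun ⟨h₁, h₂⟩ =>
      ⟨fun φ _ => Finset.sum_eq_zero fun i _ => edgeInt_eq_zero (h₁ i) _,
        fun q _ => edgeInt_eq_zero h₂ _⟩⟩
  · refine res_eq_zero_of_moments_two hab (l := k - 3) ?_ (h a ha i).1 (h b hb i).1 (h a ha i).2
      (h b hb i).2 (edgeInt_apply_eq_zero_of_sum h₁ i)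
    exact (show k - 3 + 4 = k + 1 by omega) ▸ mem_PVec.1 hv i
  · refine res_eq_zero_of_moments_one hab (l := k - 2) ?_ (ev_divP_eq_zero fun i => (h a ha i).2)
      (ev_divP_eq_zero fun i => (h b hb i).2) h₂
    rw [show k - 2 + 2 = k by omega]
    exact divP_mem hv

theorem normalTrace_apply (a b : E) (σ : Matrix (Fin 2) (Fin 2) Poly) (i : Fin 2) :
    normalTrace a b σ i = unitNormal a b 0 • σ i 0 + unitNormal a b 1 • σ i 1 := by
  simp [normalTrace]

theorem divNormalTrace_apply (a b : E) (σ : Matrix (Fin 2) (Fin 2) Poly) :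
    divNormalTrace a b σ = unitNormal a b 0 • rowDivP σ 0 + unitNormal a b 1 • rowDivP σ 1 := by
  simp [divNormalTrace]

/-- Here `σn` has degree `k = (k - 2) + 2` and vanishes at both ends, while `div σ · n` has degree
`k - 1`, needs no vertex data and is tested with its full degree. -/
theorem SDofsAgree_zero_iff {k : ℕ} (hk : 3 ≤ k) {S : Set E} {σ : Matrix (Fin 2) (Fin 2) Poly}
    (hσ : ∀ i j, σ i j ∈ P k) : SDofsAgree k S σ 0 ↔
      (∀ a ∈ S, ∀ i j, ev a (σ i j) = 0) ∧
      ∀ a ∈ S, ∀ b ∈ S, a ≠ b →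
        (∀ i, res a b (normalTrace a b σ i) = 0) ∧ res a b (divNormalTrace a b σ) = 0 := by
  simp only [SDofsAgree, map_zero, Pi.zero_apply, Matrix.zero_apply, ev_zero, zero_mul,
    Finset.sum_const_zero]
  refine and_congr_right fun h => forall₂_congr fun a ha => forall₂_congr fun b hb =>
    forall_congr' fun hab => ⟨fun ⟨h₁, h₂⟩ => ⟨fun i => ?_, ?_⟩, fun ⟨h₁, h₂⟩ =>
      ⟨fun φ _ => Finset.sum_eq_zero fun i _ => edgeInt_eq_zero (h₁ i) _,
        fun q _ => edgeInt_eq_zero h₂ _⟩⟩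
  · have h0 : ∀ x ∈ S, ev x (normalTrace a b σ i) = 0 := fun x hx => by
      rw [normalTrace_apply, ev_add, ev_smul, ev_smul, h x hx, h x hx, mul_zero, mul_zero, add_zero]
    refine res_eq_zero_of_moments_one hab (l := k - 2) ?_ (h0 a ha) (h0 b hb)
      (edgeInt_apply_eq_zero_of_sum h₁ i)
    rw [show k - 2 + 2 = k by omega, normalTrace_apply]
    exact (P k).add_mem ((P k).smul_mem _ (hσ i 0)) ((P k).smul_mem _ (hσ i 1))
  · refine res_eq_zero_of_moments_zero hab (l := k - 1) ?_ h₂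
    have := mem_PVec.1 (rowDivP_mem (l := k - 1) (show k = k - 1 + 1 by omega ▸ hσ))
    rw [divNormalTrace_apply]
    exact (P _).add_mem ((P _).smul_mem _ (this 0)) ((P _).smul_mem _ (this 1))

/-- The vector from `a` to `b`. -/
abbrev edgeVec (a b : E) : Fin 2 → ℝ := fun i => b i - a i

/-- The normal is the rotated tangent, and rotation exchanges curl and gradient: only the tangential
derivative of `v` and its divergence survive. Both are visible on the edge. Multiplying by the
length clears the denominators of the unit normal. -/
theorem dist_smul_normalTrace_symCurlP {a b : E} (hab : a ≠ b) (v : Fin 2 → Poly) (i : Fin 2) :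
    dist a b • normalTrace a b (symCurlP v) i =
      -dirD (edgeVec a b) (v i) + ((b i - a i) / 2) • divP v := by
  have hd : dist a b ≠ 0 := dist_ne_zero.2 hab
  rw [normalTrace_apply, smul_add, smul_smul, smul_smul, divP_apply, dirD_apply]
  simp only [unitNormal, Matrix.cons_val_zero, Matrix.cons_val_one]
  rw [mul_div_cancel₀ _ hd, mul_div_cancel₀ _ hd]
  fin_cases i
  · simp only [Fin.zero_eta, symCurlP_zero_zero, symCurlP_zero_one]
    module
  · simp only [Fin.mk_one, symCurlP_one_zero, symCurlP_one_one]
    module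

/-- The normal component of `½ curl div v` is a tangential derivative of `div v`. -/
theorem dist_smul_divNormalTrace_symCurlP {a b : E} (hab : a ≠ b) (v : Fin 2 → Poly) :
    dist a b • divNormalTrace a b (symCurlP v) =
      -((1 / 2 : ℝ) • dirD (edgeVec a b) (divP v)) := by
  have hd : dist a b ≠ 0 := dist_ne_zero.2 hab
  rw [divNormalTrace_apply, smul_add, smul_smul, smul_smul, dirD_apply]
  simp only [unitNormal, Matrix.cons_val_zero, Matrix.cons_val_one]
  rw [mul_div_cancel₀ _ hd, mul_div_cancel₀ _ hd, rowDivP_symCurlP_zero, rowDivP_symCurlP_one]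
  module

/-! ### Integration and the divergence theorem on a triangle -/

section green

/-- Twice the signed area of the triangle `abc`. -/
def orient (a b c : E) : ℝ := (b 0 - a 0) * (c 1 - a 1) - (b 1 - a 1) * (c 0 - a 0)

/-- The point with barycentric coordinates `1 - x - y, x, y`. -/
def bary (a b c : E) (p : ℝ × ℝ) : E := a + (p.1 • (b - a) + p.2 • (c - a))

/-- The reference triangle. -/
def refTriangle : Set (ℝ × ℝ) := {p | 0 ≤ p.1 ∧ 0 ≤ p.2 ∧ p.1 + p.2 ≤ 1}

theorem isClosed_refTriangle : IsClosed refTriangle := by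
  refine (isClosed_le continuous_const continuous_fst).inter
    ((isClosed_le continuous_const continuous_snd).inter
      (isClosed_le (continuous_fst.add continuous_snd) continuous_const))

theorem refTriangle_subset : refTriangle ⊆ Set.Icc 0 1 := fun p ⟨h0, h1, h⟩ =>
  ⟨⟨h0, h1⟩, ⟨by simp; linarith, by simp; linarith⟩⟩

theorem isCompact_refTriangle : IsCompact refTriangle :=
  isCompact_Icc.of_isClosed_subset isClosed_refTriangle refTriangle_subset

theorem convexHull_triple (a b c : E) : convexHull ℝ {a, b, c} = bary a b c '' refTriangle := by
  ext x
  rw [convexHull_insert ⟨b, by simp⟩, convexHull_pair]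
  simp only [convexJoin_singleton_left, Set.mem_iUnion, segment, Set.mem_ofPred_eq, Set.mem_image]
  constructor
  · rintro ⟨y, ⟨r, s, hr, hs, hrs, rfl⟩, t, w, ht, hw, htw, rfl⟩
    refine ⟨(w * r, w * s), ⟨by positivity, by positivity, by simp only; nlinarith⟩, ?_⟩
    ext i
    simp only [bary, PiLp.add_apply, PiLp.smul_apply, PiLp.sub_apply, smul_eq_mul]
    have h1 : t = 1 - w := by linarith
    have h2 : r = 1 - s := by linarith
    subst h1 h2
    ring
  · rintro ⟨⟨r, s⟩, ⟨hr, hs, hrs⟩, rfl⟩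
    simp only at hr hs hrs
    -- If `r + s = 0` the point is `a`, and its companion on the opposite edge may be chosen freely.
    rcases eq_or_lt_of_le (add_nonneg hr hs) with h | h
    · have hr0 : r = 0 := by linarith
      have hs0 : s = 0 := by linarith
      exact ⟨b, ⟨1, 0, by simp⟩, 1, 0, by simp, by simp, by simp, by simp [bary, hr0, hs0]⟩
    · refine ⟨(r / (r + s)) • b + (s / (r + s)) • c, ⟨r / (r + s), s / (r + s), by positivity,
        by positivity, by field_simp, rfl⟩, 1 - (r + s), r + s, by linarith, h.le, by ring, ?_⟩
      ext i
      simp only [bary, PiLp.add_apply, PiLp.smul_apply, PiLp.sub_apply, smul_eq_mul]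
      field_simp
      ring

theorem volume_preserving_toProd :
    MeasurePreserving (fun x : E => ((x 0, x 1) : ℝ × ℝ)) volume volume :=
  (volume_preserving_finTwoArrow ℝ).comp (PiLp.volume_preserving_ofLp (Fin 2))

theorem measurableEmbedding_toProd : MeasurableEmbedding (fun x : E => ((x 0, x 1) : ℝ × ℝ)) :=
  (MeasurableEquiv.finTwoArrow (α := ℝ)).measurableEmbedding.comp
    (MeasurableEquiv.toLp 2 (Fin 2 → ℝ)).symm.measurableEmbedding

/-- The linear part of `bary`, as an endomorphism of the plane. -/
def baryLinear (a b c : E) : E →L[ℝ] E :=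
  (Matrix.toLin (EuclideanSpace.basisFun (Fin 2) ℝ).toBasis
    (EuclideanSpace.basisFun (Fin 2) ℝ).toBasis
    !![b 0 - a 0, c 0 - a 0; b 1 - a 1, c 1 - a 1]).toContinuousLinearMap

theorem det_baryLinear (a b c : E) : (baryLinear a b c).det = orient a b c := by
  rw [ContinuousLinearMap.det, baryLinear, LinearMap.coe_toContinuousLinearMap,
    LinearMap.det_toLin, Matrix.det_fin_two_of, orient]
  ring

theorem baryLinear_apply (a b c x : E) :
    baryLinear a b c x = x 0 • (b - a) + x 1 • (c - a) := by
  rw [baryLinear, LinearMap.coe_toContinuousLinearMap', Matrix.toLin_apply]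
  ext i
  fin_cases i <;> simp [Matrix.mulVec, dotProduct, Fin.sum_univ_two] <;> ring

theorem injective_baryLinear {a b c : E} (h : orient a b c ≠ 0) :
    Function.Injective (baryLinear a b c) := by
  have : LinearMap.det (baryLinear a b c : E →ₗ[ℝ] E) ≠ 0 := by
    have := det_baryLinear a b c
    rw [ContinuousLinearMap.det] at this
    rwa [this]
  exact (LinearMap.equivOfDetNeZero _ this).injective

/-- Integration over a triangle in barycentric coordinates. -/
theorem integral_triangle {a b c : E} (h : orient a b c ≠ 0) (f : E → ℝ) :
    ∫ x in convexHull ℝ {a, b, c}, f x =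
      |orient a b c| * ∫ p in refTriangle, f (bary a b c p) := by
  set R : Set E := (fun x : E => ((x 0, x 1) : ℝ × ℝ)) ⁻¹' refTriangle with hR
  have himg : convexHull ℝ {a, b, c} = (fun x => a + baryLinear a b c x) '' R := by
    rw [convexHull_triple]
    ext y
    constructor
    · rintro ⟨p, hp, rfl⟩
      refine ⟨!₂[p.1, p.2], by simpa [hR] using hp, ?_⟩
      simp [baryLinear_apply, bary]
    · rintro ⟨x, hx, rfl⟩
      exact ⟨(x 0, x 1), hx, by simp [baryLinear_apply, bary]⟩
  have hmeas : MeasurableSet R :=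
    measurableEmbedding_toProd.measurable isClosed_refTriangle.measurableSet
  rw [himg, integral_image_eq_integral_abs_det_fderiv_smul volume hmeas
    (f' := fun _ => baryLinear a b c)
    (fun x _ => ((baryLinear a b c).hasFDerivAt.const_add a).hasFDerivWithinAt)
    (fun x _ y _ hxy => injective_baryLinear h (add_left_cancel hxy)), det_baryLinear]
  simp only [smul_eq_mul]
  rw [integral_const_mul, hR, ← volume_preserving_toProd.setIntegral_preimage_emb
    measurableEmbedding_toProd]
  simp [baryLinear_apply, bary]

theorem integral_refTriangle {h : ℝ × ℝ → ℝ} (hh : Continuous h) :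
    ∫ p in refTriangle, h p = ∫ y in (0 : ℝ)..1, ∫ x in (0 : ℝ)..(1 - y), h (x, y) := by
  have hm := isClosed_refTriangle.measurableSet
  have hint : Integrable (refTriangle.indicator h) (volume.prod volume) :=
    (integrable_indicator_iff hm).2 (hh.continuousOn.integrableOn_compact isCompact_refTriangle)
  rw [← integral_indicator hm, Measure.volume_eq_prod, integral_prod_symm _ hint,
    intervalIntegral.integral_of_le zero_le_one, ← integral_Icc_eq_integral_Ioc,
    ← integral_indicator measurableSet_Icc]
  congr 1
  ext y
  by_cases hy : y ∈ Set.Icc (0 : ℝ) 1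
  · rw [Set.indicator_of_mem hy, intervalIntegral.integral_of_le (by linarith [hy.2]),
      ← integral_Icc_eq_integral_Ioc, ← integral_indicator measurableSet_Icc]
    congr 1
    ext x
    refine Set.indicator_eq_indicator ?_ rfl
    simp only [refTriangle, Set.mem_ofPred_eq, Set.mem_Icc]
    constructor
    · rintro ⟨h1, h2, h3⟩
      exact ⟨h1, by linarith⟩
    · rintro ⟨h1, h2⟩
      exact ⟨h1, hy.1, by linarith⟩
  · rw [Set.indicator_of_notMem hy]
    have : ∀ x, refTriangle.indicator h (x, y) = 0 := fun x => by
      refine Set.indicator_of_notMem ?_ _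
      rintro ⟨h1, h2, h3⟩
      exact hy ⟨h2, by simp only at h1 h3; linarith⟩
    simp [this]

/-- This symmetry gives the derivative along the second edge from the one along the first, by
exchanging two vertices. -/
theorem integral_refTriangle_swap (h : ℝ × ℝ → ℝ) :
    ∫ p in refTriangle, h p.swap = ∫ p in refTriangle, h p := by
  have h1 : (Prod.swap ⁻¹' refTriangle : Set (ℝ × ℝ)) = refTriangle := by
    ext p
    simp only [refTriangle, Set.mem_preimage, Set.mem_ofPred_eq, Prod.fst_swap, Prod.snd_swap,
      add_comm]
    tauto
  have h2 := (Measure.measurePreserving_swap (μ := (volume : Measure ℝ))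
    (ν := (volume : Measure ℝ))).setIntegral_preimage_emb
    MeasurableEquiv.prodComm.measurableEmbedding h refTriangle
  rw [h1] at h2
  exact h2

/-- The derivative of `f` in the direction `u`. -/
def dirDeriv (u : E) (f : E → ℝ) (x : E) : ℝ := u 0 * pd 0 f x + u 1 * pd 1 f x

theorem fderiv_apply_eq {f : E → ℝ} (x u : E) : fderiv ℝ f x u = dirDeriv u f x := by
  have h : u = u 0 • EuclideanSpace.single 0 1 + u 1 • EuclideanSpace.single 1 1 := by
    ext i
    fin_cases i <;> simp
  conv_lhs => rw [h]
  simp [pd, dirDeriv]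

theorem continuous_pd {f : E → ℝ} (hf : ContDiff ℝ 1 f) (i : Fin 2) : Continuous (pd i f) :=
  (hf.continuous_fderiv (by norm_num)).clm_apply continuous_const

theorem continuous_dirDeriv {f : E → ℝ} (hf : ContDiff ℝ 1 f) (u : E) :
    Continuous (dirDeriv u f) :=
  (continuous_const.mul (continuous_pd hf 0)).add (continuous_const.mul (continuous_pd hf 1))

theorem continuous_bary (a b c : E) : Continuous (bary a b c) := by
  unfold bary
  fun_prop

theorem hasDerivAt_line {f : E → ℝ} (hf : ContDiff ℝ 1 f) (p u : E) (s : ℝ) :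
    HasDerivAt (fun s : ℝ => f (p + s • u)) (dirDeriv u f (p + s • u)) s := by
  have h1 : HasDerivAt (fun s : ℝ => p + s • u) u s := by
    simpa using ((hasDerivAt_id s).smul_const u).const_add p
  have h2 := ((hf.differentiable (by norm_num)) (p + s • u)).hasFDerivAt.comp_hasDerivAt s h1
  rwa [fderiv_apply_eq] at h2

/-- On a slice of fixed `y` the integrand is a derivative along `b - a`; the slice begins on the
side `ac` and ends on `bc`, at parameter `y` on both. -/
theorem integral_dirDeriv_refTriangle (a b c : E) {f : E → ℝ} (hf : ContDiff ℝ 1 f) :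
    ∫ p in refTriangle, dirDeriv (b - a) f (bary a b c p) =
      (∫ s in (0 : ℝ)..1, f (AffineMap.lineMap b c s)) -
        ∫ s in (0 : ℝ)..1, f (AffineMap.lineMap a c s) := by
  rw [integral_refTriangle (h := fun p => dirDeriv (b - a) f (bary a b c p))
      ((continuous_dirDeriv hf _).comp (continuous_bary a b c)), ← intervalIntegral.integral_sub]
  · refine intervalIntegral.integral_congr fun y _ => ?_
    have h1 : ∀ x : ℝ, bary a b c (x, y) = (a + y • (c - a)) + x • (b - a) := fun x => by
      simp only [bary]; abel
    simp only [h1]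
    rw [intervalIntegral.integral_eq_sub_of_hasDerivAt (fun x _ => hasDerivAt_line hf _ _ x)]
    · congr 2
      · ext i
        simp [AffineMap.lineMap_apply]
        ring
      · ext i
        simp [AffineMap.lineMap_apply]
        ring
    · exact ((continuous_dirDeriv hf _).comp (by fun_prop)).intervalIntegrable _ _
  · exact (hf.continuous.comp AffineMap.lineMap_continuous).intervalIntegrable _ _
  · exact (hf.continuous.comp AffineMap.lineMap_continuous).intervalIntegrable _ _

theorem integral_lineMap_symm (a b : E) (f : E → ℝ) :
    ∫ s in (0 : ℝ)..1, f (AffineMap.lineMap a b s) =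
      ∫ s in (0 : ℝ)..1, f (AffineMap.lineMap b a s) := by
  have h := intervalIntegral.integral_comp_sub_left (a := 0) (b := 1)
    (fun s => f (AffineMap.lineMap b a s)) 1
  simp only [AffineMap.lineMap_apply_one_sub, sub_self, sub_zero] at h
  exact h

theorem integral_dirDeriv_refTriangle' (a b c : E) {f : E → ℝ} (hf : ContDiff ℝ 1 f) :
    ∫ p in refTriangle, dirDeriv (c - a) f (bary a b c p) =
      (∫ s in (0 : ℝ)..1, f (AffineMap.lineMap b c s)) -
        ∫ s in (0 : ℝ)..1, f (AffineMap.lineMap a b s) := by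
  rw [← integral_refTriangle_swap, integral_lineMap_symm b c, ← integral_dirDeriv_refTriangle a c b hf]
  congr 1
  ext p
  congr 1
  simp only [bary, Prod.fst_swap, Prod.snd_swap]
  abel

/-- The flux of `F` through the segment from `a` to `b`. -/
def flux (a b : E) (F : Fin 2 → E → ℝ) : ℝ :=
  (b 1 - a 1) * (∫ s in (0 : ℝ)..1, F 0 (AffineMap.lineMap a b s)) -
    (b 0 - a 0) * ∫ s in (0 : ℝ)..1, F 1 (AffineMap.lineMap a b s)

/-- The divergence theorem on a triangle. -/
theorem integral_div_triangle {a b c : E} (h : orient a b c ≠ 0) {F : Fin 2 → E → ℝ}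
    (hF : ∀ i, ContDiff ℝ 1 (F i)) :
    ∫ x in convexHull ℝ {a, b, c}, (pd 0 (F 0) x + pd 1 (F 1) x) =
      |orient a b c| / orient a b c * (flux a b F + flux b c F + flux c a F) := by
  rw [integral_triangle h, div_mul_eq_mul_div, mul_div_assoc]
  congr 1
  rw [eq_div_iff h, mul_comm, ← integral_const_mul]
  -- Cramer's rule writes the two coordinate derivatives through the derivatives along `b - a` and
  -- `c - a`. The factor `|orient| / orient` in the result makes the fluxes outward for either
  -- orientation of the vertices.
  have key : ∀ x, orient a b c * (pd 0 (F 0) x + pd 1 (F 1) x) =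
      ((c 1 - a 1) * dirDeriv (b - a) (F 0) x - (c 0 - a 0) * dirDeriv (b - a) (F 1) x) -
      ((b 1 - a 1) * dirDeriv (c - a) (F 0) x - (b 0 - a 0) * dirDeriv (c - a) (F 1) x) := by
    intro x
    simp only [dirDeriv, orient, PiLp.sub_apply]
    ring
  simp only [key]
  have hi : ∀ (i : Fin 2) (u : E) (r : ℝ),
      IntegrableOn (fun p => r * dirDeriv u (F i) (bary a b c p)) refTriangle := fun i u r =>
    (continuous_const.mul ((continuous_dirDeriv (hF i) u).comp
      (continuous_bary a b c))).continuousOn.integrableOn_compact isCompact_refTriangle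
  rw [integral_sub ?_ ?_, integral_sub (hi _ _ _) (hi _ _ _), integral_sub (hi _ _ _) (hi _ _ _)]
  rotate_left
  · exact (hi _ _ _).sub (hi _ _ _)
  · exact (hi _ _ _).sub (hi _ _ _)
  simp only [integral_const_mul]
  rw [integral_dirDeriv_refTriangle _ _ _ (hF 0), integral_dirDeriv_refTriangle _ _ _ (hF 1),
    integral_dirDeriv_refTriangle' _ _ _ (hF 0), integral_dirDeriv_refTriangle' _ _ _ (hF 1)]
  simp only [flux]
  rw [integral_lineMap_symm c a, integral_lineMap_symm c a]
  ring

end green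

/-! ### Raviart–Thomas germs and the traces of `sym curl` -/

section germs

open MvPolynomial

/-- The Raviart-Thomas field with the same value and divergence at `a` as `w`. -/
def germ (a : E) (w : Fin 2 → Poly) : Fin 2 → Poly := fun i =>
  C (ev a (w i) - 1 / 2 * ev a (divP w) * a i) + (1 / 2 * ev a (divP w)) • X i

theorem germ_mem (a : E) (w : Fin 2 → Poly) : germ a w ∈ RTPoly := ⟨_, _, fun _ => rfl⟩

theorem germ_congr {a : E} {v w : Fin 2 → Poly} (h : ∀ i, ev a (v i) = ev a (w i))
    (h' : ev a (divP v) = ev a (divP w)) : germ a v = germ a w := by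
  funext i
  rw [germ, germ, h, h']

theorem germ_sub (a : E) (v w : Fin 2 → Poly) : germ a (v - w) = germ a v - germ a w := by
  funext i
  simp only [germ, map_sub, Pi.sub_apply, ev_sub, smul_eq_C_mul, C_mul]
  ring

theorem germ_of_mem {r : Fin 2 → Poly} (hr : r ∈ RTPoly) (a : E) : germ a r = r := by
  obtain ⟨c, b, h⟩ := hr
  have hdiv : ev a (divP r) = 2 * b := by
    simp [divP_apply, h, ev_add, ev_smul, ev_one]
    ring
  funext i
  rw [germ, hdiv, h, ev_add, ev_C, ev_smul, ev_X]
  ring_nf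

theorem ev_germ (a : E) (w : Fin 2 → Poly) (i : Fin 2) : ev a (germ a w i) = ev a (w i) := by
  rw [germ, ev_add, ev_C, ev_smul, ev_X]
  ring

theorem divP_germ (a : E) (w : Fin 2 → Poly) : divP (germ a w) = C (ev a (divP w)) := by
  rw [divP_apply]
  simp only [germ, map_add, pderiv_C, pderiv_smul, pderiv_X_self, zero_add, ← add_smul]
  rw [smul_eq_C_mul, mul_one]
  ring_nf

theorem res_eq_const {a b : E} {p : Poly} (h : res a b (dirD (edgeVec a b) p) = 0) :
    res a b p = Polynomial.C (ev a p) := by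
  have h1 : Polynomial.derivative (res a b p) = 0 := by rw [derivative_res, h]
  have h2 := Polynomial.eq_C_of_derivative_eq_zero h1
  rw [h2, ← eval_zero_res a b, h2]
  simp

theorem res_smul_eq_zero {a b : E} {c : ℝ} (hc : c ≠ 0) {p : Poly} (h : res a b (c • p) = 0) :
    res a b p = 0 := by
  rw [map_smul] at h
  exact (smul_eq_zero.1 h).resolve_left hc

/-- If the normal traces of `sym curl w` vanish on an edge, then `w` agrees there with a
Raviart-Thomas field. -/
theorem edge_germ {a b : E} (hab : a ≠ b) {w : Fin 2 → Poly}
    (h₁ : ∀ i, res a b (normalTrace a b (symCurlP w) i) = 0)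
    (h₂ : res a b (divNormalTrace a b (symCurlP w)) = 0) :
    (∀ i, res a b ((w - germ a w) i) = 0) ∧ res a b (divP (w - germ a w)) = 0 := by
  -- The second trace is a tangential derivative of `div w`, so `div w` is constant on the edge.
  have hdiv : res a b (divP w) = Polynomial.C (ev a (divP w)) := by
    have h3 := congrArg (res a b) (dist_smul_divNormalTrace_symCurlP hab w)
    rw [map_smul, h₂, smul_zero, map_neg, map_smul, eq_comm, neg_eq_zero] at h3
    exact res_eq_const ((smul_eq_zero.1 h3).resolve_left (by norm_num))
  have hdiv' : res a b (divP (w - germ a w)) = 0 := by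
    rw [map_sub, map_sub, hdiv, divP_germ, res, aeval_C, Polynomial.algebraMap_eq, sub_self]
  refine ⟨fun i => ?_, hdiv'⟩
  -- Subtracting the germ does not change `sym curl` and removes the divergence on the edge. The
  -- first trace then says that `w - germ a w` is constant along the edge, and it vanishes at `a`.
  have hs : symCurlP (w - germ a w) = symCurlP w := by
    rw [map_sub, (symCurlP_eq_zero_iff _).2 (germ_mem a w), sub_zero]
  have h3 := congrArg (res a b) (dist_smul_normalTrace_symCurlP hab (w - germ a w) i)
  rw [hs, map_smul, h₁, smul_zero, map_add, map_smul, hdiv', smul_zero, add_zero, map_neg,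
    eq_comm, neg_eq_zero] at h3
  rw [res_eq_const h3, Pi.sub_apply, ev_sub, ev_germ, sub_self, Polynomial.C_0]

theorem ev_of_res_eq_zero {a b : E} {p : Poly} (h : res a b p = 0) : ev b p = 0 := by
  rw [← eval_one_res a b, h, Polynomial.eval_zero]

/-- At `b` the field `w` has the value and divergence of the germ taken at `a`, and a Raviart–Thomas
field is its own germ everywhere. -/
theorem germ_eq_germ {a b : E} (hab : a ≠ b) {w : Fin 2 → Poly}
    (h₁ : ∀ i, res a b (normalTrace a b (symCurlP w) i) = 0)
    (h₂ : res a b (divNormalTrace a b (symCurlP w)) = 0) : germ a w = germ b w := by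
  obtain ⟨h3, h4⟩ := edge_germ hab h₁ h₂
  rw [← germ_of_mem (germ_mem a w) b]
  refine germ_congr (fun i => ?_) ?_
  · have := ev_of_res_eq_zero (h3 i)
    rw [Pi.sub_apply, ev_sub] at this
    linarith
  · have := ev_of_res_eq_zero h4
    rw [map_sub, ev_sub] at this
    linarith

/-- Where `sym curl w` vanishes, the gradient of `w` is `½ div w` times the identity, which is the
gradient of the germ. -/
theorem ev_gradP_sub_germ {a : E} {w : Fin 2 → Poly} (h : ∀ i j, ev a (symCurlP w i j) = 0)
    (i j : Fin 2) : ev a (gradP (w - germ a w) i j) = 0 := by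
  have h00 := h 0 0
  have h01 := h 0 1
  have h11 := h 1 1
  rw [symCurlP_zero_zero, ev_neg] at h00
  rw [symCurlP_zero_one, ev_smul, ev_sub] at h01
  rw [symCurlP_one_one] at h11
  have hd : ev a (divP w) = ev a (pderiv 0 (w 0)) + ev a (pderiv 1 (w 1)) := by
    rw [divP_apply, ev_add]
  rw [map_sub, Matrix.sub_apply, ev_sub, gradP_apply, gradP_apply]
  fin_cases i <;> fin_cases j <;>
    simp [germ, ev_smul, ev_zero, ev_one, hd] <;> linarith

/-- A partial converse of `SDofsAgree_symCurlP`: vanishing degrees of freedom of `sym curl w`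
determine those of `w` up to a Raviart–Thomas field, once the germs at all points of `S` are the
same. -/
theorem VDofsAgree_of_germ {k : ℕ} (hk : 3 ≤ k) {S : Set E} {w r : Fin 2 → Poly}
    (hw : w ∈ PVec (k + 1)) (h : SDofsAgree k S (symCurlP w) 0) (hr : ∀ a ∈ S, germ a w = r)
    (hr' : r ∈ RTPoly) : VDofsAgree k S w r := by
  rw [SDofsAgree_zero_iff hk (symCurlP_mem_PSym hw).2] at h
  rw [← VDofsAgree_sub_iff,
    VDofsAgree_zero_iff hk ((PVec _).sub_mem hw (RTPoly_le_PVec _ hr'))]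
  refine ⟨fun a ha i => ⟨?_, ?_⟩, fun a ha b hb hab => ?_⟩
  · rw [← hr a ha, Pi.sub_apply, ev_sub, ev_germ, sub_self]
  · rw [← hr a ha]
    exact ev_gradP_sub_germ (h.1 a ha) i
  · rw [← hr a ha]
    exact edge_germ hab (h.2 a ha b hb hab).1 (h.2 a ha b hb hab).2

theorem germ_eq_of_SDofsAgree {k : ℕ} (hk : 3 ≤ k) {S : Set E} {w : Fin 2 → Poly}
    (hw : w ∈ PVec (k + 1)) (h : SDofsAgree k S (symCurlP w) 0) {a b : E} (ha : a ∈ S)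
    (hb : b ∈ S) : germ a w = germ b w := by
  rw [SDofsAgree_zero_iff hk (symCurlP_mem_PSym hw).2] at h
  by_cases hab : a = b
  · rw [hab]
  · exact germ_eq_germ hab (h.2 a ha b hb hab).1 (h.2 a ha b hb hab).2

/-- `sym curl` respects single-valuedness of the degrees of freedom. -/
theorem SDofsAgree_symCurlP {k : ℕ} (hk : 3 ≤ k) {S : Set E} {v w : Fin 2 → Poly}
    (hv : v ∈ PVec (k + 1)) (hw : w ∈ PVec (k + 1)) (h : VDofsAgree k S v w) :
    SDofsAgree k S (symCurlP v) (symCurlP w) := by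
  have hvw := (PVec (k + 1)).sub_mem hv hw
  rw [← VDofsAgree_sub_iff, VDofsAgree_zero_iff hk hvw] at h
  rw [← SDofsAgree_sub_iff, ← map_sub, SDofsAgree_zero_iff hk (symCurlP_mem_PSym hvw).2]
  refine ⟨fun a ha i j => ?_, fun a ha b hb hab => ⟨fun i => ?_, ?_⟩⟩
  · have hg := fun i => (h.1 a ha i).2
    simp only [gradP_apply] at hg
    clear h
    generalize v - w = u at *
    fin_cases i <;> fin_cases j
    · simp [symCurlP_zero_zero, ev_neg, hg]
    · simp [symCurlP_zero_one, ev_smul, ev_sub, hg]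
    · simp [symCurlP_one_zero, ev_smul, ev_sub, hg]
    · simp [symCurlP_one_one, hg]
  · obtain ⟨h1, h2⟩ := h.2 a ha b hb hab
    refine res_smul_eq_zero (dist_ne_zero.2 hab) ?_
    rw [dist_smul_normalTrace_symCurlP hab, map_add, map_smul, h2, map_neg, ← derivative_res, h1]
    simp
  · obtain ⟨h1, h2⟩ := h.2 a ha b hb hab
    refine res_smul_eq_zero (dist_ne_zero.2 hab) ?_
    rw [dist_smul_divNormalTrace_symCurlP hab, map_neg, map_smul, ← derivative_res, h2]
    simp

/-- The map `x ↦ c + d x` is injective unless `d = 0`. Two zeros are the reason why sharing an edge,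
and not merely a vertex, identifies the fields of neighbours. -/
theorem eq_zero_of_mem_RTPoly {r : Fin 2 → Poly} (hr : r ∈ RTPoly) {a b : E} (hab : a ≠ b)
    (ha : ∀ i, ev a (r i) = 0) (hb : ∀ i, ev b (r i) = 0) : r = 0 := by
  obtain ⟨c, d, h⟩ := hr
  simp only [h, ev_add, ev_C, ev_smul, ev_X] at ha hb
  have hd : d = 0 := by
    by_contra hd
    refine hab ?_
    ext i
    have : d * (a i - b i) = 0 := by linarith [ha i, hb i]
    exact sub_eq_zero.1 ((mul_eq_zero.1 this).resolve_left hd)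
  funext i
  have hc : c i = 0 := by simpa [hd] using ha i
  simp [h, hd, hc]

end germs

/-! ### Barycentric coordinates and edge bubbles -/

section barycentric

open MvPolynomial

/-- A polynomial that vanishes on a nonempty open set is zero. -/
theorem eq_zero_of_ev_eq_zero {U : Set E} (hU : IsOpen U) (hne : U.Nonempty) {p : Poly}
    (h : ∀ x ∈ U, ev x p = 0) : p = 0 := by
  obtain ⟨x, hx⟩ := hne
  have hU' : IsOpen ((WithLp.toLp 2 : (Fin 2 → ℝ) → E) ⁻¹' U) :=
    hU.preimage (PiLp.continuous_toLp 2 _)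
  obtain ⟨ε, hε, hb⟩ := Metric.isOpen_iff.1 hU' (fun i => x i) hx
  refine funext_set (fun i => Metric.ball (x i) ε) (fun i => ?_) fun y hy => ?_
  · rw [Real.ball_eq_Ioo]
    exact Set.Ioo_infinite (by linarith)
  · rw [map_zero]
    rw [← ball_pi _ hε] at hy
    exact h _ (hb hy)

/-- Twice the signed area of the triangle with vertices `v`. -/
def ori (v : Fin 3 → E) : ℝ := orient (v 0) (v 1) (v 2)

/-- The barycentric coordinates of the triangle with vertices `v`. -/
def lam (v : Fin 3 → E) (i : Fin 3) : Poly :=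
  (ori v)⁻¹ • (C (v (i + 1) 0 * v (i + 2) 1 - v (i + 1) 1 * v (i + 2) 0) +
    (v (i + 1) 1 - v (i + 2) 1) • X 0 + (v (i + 2) 0 - v (i + 1) 0) • X 1)

variable {v : Fin 3 → E}

theorem lam_mem (v : Fin 3 → E) (i : Fin 3) : lam v i ∈ P 1 :=
  (P 1).smul_mem _ ((P 1).add_mem ((P 1).add_mem (C_mem_P _ _)
    ((P 1).smul_mem _ (X_mem_P 0))) ((P 1).smul_mem _ (X_mem_P 1)))

theorem ev_lam (v : Fin 3 → E) (i : Fin 3) (x : E) : ev x (lam v i) =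
    (ori v)⁻¹ * (v (i + 1) 0 * v (i + 2) 1 - v (i + 1) 1 * v (i + 2) 0 +
      (v (i + 1) 1 - v (i + 2) 1) * x 0 + (v (i + 2) 0 - v (i + 1) 0) * x 1) := by
  simp only [lam, ev_smul, ev_add, ev_C, ev_X]

theorem ev_lam_self (hv : ori v ≠ 0) (i : Fin 3) : ev (v i) (lam v i) = 1 := by
  rw [ev_lam, inv_mul_eq_one₀ hv, ori, orient]
  fin_cases i <;> simp <;> ring

theorem ev_lam_of_ne (v : Fin 3 → E) {i j : Fin 3} (h : j ≠ i) : ev (v j) (lam v i) = 0 := by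
  rw [ev_lam, mul_eq_zero]
  right
  fin_cases i <;> fin_cases j <;> first | exact absurd rfl h | (simp; ring)

theorem sum_lam (hv : ori v ≠ 0) : lam v 0 + lam v 1 + lam v 2 = 1 := by
  have : (ori v)⁻¹ • (C (ori v) : Poly) = 1 := by
    rw [smul_eq_C_mul, ← C_mul, inv_mul_cancel₀ hv, C_1]
  rw [← this, lam, lam, lam, ← smul_add, ← smul_add]
  congr 1
  simp only [ori, orient, smul_eq_C_mul, C_mul, C_sub]
  simp
  ring

theorem ev_lam_combo (v : Fin 3 → E) (i : Fin 3) (x y : E) {s t : ℝ} (hst : s + t = 1) :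
    ev (s • x + t • y) (lam v i) = s * ev x (lam v i) + t * ev y (lam v i) := by
  obtain rfl : s = 1 - t := by linarith
  simp only [ev_lam, PiLp.add_apply, PiLp.smul_apply, smul_eq_mul]
  ring

theorem sum_ev_lam (hv : ori v ≠ 0) (x : E) : ∑ i, ev x (lam v i) = 1 := by
  rw [Fin.sum_univ_three, ← ev_add, ← ev_add, sum_lam hv, ev_one]

theorem sum_ev_lam_smul (hv : ori v ≠ 0) (x : E) : ∑ i, ev x (lam v i) • v i = x := by
  rw [Fin.sum_univ_three]
  have h := hv
  ext j
  simp only [ev_lam, PiLp.add_apply, PiLp.smul_apply, smul_eq_mul]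
  field_simp
  fin_cases j <;> simp [ori, orient] <;> ring

theorem mem_convexHull_iff_lam (hv : ori v ≠ 0) (x : E) :
    x ∈ convexHull ℝ (Set.range v) ↔ ∀ i, 0 ≤ ev x (lam v i) := by
  constructor
  · intro hx
    refine convexHull_min (t := {x | ∀ i, 0 ≤ ev x (lam v i)}) ?_ ?_ hx
    · rintro _ ⟨j, rfl⟩ i
      by_cases h : j = i
      · rw [h, ev_lam_self hv]
        exact zero_le_one
      · rw [ev_lam_of_ne v h]
    · intro x hx y hy s t hs ht hst i
      rw [ev_lam_combo v i x y hst]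
      exact add_nonneg (mul_nonneg hs (hx i)) (mul_nonneg ht (hy i))
  · intro h
    rw [← sum_ev_lam_smul hv x]
    exact (convex_convexHull ℝ _).sum_mem (fun i _ => h i) (sum_ev_lam hv x)
      fun i _ => subset_convexHull ℝ _ ⟨i, rfl⟩

theorem isOpen_lam_pos (v : Fin 3 → E) : IsOpen {x | ∀ i, 0 < ev x (lam v i)} := by
  simp only [Set.ofPred_forall]
  exact isOpen_iInter_of_finite fun i => isOpen_lt continuous_const (continuous_ev _)

theorem lam_pos_subset (hv : ori v ≠ 0) :
    {x | ∀ i, 0 < ev x (lam v i)} ⊆ interior (convexHull ℝ (Set.range v)) :=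
  interior_maximal (fun x hx => (mem_convexHull_iff_lam hv x).2 fun i => (hx i).le)
    (isOpen_lam_pos v)

theorem lam_pos_nonempty (hv : ori v ≠ 0) : {x | ∀ i, 0 < ev x (lam v i)}.Nonempty := by
  refine ⟨(3 : ℝ)⁻¹ • (v 0 + v 1 + v 2), fun i => ?_⟩
  have : ev ((3 : ℝ)⁻¹ • (v 0 + v 1 + v 2)) (lam v i) =
      3⁻¹ * (ev (v 0) (lam v i) + ev (v 1) (lam v i) + ev (v 2) (lam v i)) := by
    simp only [ev_lam, PiLp.add_apply, PiLp.smul_apply, smul_eq_mul]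
    ring
  rw [this]
  have h := ev_lam_self hv
  have h' := fun i j => ev_lam_of_ne v (i := i) (j := j)
  fin_cases i <;> simp [h, h']

theorem interior_nonempty (hv : ori v ≠ 0) : (interior (convexHull ℝ (Set.range v))).Nonempty :=
  (lam_pos_nonempty hv).mono (lam_pos_subset hv)

/-- The derivative along the edge from `v i` to `v (i + 1)`. -/
abbrev dE (v : Fin 3 → E) (i : Fin 3) : Derivation ℝ Poly Poly :=
  dirD (edgeVec (v i) (v (i + 1)))

theorem dirD_lam (v : Fin 3 → E) (a b : E) (i : Fin 3) :
    dirD (edgeVec a b) (lam v i) = C (ev b (lam v i) - ev a (lam v i)) := by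
  have h0 : pderiv 0 (lam v i) = C ((ori v)⁻¹ * (v (i + 1) 1 - v (i + 2) 1)) := by
    rw [lam, pderiv_smul, map_add, map_add, pderiv_smul, pderiv_smul, pderiv_C, pderiv_X_self,
      pderiv_X_of_ne (by decide), C_mul, smul_eq_C_mul, smul_eq_C_mul]
    simp
  have h1 : pderiv 1 (lam v i) = C ((ori v)⁻¹ * (v (i + 2) 0 - v (i + 1) 0)) := by
    rw [lam, pderiv_smul, map_add, map_add, pderiv_smul, pderiv_smul, pderiv_C, pderiv_X_self,
      pderiv_X_of_ne (by decide), C_mul, smul_eq_C_mul, smul_eq_C_mul]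
    simp [smul_eq_C_mul, mul_comm]
  rw [dirD_apply, h0, h1, smul_eq_C_mul, smul_eq_C_mul, ← C_mul, ← C_mul, ← C_add, ev_lam, ev_lam]
  congr 1
  ring

theorem dE_lam_self (hv : ori v ≠ 0) (i : Fin 3) : dE v i (lam v i) = -1 := by
  rw [dirD_lam, ev_lam_self hv, ev_lam_of_ne v (by fin_cases i <;> decide)]
  simp

theorem dE_lam_succ (hv : ori v ≠ 0) (i : Fin 3) : dE v i (lam v (i + 1)) = 1 := by
  rw [dirD_lam, ev_lam_self hv, ev_lam_of_ne v (by fin_cases i <;> decide)]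
  simp

theorem dE_lam_opp (v : Fin 3 → E) (i : Fin 3) : dE v i (lam v (i + 2)) = 0 := by
  rw [dirD_lam, ev_lam_of_ne v (by fin_cases i <;> decide),
    ev_lam_of_ne v (by fin_cases i <;> decide)]
  simp

theorem res_lam_opp (v : Fin 3 → E) (i : Fin 3) : res (v i) (v (i + 1)) (lam v (i + 2)) = 0 := by
  rw [res_eq_const (by rw [dE_lam_opp, map_zero]), ev_lam_of_ne v (by fin_cases i <;> decide),
    Polynomial.C_0]

theorem lam_ne_zero (hv : ori v ≠ 0) (i : Fin 3) : lam v i ≠ 0 := fun h => by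
  simpa [h, ev_zero] using ev_lam_self hv i

/-- The edge bubble of the edge from `v i` to `v (i + 1)`. -/
def edgeBubble (v : Fin 3 → E) (i : Fin 3) : Poly := lam v i * lam v (i + 1)

theorem edgeBubble_mem (v : Fin 3 → E) (i : Fin 3) : edgeBubble v i ∈ P 2 :=
  mul_mem_P (lam_mem v i) (lam_mem v (i + 1))

theorem edgeBubble_ne_zero (hv : ori v ≠ 0) (i : Fin 3) : edgeBubble v i ≠ 0 :=
  mul_ne_zero (lam_ne_zero hv _) (lam_ne_zero hv _)

theorem ev_edgeBubble_nonneg (hv : ori v ≠ 0) (i : Fin 3) {x : E}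
    (hx : x ∈ convexHull ℝ (Set.range v)) : 0 ≤ ev x (edgeBubble v i) := by
  rw [edgeBubble, ev_mul]
  exact mul_nonneg ((mem_convexHull_iff_lam hv x).1 hx _) ((mem_convexHull_iff_lam hv x).1 hx _)

/-- The edge bubble contains the barycentric coordinate of each endpoint of its edge, and on either
other edge one of these two coordinates vanishes. -/
theorem res_edgeBubble_of_ne (v : Fin 3 → E) {i j : Fin 3} (h : j ≠ i) :
    res (v j) (v (j + 1)) (edgeBubble v i) = 0 := by
  rw [edgeBubble, map_mul]
  rcases (by fin_cases i <;> fin_cases j <;> simp_all : i = j + 2 ∨ i + 1 = j + 2) with h | h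
  · rw [h, res_lam_opp, zero_mul]
  · rw [h, res_lam_opp, mul_zero]

theorem ev_edgeBubble (v : Fin 3 → E) (i j : Fin 3) : ev (v j) (edgeBubble v i) = 0 := by
  rw [edgeBubble, ev_mul]
  by_cases h : j = i
  · subst h
    rw [ev_lam_of_ne v (i := j + 1) (by fin_cases j <;> decide), mul_zero]
  · rw [ev_lam_of_ne v h, zero_mul]

end barycentric

/-! ### Integration by parts on a triangle without boundary terms -/

section cells

open MvPolynomial

/-- The integral of a polynomial over the triangle with vertices `T`. -/
def cellInt (T : Finset E) : Poly →ₗ[ℝ] ℝ where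
  toFun p := ∫ x in convexHull ℝ (T : Set E), ev x p
  map_add' p q := by
    simp only [ev_add]
    exact integral_add (integrableOn_ev T p) (integrableOn_ev T q)
  map_smul' c p := by
    simp only [ev_smul]
    exact integral_const_mul _ _

theorem cellInt_apply (T : Finset E) (p : Poly) :
    cellInt T p = ∫ x in convexHull ℝ (T : Set E), ev x p := rfl

theorem contDiff_ev (p : Poly) {n : WithTop ℕ∞} : ContDiff ℝ n fun x : E => ev x p := by
  induction p using MvPolynomial.induction_on with
  | C c => simpa only [ev_C] using contDiff_const
  | add p q hp hq => simpa only [ev_add] using hp.add hq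
  | mul_X p i hp =>
    simp only [ev_mul, ev_X]
    exact hp.mul (contDiff_piLp_apply 2)

theorem pd_add {f g : E → ℝ} (hf : Differentiable ℝ f) (hg : Differentiable ℝ g) (i : Fin 2)
    (x : E) : pd i (fun x => f x + g x) x = pd i f x + pd i g x := by
  simp only [pd]
  rw [fderiv_fun_add (hf x) (hg x)]
  rfl

theorem pd_mul {f g : E → ℝ} (hf : Differentiable ℝ f) (hg : Differentiable ℝ g) (i : Fin 2)
    (x : E) : pd i (fun x => f x * g x) x = pd i f x * g x + f x * pd i g x := by
  simp only [pd]
  rw [fderiv_fun_mul (hf x) (hg x)]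
  simp
  ring

theorem pd_ev (i : Fin 2) (p : Poly) : pd i (fun x => ev x p) = fun x => ev x (pderiv i p) := by
  have hd : ∀ p : Poly, Differentiable ℝ fun x : E => ev x p := fun p =>
    (contDiff_ev p (n := 1)).differentiable (by norm_num)
  induction p using MvPolynomial.induction_on with
  | C c =>
    funext x
    simp [pd, ev_C, ev_zero]
  | add p q hp hq =>
    funext x
    simp only [ev_add, map_add]
    rw [pd_add (hd p) (hd q), hp, hq]
  | mul_X p j hp =>
    funext x
    have hX : pd i (fun x : E => ev x (X j)) x = ev x (pderiv i (X j)) := by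
      simp only [ev_X, pd]
      rw [(PiLp.hasFDerivAt_apply (𝕜 := ℝ) 2 x j).fderiv]
      rcases eq_or_ne j i with rfl | h
      · simp [ev_one]
      · simp [pderiv_X_of_ne h, ev_zero, h]
    simp only [ev_mul]
    rw [pd_mul (hd p) (hd (X j)), hp, hX, Derivation.leibniz, ev_add, smul_eq_mul, smul_eq_mul,
      ev_mul, ev_mul]
    ring

theorem integral_div_range {v : Fin 3 → E} (hv : ori v ≠ 0) {F : Fin 2 → E → ℝ}
    (hF : ∀ i, ContDiff ℝ 1 (F i)) :
    ∫ x in convexHull ℝ (Set.range v), (pd 0 (F 0) x + pd 1 (F 1) x) =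
      |ori v| / ori v * ∑ i, flux (v i) (v (i + 1)) F := by
  have hr : Set.range v = {v 0, v 1, v 2} := by
    ext x
    simp [Fin.exists_fin_succ, eq_comm]
  rw [hr, integral_div_triangle hv hF, Fin.sum_univ_three]
  rfl

variable {T : Finset E} {v : Fin 3 → E}

theorem flux_ev_eq_zero {a b : E} {w : Fin 2 → Poly}
    (h : res a b ((b 1 - a 1) • w 0 - (b 0 - a 0) • w 1) = 0) :
    flux a b (fun i x => ev x (w i)) = 0 := by
  simp only [flux, ← eval_res, ← intervalIntegral.integral_const_mul]
  rw [← intervalIntegral.integral_sub]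
  · rw [intervalIntegral.integral_congr (g := fun _ => 0) fun s _ => ?_]
    · simp
    · have := congrArg (Polynomial.eval s) h
      simpa using this
  all_goals exact (continuous_const.mul (Polynomial.continuous _)).intervalIntegrable _ _

theorem cellInt_divP_eq_zero (hT : (T : Set E) = Set.range v) (hv : ori v ≠ 0) {w : Fin 2 → Poly}
    (h : ∀ i, res (v i) (v (i + 1))
      ((v (i + 1) 1 - v i 1) • w 0 - (v (i + 1) 0 - v i 0) • w 1) = 0) :
    cellInt T (divP w) = 0 := by
  have h1 := integral_div_range hv (F := fun i x => ev x (w i)) fun i => contDiff_ev _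
  rw [Finset.sum_eq_zero fun i _ => flux_ev_eq_zero (h i), mul_zero] at h1
  simp only [pd_ev] at h1
  rw [cellInt_apply, hT, divP_apply]
  simpa only [ev_add] using h1

theorem divP_smul_eq (t : Fin 2 → ℝ) (p : Poly) : divP (fun j => t j • p) = dirD t p := by
  rw [divP_apply, dirD_apply, pderiv_smul, pderiv_smul]

/-- The integrand is the divergence of `bᵢ r tᵢ`, which has no normal component on the edge `i`,
being tangential, nor on the other edges, where `bᵢ` vanishes. -/
theorem cellInt_dE_edgeBubble (hT : (T : Set E) = Set.range v) (hv : ori v ≠ 0) (i : Fin 3)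
    (r : Poly) : cellInt T (dE v i (edgeBubble v i * r)) = 0 := by
  rw [← divP_smul_eq]
  refine cellInt_divP_eq_zero hT hv fun j => ?_
  by_cases h : j = i
  · subst h
    have : (v (j + 1) 1 - v j 1) • edgeVec (v j) (v (j + 1)) 0 • (edgeBubble v j * r) -
      (v (j + 1) 0 - v j 0) • edgeVec (v j) (v (j + 1)) 1 • (edgeBubble v j * r) = 0 := by module
    rw [this, map_zero]
  · rw [map_sub, map_smul, map_smul, map_smul, map_smul, map_mul, res_edgeBubble_of_ne v h]
    simp

/-- This makes the weighted operators below symmetric and negative semidefinite, with no boundary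
condition on the polynomials. -/
theorem cellInt_mul_dE (hT : (T : Set E) = Set.range v) (hv : ori v ≠ 0) (i : Fin 3)
    (p r : Poly) : cellInt T (p * dE v i (edgeBubble v i * r)) =
      -cellInt T (edgeBubble v i * (r * dE v i p)) := by
  have h := cellInt_dE_edgeBubble hT hv i (p * r)
  have e : edgeBubble v i * (p * r) = p * (edgeBubble v i * r) := by ring
  rw [e, Derivation.leibniz, map_add, smul_eq_mul, smul_eq_mul] at h
  rw [eq_neg_iff_add_eq_zero, ← h, mul_assoc]

theorem cellInt_nonneg (hT : (T : Set E) = Set.range v) {p : Poly}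
    (h : ∀ x ∈ convexHull ℝ (Set.range v), 0 ≤ ev x p) : 0 ≤ cellInt T p :=
  setIntegral_nonneg (T.finite_toSet.isCompact_convexHull (𝕜 := ℝ)).measurableSet (hT ▸ h)

theorem eq_zero_of_cellInt_eq_zero (hT : (T : Set E) = Set.range v) (hv : ori v ≠ 0) {p : Poly}
    (h : ∀ x ∈ convexHull ℝ (Set.range v), 0 ≤ ev x p) (h0 : cellInt T p = 0) : p = 0 := by
  have hm := (T.finite_toSet.isCompact_convexHull (𝕜 := ℝ)).measurableSet
  rw [← hT] at h
  rw [cellInt_apply, setIntegral_eq_zero_iff_of_nonneg_ae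
    ((ae_restrict_iff' hm).2 (Filter.Eventually.of_forall h)) (integrableOn_ev T p)] at h0
  refine eq_zero_of_ev_eq_zero isOpen_interior (interior_nonempty hv) ?_
  rw [← hT]
  have h1 : (fun x => ev x p) =ᵐ[volume.restrict (interior (convexHull ℝ (T : Set E)))] 0 :=
    ae_restrict_of_ae_restrict_of_subset interior_subset h0
  exact Measure.eqOn_open_of_ae_eq h1 isOpen_interior (continuous_ev p).continuousOn
    continuousOn_const

theorem eq_zero_of_cellInt_sq (hT : (T : Set E) = Set.range v) (hv : ori v ≠ 0) {p : Poly}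
    (h0 : cellInt T (p * p) = 0) : p = 0 :=
  mul_self_eq_zero.1 (eq_zero_of_cellInt_eq_zero hT hv
    (fun x _ => by rw [ev_mul]; exact mul_self_nonneg _) h0)

theorem ev_edgeBubble_mul_sq_nonneg (hv : ori v ≠ 0) (i : Fin 3) (p : Poly) {x : E}
    (hx : x ∈ convexHull ℝ (Set.range v)) : 0 ≤ ev x (edgeBubble v i * (p * p)) := by
  rw [ev_mul, ev_mul]
  exact mul_nonneg (ev_edgeBubble_nonneg hv i hx) (mul_self_nonneg _)

theorem eq_zero_of_sum_cellInt_edgeBubble (hT : (T : Set E) = Set.range v) (hv : ori v ≠ 0)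
    {p : Fin 3 → Poly} (h : ∑ i, cellInt T (edgeBubble v i * (p i * p i)) = 0) (i : Fin 3) :
    p i = 0 := by
  have hnn : ∀ i, ∀ x ∈ convexHull ℝ (Set.range v), 0 ≤ ev x (edgeBubble v i * (p i * p i)) :=
    fun i _ hx => ev_edgeBubble_mul_sq_nonneg hv i (p i) hx
  have h1 := (Finset.sum_eq_zero_iff_of_nonneg fun i _ =>
    cellInt_nonneg hT (hnn i)).1 h i (Finset.mem_univ i)
  have h2 := eq_zero_of_cellInt_eq_zero hT hv (hnn i) h1
  exact mul_self_eq_zero.1 ((mul_eq_zero.1 h2).resolve_left (edgeBubble_ne_zero hv i))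

end cells

/-! ### Vertices of a triangle and Green's formula for `div div` -/

section triangles

open MvPolynomial

theorem orient_ne_zero_of_affineIndependent {v : Fin 3 → E} (h : AffineIndependent ℝ v) :
    ori v ≠ 0 := by
  intro h0
  rw [affineIndependent_iff] at h
  have key : ∀ r s : ℝ, r • (v 1 - v 0) + s • (v 2 - v 0) = 0 → r = 0 ∧ s = 0 := by
    intro r s hrs
    have := h Finset.univ ![-r - s, r, s] (by simp [Fin.sum_univ_three]; ring) (by
      simp [Fin.sum_univ_three]
      rw [← hrs]
      module)
    exact ⟨by simpa using this 1, by simpa using this 2⟩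
  rw [ori, orient] at h0
  -- If the determinant of the edge vectors `e₁`, `e₂` is zero, then `(e₂)ⱼ e₁ - (e₁)ⱼ e₂ = 0` for
  -- both coordinates `j`. Independence gives `e₁ = 0`, which contradicts independence.
  have h1 := key (v 2 1 - v 0 1) (-(v 1 1 - v 0 1)) (by
    ext i
    fin_cases i <;> simp <;> linarith)
  have h2 := key (v 2 0 - v 0 0) (-(v 1 0 - v 0 0)) (by
    ext i
    fin_cases i <;> simp <;> linarith)
  have h3 := (key 1 0 (by
    ext i
    fin_cases i
    · simpa using neg_eq_zero.1 h2.2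
    · simpa using neg_eq_zero.1 h1.2)).1
  exact one_ne_zero h3

theorem IsTriangle.exists_vertices {T : Finset E} (hT : IsTriangle T) :
    ∃ v : Fin 3 → E, (T : Set E) = Set.range v ∧ ori v ≠ 0 := by
  obtain ⟨hc, hi⟩ := hT
  let e : Fin 3 ≃ T := (T.equivFinOfCardEq hc).symm
  refine ⟨fun i => e i, ?_, orient_ne_zero_of_affineIndependent (hi.comp_embedding e.toEmbedding)⟩
  ext x
  constructor
  · intro hx
    exact ⟨e.symm ⟨x, hx⟩, by simp⟩
  · rintro ⟨i, rfl⟩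
    exact (e i).2

theorem vertices_ne {v : Fin 3 → E} (hv : ori v ≠ 0) {i j : Fin 3} (h : i ≠ j) : v i ≠ v j :=
  fun e => one_ne_zero ((ev_lam_self hv i).symm.trans (e ▸ ev_lam_of_ne v h.symm))

/-- Indices are taken modulo three, so two distinct ones are consecutive in one of the two orders.
-/
theorem forall_edges {v : Fin 3 → E} {R : E → E → Prop} (hs : ∀ a b, R a b → R b a)
    (h : ∀ i, R (v i) (v (i + 1))) : ∀ a ∈ Set.range v, ∀ b ∈ Set.range v, a ≠ b → R a b := by
  rintro _ ⟨i, rfl⟩ _ ⟨j, rfl⟩ hij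
  rcases (by fin_cases i <;> fin_cases j <;> simp_all : j = i + 1 ∨ i = j + 1) with rfl | rfl
  · exact h i
  · exact hs _ _ (h j)

theorem res_symm {a b : E} {p : Poly} (h : res a b p = 0) : res b a p = 0 := by
  refine Polynomial.funext fun s => ?_
  have := congrArg (Polynomial.eval (1 - s)) h
  rw [eval_res, AffineMap.lineMap_apply_one_sub] at this
  rw [eval_res, this, Polynomial.eval_zero, Polynomial.eval_zero]

theorem unitNormal_symm (a b : E) (i : Fin 2) : unitNormal b a i = -unitNormal a b i := by
  rw [unitNormal, unitNormal, dist_comm b a]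
  fin_cases i <;> simp <;> ring

theorem normalTrace_symm (a b : E) (σ : Matrix (Fin 2) (Fin 2) Poly) (i : Fin 2) :
    normalTrace b a σ i = -normalTrace a b σ i := by
  simp only [normalTrace_apply, unitNormal_symm a b]
  module

theorem divNormalTrace_symm (a b : E) (σ : Matrix (Fin 2) (Fin 2) Poly) :
    divNormalTrace b a σ = -divNormalTrace a b σ := by
  simp only [divNormalTrace_apply, unitNormal_symm a b]
  module

theorem SDofsAgree_zero_of_edges {k : ℕ} (hk : 3 ≤ k) {T : Finset E} {v : Fin 3 → E}
    (hT : (T : Set E) = Set.range v) {σ : Matrix (Fin 2) (Fin 2) Poly} (hσ : σ ∈ PSym k)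
    (h₀ : ∀ l i j, ev (v l) (σ i j) = 0)
    (h₁ : ∀ l i, res (v l) (v (l + 1)) (normalTrace (v l) (v (l + 1)) σ i) = 0)
    (h₂ : ∀ l, res (v l) (v (l + 1)) (divNormalTrace (v l) (v (l + 1)) σ) = 0) :
    SDofsAgree k (T : Set E) σ 0 := by
  rw [SDofsAgree_zero_iff hk hσ.2, hT]
  refine ⟨?_, forall_edges (fun a b ⟨h1, h2⟩ => ⟨fun i => ?_, ?_⟩) fun l => ⟨h₁ l, h₂ l⟩⟩
  · rintro _ ⟨l, rfl⟩
    exact h₀ l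
  · rw [normalTrace_symm, map_neg, res_symm (h1 i), neg_zero]
  · rw [divNormalTrace_symm, map_neg, res_symm h2, neg_zero]

/-- The boundary term on the edge from `a` to `b` in Green's formula for `div div`. -/
def edgeTerm (a b : E) (σ : Matrix (Fin 2) (Fin 2) Poly) (φ : E → ℝ) : ℝ :=
  dist a b * ∫ s in (0 : ℝ)..1,
    (φ (AffineMap.lineMap a b s) * (res a b (divNormalTrace a b σ)).eval s -
      ∑ j, pd j φ (AffineMap.lineMap a b s) * (res a b (normalTrace a b σ j)).eval s)

theorem edgeTerm_eq_zero {a b : E} {σ : Matrix (Fin 2) (Fin 2) Poly}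
    (h₁ : ∀ i, res a b (normalTrace a b σ i) = 0) (h₂ : res a b (divNormalTrace a b σ) = 0)
    (φ : E → ℝ) : edgeTerm a b σ φ = 0 := by
  simp [edgeTerm, h₁, h₂]

theorem contDiff_pd_one {φ : E → ℝ} (hφ : ContDiff ℝ 2 φ) (i : Fin 2) : ContDiff ℝ 1 (pd i φ) :=
  (hφ.fderiv_right (m := 1) (by norm_num)).clm_apply contDiff_const

/-- The field is `φ div σ - σ ∇φ`, with divergence `φ div div σ - σ : ∇²φ`. Symmetry of `σ` turns
`(σ ∇φ) · n` into `∇φ · σn`. -/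
theorem flux_eq_edgeTerm {a b : E} (hab : a ≠ b) (σ : Matrix (Fin 2) (Fin 2) Poly)
    (hσ : σ.IsSymm) {φ : E → ℝ} (hφ : ContDiff ℝ 2 φ) :
    flux a b (fun i x => φ x * ev x (rowDivP σ i) - ∑ j, ev x (σ i j) * pd j φ x) =
      edgeTerm a b σ φ := by
  have hd : dist a b ≠ 0 := dist_ne_zero.2 hab
  have hs : σ 1 0 = σ 0 1 := hσ.apply 0 1
  have hc : ∀ i, Continuous fun x => φ x * ev x (rowDivP σ i) - ∑ j, ev x (σ i j) * pd j φ x :=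
    fun i => (hφ.continuous.mul (continuous_ev _)).sub (continuous_finsetSum _ fun j _ =>
      (continuous_ev _).mul (contDiff_pd_one hφ j).continuous)
  rw [flux, edgeTerm, ← intervalIntegral.integral_const_mul, ← intervalIntegral.integral_const_mul,
    ← intervalIntegral.integral_const_mul, ← intervalIntegral.integral_sub]
  · refine intervalIntegral.integral_congr fun s _ => ?_
    simp only [eval_res, normalTrace_apply, divNormalTrace_apply, ev_add, ev_smul, unitNormal,
      Fin.sum_univ_two, Matrix.cons_val_zero, Matrix.cons_val_one, hs]
    field_simp
    ring
  all_goals exact (continuous_const.mul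
    ((hc _).comp AffineMap.lineMap_continuous)).intervalIntegrable _ _

/-- Green's formula for `div div` on a triangle. -/
theorem integral_divDiv_triangle {v : Fin 3 → E} (hv : ori v ≠ 0)
    {σ : Matrix (Fin 2) (Fin 2) Poly} (hσ : σ.IsSymm) {φ : E → ℝ} (hφ : ContDiff ℝ 2 φ) :
    ∫ x in convexHull ℝ (Set.range v),
        (ev x (divDivP σ) * φ x - ∑ i, ∑ j, ev x (σ i j) * pd i (pd j φ) x) =
      |ori v| / ori v * ∑ i, edgeTerm (v i) (v (i + 1)) σ φ := by
  have hs : σ 1 0 = σ 0 1 := hσ.apply 0 1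
  have h1 := fun i => contDiff_pd_one hφ i
  have hφ1 : ContDiff ℝ 1 φ := hφ.of_le (by norm_num)
  have hd : ∀ {f : E → ℝ}, ContDiff ℝ 1 f → Differentiable ℝ f := fun h =>
    h.differentiable (by norm_num)
  have hF : ∀ i, ContDiff ℝ 1
      (fun x => φ x * ev x (rowDivP σ i) - ∑ j, ev x (σ i j) * pd j φ x) := fun i =>
    (hφ1.mul (contDiff_ev _)).sub (ContDiff.sum fun j _ => (contDiff_ev _).mul (h1 j))
  have key := integral_div_range hv hF
  rw [Finset.sum_congr rfl fun i _ => flux_eq_edgeTerm (σ := σ) (vertices_ne hv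
    (show i ≠ i + 1 by fin_cases i <;> decide)) hσ hφ] at key
  rw [← key]
  congr 1
  ext x
  have e : ∀ i l : Fin 2, pd l (fun x => φ x * ev x (rowDivP σ i) - ∑ j, ev x (σ i j) * pd j φ x) x =
      pd l φ x * ev x (rowDivP σ i) + φ x * ev x (pderiv l (rowDivP σ i)) -
        ∑ j, (ev x (pderiv l (σ i j)) * pd j φ x + ev x (σ i j) * pd l (pd j φ) x) := by
    intro i l
    have e0 : (fun x => φ x * ev x (rowDivP σ i) - ∑ j, ev x (σ i j) * pd j φ x) =
        fun x => φ x * ev x (rowDivP σ i) +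
          (ev x (-σ i 0) * pd 0 φ x + ev x (-σ i 1) * pd 1 φ x) := by
      funext x
      rw [Fin.sum_univ_two, ev_neg, ev_neg]
      ring
    have d0 := hd hφ1
    have d1 := fun p : Poly => hd (contDiff_ev p)
    have d2 := fun j => hd (h1 j)
    rw [e0, pd_add (d0.fun_mul (d1 _)) (((d1 _).fun_mul (d2 _)).fun_add ((d1 _).fun_mul (d2 _))),
      pd_add ((d1 _).fun_mul (d2 _)) ((d1 _).fun_mul (d2 _)), pd_mul d0 (d1 _), pd_mul (d1 _) (d2 _),
      pd_mul (d1 _) (d2 _), pd_ev, pd_ev, pd_ev, Fin.sum_univ_two, map_neg, map_neg]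
    simp only [ev_neg]
    ring
  rw [e, e, divDivP_apply, ← rowDivP_apply, ← rowDivP_apply]
  simp only [Fin.sum_univ_two, ev_add, rowDivP_apply, hs]
  ring

theorem pderiv_eq_zero_of_mem_P_zero {p : Poly} (hp : p ∈ P 0) (i : Fin 2) : pderiv i p = 0 := by
  rw [mem_P, Nat.le_zero, totalDegree_eq_zero_iff_eq_C] at hp
  rw [hp, pderiv_C]

/-- An affine test function has no second derivatives, and all boundary terms of Green's formula
vanish for a bubble. -/
theorem divDivP_mem_bubbleP {k : ℕ} (hk : 3 ≤ k) {T : Finset E} (hT : IsTriangle T)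
    {σ : Matrix (Fin 2) (Fin 2) Poly} (hσ : σ ∈ bubbleS k T) : divDivP σ ∈ bubbleP k T := by
  obtain ⟨l, rfl⟩ : ∃ l, k = l + 2 := ⟨k - 2, by omega⟩
  obtain ⟨v, hv, hv0⟩ := hT.exists_vertices
  obtain ⟨hσ, hd⟩ := hσ
  refine ⟨divDivP_mem hσ.2, fun p hp => ?_⟩
  have key := integral_divDiv_triangle hv0 hσ.1 (contDiff_ev p)
  rw [SDofsAgree_zero_iff hk hσ.2] at hd
  rw [Finset.sum_eq_zero, mul_zero] at key
  · rw [hv, ← key]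
    congr 1
    ext x
    simp only [pd_ev, pderiv_eq_zero_of_mem_P_zero (pderiv_mem_P _ hp), ev_zero, ev_mul]
    simp
  · intro i _
    have := hd.2 (v i) (by rw [hv]; exact ⟨i, rfl⟩) (v (i + 1)) (by rw [hv]; exact ⟨i + 1, rfl⟩)
      (vertices_ne hv0 (by fin_cases i <;> decide))
    exact edgeTerm_eq_zero this.1 this.2 _

end triangles

/-! ### Weighted Laplace and elasticity problems on a triangle -/

section bubbleSurjectivity

open MvPolynomial

/-- Both boundary value problems below are solved through this: uniqueness comes from an energy
identity, and existence from finite dimension. -/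
theorem exists_eq_of_injOn {M : Type*} [AddCommGroup M] [Module ℝ M] (Z : Submodule ℝ M)
    [FiniteDimensional ℝ Z] (f : M →ₗ[ℝ] M) (hf : ∀ z ∈ Z, f z ∈ Z)
    (hinj : ∀ z ∈ Z, f z = 0 → z = 0) {z : M} (hz : z ∈ Z) : ∃ y ∈ Z, f y = z := by
  have h1 : Function.Injective (f.restrict hf) := by
    rw [← LinearMap.ker_eq_bot, LinearMap.ker_eq_bot']
    exact fun z h => Subtype.ext (hinj z z.2 (congrArg Subtype.val h))
  obtain ⟨y, hy⟩ := LinearMap.injective_iff_surjective.1 h1 ⟨z, hz⟩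
  exact ⟨y, y.2, congrArg Subtype.val hy⟩

instance finiteDimensional_PVec (l : ℕ) : FiniteDimensional ℝ (PVec l) := by
  let f : (Fin 2 → P l) →ₗ[ℝ] (Fin 2 → Poly) := LinearMap.pi fun i =>
    (P l).subtype ∘ₗ LinearMap.proj i
  have h : PVec l ≤ LinearMap.range f := fun w hw =>
    ⟨fun i => ⟨w i, mem_PVec.1 hw i⟩, rfl⟩
  exact Submodule.finiteDimensional_of_le h

variable {T : Finset E} {v : Fin 3 → E}

theorem dirD_mem {l : ℕ} {p : Poly} (t : Fin 2 → ℝ) (hp : p ∈ P (l + 1)) : dirD t p ∈ P l :=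
  dirD_apply t p ▸ (P l).add_mem ((P l).smul_mem _ (pderiv_mem_P 0 hp))
    ((P l).smul_mem _ (pderiv_mem_P 1 hp))

theorem pderiv_eq_zero_of_dE (hv : ori v ≠ 0) {p : Poly} (h : ∀ i, dE v i p = 0) (i : Fin 2) :
    pderiv i p = 0 := by
  have h0 := h 0
  have h2 := h 2
  rw [dirD_apply] at h0 h2
  simp only [edgeVec, zero_add, show (2 : Fin 3) + 1 = 0 from rfl] at h0 h2
  have e0 : ori v • pderiv 0 p = 0 := by
    have : ori v • pderiv 0 p = (v 2 1 - v 0 1) • ((v 1 0 - v 0 0) • pderiv 0 p +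
      (v 1 1 - v 0 1) • pderiv 1 p) + (v 1 1 - v 0 1) • ((v 0 0 - v 2 0) • pderiv 0 p +
      (v 0 1 - v 2 1) • pderiv 1 p) := by rw [ori, orient]; module
    rw [this, h0, h2, smul_zero, smul_zero, add_zero]
  have e1 : ori v • pderiv 1 p = 0 := by
    have : ori v • pderiv 1 p = -((v 2 0 - v 0 0) • ((v 1 0 - v 0 0) • pderiv 0 p +
      (v 1 1 - v 0 1) • pderiv 1 p) + (v 1 0 - v 0 0) • ((v 0 0 - v 2 0) • pderiv 0 p +
      (v 0 1 - v 2 1) • pderiv 1 p)) := by rw [ori, orient]; module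
    rw [this, h0, h2, smul_zero, smul_zero, add_zero, neg_zero]
  fin_cases i
  · exact (smul_eq_zero.1 e0).resolve_left hv
  · exact (smul_eq_zero.1 e1).resolve_left hv

/-- Mean-free polynomials are divergences of fields with vanishing normal trace. -/
theorem exists_sum_dE_eq (hT : (T : Set E) = Set.range v) (hv : ori v ≠ 0) {l : ℕ} {q : Poly}
    (hq : q ∈ P (l + 1)) (h0 : cellInt T q = 0) :
    ∃ r ∈ P (l + 1), ∑ i, dE v i (edgeBubble v i * dE v i r) = q := by
  -- A degenerate Neumann problem. The bubbles raise the degree by two and the two derivatives lower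
  -- it by two, so `f` maps the mean-free polynomials of bounded degree into themselves.
  let f : Poly →ₗ[ℝ] Poly := ∑ i, (dE v i : Poly →ₗ[ℝ] Poly) ∘ₗ
    LinearMap.mulLeft ℝ (edgeBubble v i) ∘ₗ (dE v i : Poly →ₗ[ℝ] Poly)
  have hf : ∀ r, f r = ∑ i, dE v i (edgeBubble v i * dE v i r) := fun r => by
    simp [f, LinearMap.sum_apply]
  let Z : Submodule ℝ Poly := P (l + 1) ⊓ LinearMap.ker (cellInt T)
  have : FiniteDimensional ℝ Z := Submodule.finiteDimensional_of_le (inf_le_left : Z ≤ P (l + 1))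
  have hmaps : ∀ r ∈ Z, f r ∈ Z := by
    intro r hr
    rw [hf]
    refine ⟨Submodule.sum_mem _ fun i _ => dirD_mem _ ?_, ?_⟩
    · have := mul_mem_P (edgeBubble_mem v i) (dirD_mem (edgeVec (v i) (v (i + 1))) hr.1)
      exact P_mono (by omega) this
    · rw [SetLike.mem_coe, LinearMap.mem_ker, map_sum]
      exact Finset.sum_eq_zero fun i _ => cellInt_dE_edgeBubble hT hv i _
  have hinj : ∀ r ∈ Z, f r = 0 → r = 0 := by
    intro r hr h
    -- Testing `f r = 0` with `r` gives the energy. Every summand is nonnegative, so all tangential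
    -- derivatives vanish and `r` is constant; having mean zero, it is `0`.
    have h1 : ∑ i, cellInt T (edgeBubble v i * (dE v i r * dE v i r)) = 0 := by
      have h2 : cellInt T (r * f r) = 0 := by rw [h, mul_zero, map_zero]
      rw [hf, Finset.mul_sum, map_sum] at h2
      simp only [cellInt_mul_dE hT hv, Finset.sum_neg_distrib, neg_eq_zero] at h2
      exact h2
    obtain ⟨c, rfl⟩ := eq_C_of_pderiv_eq_zero
      (pderiv_eq_zero_of_dE hv (eq_zero_of_sum_cellInt_edgeBubble hT hv h1))
    refine eq_zero_of_cellInt_sq hT hv ?_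
    rw [← smul_eq_C_mul, map_smul, hr.2, smul_zero]
  obtain ⟨r, hr, e⟩ := exists_eq_of_injOn Z f hmaps hinj (show q ∈ Z from ⟨hq, h0⟩)
  exact ⟨r, hr.1, by rw [← hf, e]⟩

/-- The component `tᵀ ε(w) t` of the strain along the edge with tangent `t`. -/
def strain (v : Fin 3 → E) (i : Fin 3) : (Fin 2 → Poly) →ₗ[ℝ] Poly :=
  ∑ j, edgeVec (v i) (v (i + 1)) j • ((dE v i : Poly →ₗ[ℝ] Poly) ∘ₗ LinearMap.proj j)

theorem strain_apply (v : Fin 3 → E) (i : Fin 3) (w : Fin 2 → Poly) : strain v i w =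
    ∑ j, edgeVec (v i) (v (i + 1)) j • dE v i (w j) := by
  simp [strain]

theorem strain_mem {l : ℕ} {w : Fin 2 → Poly} (v : Fin 3 → E) (i : Fin 3) (hw : w ∈ PVec (l + 1)) :
    strain v i w ∈ P l := by
  rw [strain_apply]
  exact Submodule.sum_mem _ fun j _ => (P l).smul_mem _ (dirD_mem _ (mem_PVec.1 hw j))

/-- The moments of `w` against the rotation about the origin. -/
def rotMoment (T : Finset E) : (Fin 2 → Poly) →ₗ[ℝ] ℝ :=
  cellInt T ∘ₗ (LinearMap.mulLeft ℝ (X 0 : Poly) ∘ₗ LinearMap.proj 1 -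
    LinearMap.mulLeft ℝ (X 1 : Poly) ∘ₗ LinearMap.proj 0)

theorem rotMoment_apply (T : Finset E) (w : Fin 2 → Poly) :
    rotMoment T w = cellInt T (X 0 * w 1 - X 1 * w 0) := by
  simp [rotMoment]

/-- The combination of tangential tensors `∑ pᵢ tᵢ tᵢᵀ`. -/
def tangentTensor (v : Fin 3 → E) (p : Fin 3 → Poly) : Matrix (Fin 2) (Fin 2) Poly :=
  Matrix.of fun j l => ∑ i,
    (edgeVec (v i) (v (i + 1)) j * edgeVec (v i) (v (i + 1)) l) • p i

theorem tangentTensor_apply (v : Fin 3 → E) (p : Fin 3 → Poly) (j l : Fin 2) :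
    tangentTensor v p j l = ∑ i,
      (edgeVec (v i) (v (i + 1)) j * edgeVec (v i) (v (i + 1)) l) • p i := rfl

theorem rowDivP_tangentTensor (v : Fin 3 → E) (p : Fin 3 → Poly) (j : Fin 2) :
    rowDivP (tangentTensor v p) j = ∑ i, edgeVec (v i) (v (i + 1)) j • dE v i (p i) := by
  rw [rowDivP_apply, tangentTensor_apply, tangentTensor_apply, map_sum, map_sum,
    ← Finset.sum_add_distrib]
  refine Finset.sum_congr rfl fun i _ => ?_
  rw [dirD_apply, pderiv_smul, pderiv_smul]
  module

theorem tangentTensor_mem {l : ℕ} {p : Fin 3 → Poly} (hp : ∀ i, p i ∈ P l) :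
    tangentTensor v p ∈ PSym l := by
  refine ⟨?_, fun i j => ?_⟩
  swap
  · rw [tangentTensor_apply]
    exact Submodule.sum_mem _ fun _ _ => (P l).smul_mem _ (hp _)
  ext1 i j
  simp only [Matrix.transpose_apply, tangentTensor_apply, mul_comm]

theorem normalTrace_tangentTensor (a b : E) (v : Fin 3 → E) (p : Fin 3 → Poly) (j : Fin 2) :
    normalTrace a b (tangentTensor v p) j = ∑ i, (edgeVec (v i) (v (i + 1)) j *
      (unitNormal a b 0 * edgeVec (v i) (v (i + 1)) 0 +
        unitNormal a b 1 * edgeVec (v i) (v (i + 1)) 1)) • p i := by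
  rw [normalTrace_apply, tangentTensor_apply, tangentTensor_apply, Finset.smul_sum,
    Finset.smul_sum, ← Finset.sum_add_distrib]
  refine Finset.sum_congr rfl fun i _ => ?_
  module

theorem divNormalTrace_tangentTensor (a b : E) (v : Fin 3 → E) (p : Fin 3 → Poly) :
    divNormalTrace a b (tangentTensor v p) = ∑ i,
      (unitNormal a b 0 * edgeVec (v i) (v (i + 1)) 0 +
        unitNormal a b 1 * edgeVec (v i) (v (i + 1)) 1) • dE v i (p i) := by
  rw [divNormalTrace_apply, rowDivP_tangentTensor, rowDivP_tangentTensor, Finset.smul_sum,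
    Finset.smul_sum, ← Finset.sum_add_distrib]
  refine Finset.sum_congr rfl fun i _ => ?_
  module

theorem unitNormal_dot_edgeVec (a b : E) :
    unitNormal a b 0 * edgeVec a b 0 + unitNormal a b 1 * edgeVec a b 1 = 0 := by
  simp [unitNormal, edgeVec]
  ring

/-- A binary quadratic form is determined by its values in three pairwise independent directions,
here `a`, `c`, `a + c`. The triples given to `key` are rows of the inverse of this evaluation
matrix, multiplied by `(a₀ c₁ - a₁ c₀)²`. -/
theorem quadraticForm_eq_zero {M : Type*} [AddCommGroup M] [Module ℝ M] {a₀ a₁ c₀ c₁ : ℝ}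
    (hD : a₀ * c₁ - a₁ * c₀ ≠ 0) {A B D : M}
    (ha : (a₀ * a₀) • A + (a₀ * a₁) • B + (a₁ * a₁) • D = 0)
    (hc : (c₀ * c₀) • A + (c₀ * c₁) • B + (c₁ * c₁) • D = 0)
    (h : ((a₀ + c₀) * (a₀ + c₀)) • A + ((a₀ + c₀) * (a₁ + c₁)) • B +
      ((a₁ + c₁) * (a₁ + c₁)) • D = 0) : A = 0 ∧ B = 0 ∧ D = 0 := by
  have key : ∀ r s t : ℝ, r • ((a₀ * a₀) • A + (a₀ * a₁) • B + (a₁ * a₁) • D) +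
      s • ((c₀ * c₀) • A + (c₀ * c₁) • B + (c₁ * c₁) • D) +
      t • (((a₀ + c₀) * (a₀ + c₀)) • A + ((a₀ + c₀) * (a₁ + c₁)) • B +
      ((a₁ + c₁) * (a₁ + c₁)) • D) = 0 := fun r s t => by
    rw [ha, hc, h, smul_zero, smul_zero, smul_zero, add_zero, add_zero]
  have hD2 : (a₀ * c₁ - a₁ * c₀) ^ 2 ≠ 0 := pow_ne_zero 2 hD
  refine ⟨?_, ?_, ?_⟩
  · refine (smul_eq_zero.1 ?_).resolve_left hD2
    rw [← key (c₁ * c₁ + c₁ * a₁) (a₁ * a₁ + c₁ * a₁) (-(c₁ * a₁))]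
    module
  · refine (smul_eq_zero.1 ?_).resolve_left hD2
    rw [← key (-2 * c₀ * c₁ - (c₁ * a₀ + a₁ * c₀)) (-2 * a₀ * a₁ - (c₁ * a₀ + a₁ * c₀))
      (c₁ * a₀ + a₁ * c₀)]
    module
  · refine (smul_eq_zero.1 ?_).resolve_left hD2
    rw [← key (c₀ * c₀ + c₀ * a₀) (a₀ * a₀ + c₀ * a₀) (-(c₀ * a₀))]
    module

/-- The strains along the three edges determine the symmetric gradient. Turning `w` by a right angle
converts the symmetric gradient into `sym curl`, so `w` is a turned Raviart–Thomas field, that is a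
rigid motion. It is orthogonal to the rigid motions, hence to itself. -/
theorem eq_zero_of_strain_eq_zero (hT : (T : Set E) = Set.range v) (hv : ori v ≠ 0)
    {w : Fin 2 → Poly} (hm : ∀ j, cellInt T (w j) = 0) (hr : rotMoment T w = 0)
    (h : ∀ i, strain v i w = 0) : w = 0 := by
  have hs : symCurlP ![w 1, -w 0] = 0 := by
    have h0 := h 0
    have h1 := h 1
    have h2 := h 2
    simp only [strain_apply, dirD_apply, Fin.sum_univ_two, edgeVec, smul_add, smul_smul, zero_add,
      show (2 : Fin 3) + 1 = 0 from rfl, show (1 : Fin 3) + 1 = 2 from rfl] at h0 h1 h2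
    have hD : (v 1 0 - v 0 0) * (v 0 1 - v 2 1) - (v 1 1 - v 0 1) * (v 0 0 - v 2 0) ≠ 0 := by
      intro h
      exact hv (by rw [ori, orient]; linarith)
    -- The remaining edge vector is minus the sum of the other two; the sign is invisible to a
    -- quadratic form.
    obtain ⟨hA, hB, hC⟩ := quadraticForm_eq_zero hD (A := pderiv 0 (w 0))
      (B := pderiv 1 (w 0) + pderiv 0 (w 1)) (D := pderiv 1 (w 1))
      (by rw [← h0]; module) (by rw [← h2]; module) (by rw [← h1]; module)
    refine matrix_ext_fin_two ?_ ?_ ?_ ?_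
    · simp [symCurlP_zero_zero, hC]
    · rw [symCurlP_zero_one]
      simp only [Matrix.cons_val_zero, Matrix.cons_val_one, map_neg, sub_neg_eq_add]
      rw [add_comm, hB, smul_zero, Matrix.zero_apply]
    · rw [symCurlP_one_zero]
      simp only [Matrix.cons_val_zero, Matrix.cons_val_one, map_neg, sub_neg_eq_add]
      rw [add_comm, hB, smul_zero, Matrix.zero_apply]
    · simp [symCurlP_one_one, hA]
  rw [symCurlP_eq_zero_iff] at hs
  obtain ⟨c, b, hc⟩ := hs
  have h0 : w 1 = C (c 0) + b • X 0 := hc 0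
  have h1 : -w 0 = C (c 1) + b • X 1 := hc 1
  rw [rotMoment_apply, map_sub, sub_eq_zero] at hr
  have hsum : cellInt T (w 1 * w 1) + cellInt T (w 0 * w 0) = 0 := by
    have e1 : w 1 * w 1 = c 0 • w 1 + b • (X 0 * w 1) := by
      nth_rewrite 1 [h0]
      rw [smul_eq_C_mul, smul_eq_C_mul, smul_eq_C_mul]
      ring
    have e2 : w 0 * w 0 = -(c 1 • w 0 + b • (X 1 * w 0)) := by
      have : w 0 * w 0 = -(-w 0 * w 0) := by ring
      rw [this, h1, smul_eq_C_mul, smul_eq_C_mul, smul_eq_C_mul]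
      ring
    rw [e1, e2]
    simp only [map_add, map_neg, map_smul, hm, hr]
    simp
  have hn : ∀ p : Poly, 0 ≤ cellInt T (p * p) := fun p => cellInt_nonneg hT fun x _ => by
    rw [ev_mul]
    exact mul_self_nonneg _
  have := hn (w 0)
  have := hn (w 1)
  funext j
  fin_cases j
  · exact eq_zero_of_cellInt_sq hT hv (by simp only [Fin.zero_eta]; linarith)
  · exact eq_zero_of_cellInt_sq hT hv (by simp only [Fin.mk_one]; linarith)

/-- Fields orthogonal to the rigid motions are divergences of symmetric matrix fields with
vanishing normal trace. -/
theorem exists_rowDivP_tangentTensor_eq (hT : (T : Set E) = Set.range v) (hv : ori v ≠ 0) {l : ℕ}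
    {w : Fin 2 → Poly} (hw : w ∈ PVec (l + 1)) (hm : ∀ j, cellInt T (w j) = 0)
    (hr : rotMoment T w = 0) :
    ∃ p : Fin 3 → Poly, (∀ i, p i ∈ P l) ∧
      rowDivP (tangentTensor v fun i => edgeBubble v i * p i) = w := by
  -- The divergence of `∑ bᵢ εᵢ(w) tᵢ tᵢᵀ`, where `εᵢ` is the strain along edge `i`: an elasticity
  -- operator degenerating at the boundary. Tested with `w` it gives `-∑ ∫ bᵢ εᵢ(w)²`.
  let f : (Fin 2 → Poly) →ₗ[ℝ] (Fin 2 → Poly) := LinearMap.pi fun j =>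
    ∑ i, edgeVec (v i) (v (i + 1)) j • ((dE v i : Poly →ₗ[ℝ] Poly) ∘ₗ
      LinearMap.mulLeft ℝ (edgeBubble v i) ∘ₗ strain v i)
  have hf : ∀ w j, f w j = ∑ i, edgeVec (v i) (v (i + 1)) j •
      dE v i (edgeBubble v i * strain v i w) := fun w j => by
    simp [f, LinearMap.sum_apply]
  let Z : Submodule ℝ (Fin 2 → Poly) := PVec (l + 1) ⊓
    (⨅ j, LinearMap.ker (cellInt T ∘ₗ LinearMap.proj j)) ⊓ LinearMap.ker (rotMoment T)
  have hZ : ∀ w, w ∈ Z ↔ (w ∈ PVec (l + 1) ∧ ∀ j, cellInt T (w j) = 0) ∧ rotMoment T w = 0 := by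
    intro w
    simp only [Z, Submodule.mem_inf, Submodule.mem_iInf, LinearMap.mem_ker, LinearMap.comp_apply,
      LinearMap.proj_apply]
  have : FiniteDimensional ℝ Z :=
    Submodule.finiteDimensional_of_le (inf_le_left.trans inf_le_left : Z ≤ PVec (l + 1))
  have hmaps : ∀ w ∈ Z, f w ∈ Z := by
    intro w hw
    obtain ⟨⟨hw, hm⟩, hr⟩ := (hZ w).1 hw
    refine (hZ _).2 ⟨⟨mem_PVec.2 fun j => ?_, fun j => ?_⟩, ?_⟩
    · rw [hf]
      refine Submodule.sum_mem _ fun i _ => (P _).smul_mem _ (dirD_mem _ ?_)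
      exact P_mono (by omega) (mul_mem_P (edgeBubble_mem v i) (strain_mem v i hw))
    · rw [hf, map_sum]
      refine Finset.sum_eq_zero fun i _ => ?_
      rw [map_smul, cellInt_dE_edgeBubble hT hv, smul_zero]
    · rw [rotMoment_apply, hf, hf, Finset.mul_sum, Finset.mul_sum, ← Finset.sum_sub_distrib, map_sum]
      refine Finset.sum_eq_zero fun i _ => ?_
      set t := edgeVec (v i) (v (i + 1)) with ht
      set r := edgeBubble v i * strain v i w with hr
      have e1 : X 0 * t 1 • dE v i r - X 1 * t 0 • dE v i r =
          (t 1 • X 0 - t 0 • X 1) * dE v i r := by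
        simp only [smul_eq_C_mul]
        ring
      -- A rotation has no strain: its component along `t` is constant in the direction `t`. Hence
      -- the rotational moment of the range vanishes after integration by parts.
      have e2 : dE v i (t 1 • X 0 - t 0 • X 1) = 0 := by
        rw [dirD_apply, ← ht]
        simp [pderiv_X_of_ne (show (1 : Fin 2) ≠ 0 by decide),
          pderiv_X_of_ne (show (0 : Fin 2) ≠ 1 by decide)]
        module
      rw [e1, hr, cellInt_mul_dE hT hv, e2, mul_zero, mul_zero, map_zero, neg_zero]
  have hinj : ∀ w ∈ Z, f w = 0 → w = 0 := by
    intro w hw h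
    obtain ⟨⟨hw, hm⟩, hr⟩ := (hZ w).1 hw
    refine eq_zero_of_strain_eq_zero hT hv hm hr
      (eq_zero_of_sum_cellInt_edgeBubble hT hv (p := fun i => strain v i w) ?_)
    have h1 : ∑ j, cellInt T (w j * f w j) = 0 := by simp [h]
    simp only [hf, Finset.mul_sum, map_sum, mul_smul_comm, map_smul, cellInt_mul_dE hT hv] at h1
    rw [Finset.sum_comm] at h1
    rw [← neg_eq_zero, ← h1, ← Finset.sum_neg_distrib]
    refine Finset.sum_congr rfl fun i _ => ?_
    nth_rewrite 2 [strain_apply]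
    rw [Finset.mul_sum, Finset.mul_sum, map_sum, ← Finset.sum_neg_distrib]
    refine Finset.sum_congr rfl fun j _ => ?_
    rw [mul_smul_comm, mul_smul_comm, map_smul, smul_neg]
  obtain ⟨u, hu, e⟩ := exists_eq_of_injOn Z f hmaps hinj ((hZ w).2 ⟨⟨hw, hm⟩, hr⟩)
  refine ⟨fun i => strain v i u, fun i => strain_mem v i ((hZ u).1 hu).1.1, ?_⟩
  funext j
  rw [rowDivP_tangentTensor, ← hf, e]

end bubbleSurjectivity

/-! ### The exact bubble complex -/

section bubbleComplex

open MvPolynomial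

variable {T : Finset E} {v : Fin 3 → E}

/-- The cubic bubble. -/
def cubicBubble (v : Fin 3 → E) : Poly := lam v 0 * lam v 1 * lam v 2

theorem cubicBubble_mem (v : Fin 3 → E) : cubicBubble v ∈ P 3 :=
  mul_mem_P (mul_mem_P (lam_mem v 0) (lam_mem v 1)) (lam_mem v 2)

theorem res_cubicBubble (v : Fin 3 → E) (i : Fin 3) :
    res (v i) (v (i + 1)) (cubicBubble v) = 0 := by
  have h : cubicBubble v = lam v i * lam v (i + 1) * lam v (i + 2) := by
    rw [cubicBubble]
    fin_cases i <;> simp <;> ring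
  rw [h, map_mul, res_lam_opp, mul_zero]

theorem cellInt_cubicBubble_ne_zero (hT : (T : Set E) = Set.range v) (hv : ori v ≠ 0) :
    cellInt T (cubicBubble v) ≠ 0 := by
  intro h
  refine mul_ne_zero (mul_ne_zero (lam_ne_zero hv 0) (lam_ne_zero hv 1)) (lam_ne_zero hv 2)
    (eq_zero_of_cellInt_eq_zero hT hv (fun x hx => ?_) h)
  have := (mem_convexHull_iff_lam hv x).1 hx
  rw [ev_mul, ev_mul]
  exact mul_nonneg (mul_nonneg (this 0) (this 1)) (this 2)

theorem cellInt_divP_mul_cubicBubble (hT : (T : Set E) = Set.range v) (hv : ori v ≠ 0)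
    (w : Fin 2 → Poly) : cellInt T (divP fun j => w j * cubicBubble v) = 0 :=
  cellInt_divP_eq_zero hT hv fun i => by
    rw [map_sub, map_smul, map_smul, map_mul, map_mul, res_cubicBubble]
    simp

/-- The curl of a polynomial. -/
def curlP (b : Poly) : Fin 2 → Poly := ![-pderiv 1 b, pderiv 0 b]

theorem divP_curlP (b : Poly) : divP (curlP b) = 0 := by
  rw [divP_apply]
  simp only [curlP, Matrix.cons_val_zero, Matrix.cons_val_one, map_neg]
  rw [pderiv_pderiv_comm 1 0]
  ring

theorem cellInt_curlP_cubicBubble (hT : (T : Set E) = Set.range v) (hv : ori v ≠ 0) (j : Fin 2) :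
    cellInt T (curlP (cubicBubble v) j) = 0 := by
  have h := fun j => cellInt_divP_mul_cubicBubble hT hv (Pi.single j 1)
  have h0 := h 0
  have h1 := h 1
  simp only [divP_apply, Pi.single_eq_same, one_mul, ne_eq, one_ne_zero, not_false_eq_true,
    Pi.single_eq_of_ne, zero_mul, map_zero, add_zero, zero_ne_one, zero_add] at h0 h1
  fin_cases j
  · simp [curlP, h1]
  · simp [curlP, h0]

/-- The moment of a curl against the rotation is the integral of `x · ∇b`, which is `-2 ∫ b` by
parts. As this is nonzero, the curl of the cubic bubble can correct a rotational moment while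
leaving the divergence, the means and the normal traces alone. -/
theorem rotMoment_curlP_cubicBubble (hT : (T : Set E) = Set.range v) (hv : ori v ≠ 0) :
    rotMoment T (curlP (cubicBubble v)) = -2 * cellInt T (cubicBubble v) := by
  have h := cellInt_divP_mul_cubicBubble hT hv X
  have e : divP (fun j => X j * cubicBubble v) =
      (2 : ℝ) • cubicBubble v +
        (X 0 * curlP (cubicBubble v) 1 - X 1 * curlP (cubicBubble v) 0) := by
    rw [divP_apply, Derivation.leibniz, Derivation.leibniz, pderiv_X_self, pderiv_X_self, curlP,
      two_smul]
    simp only [smul_eq_mul, Matrix.cons_val_zero, Matrix.cons_val_one]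
    ring
  rw [e, map_add, map_smul, ← rotMoment_apply, smul_eq_mul] at h
  linarith

/-- Polynomials orthogonal to `P 1` are divergences of fields with vanishing normal component that
are orthogonal to the rigid motions. -/
theorem exists_divP_eq (hT : (T : Set E) = Set.range v) (hv : ori v ≠ 0) {l : ℕ} {q : Poly}
    (hq : q ∈ P (l + 1)) (h0 : ∀ p ∈ P 1, cellInt T (q * p) = 0) :
    ∃ w ∈ PVec (l + 2), divP w = q ∧ (∀ j, cellInt T (w j) = 0) ∧ rotMoment T w = 0 ∧
      ∀ i, res (v i) (v (i + 1)) (unitNormal (v i) (v (i + 1)) 0 • w 0 +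
        unitNormal (v i) (v (i + 1)) 1 • w 1) = 0 := by
  obtain ⟨r, hr, e⟩ := exists_sum_dE_eq hT hv hq (by simpa using h0 1 (mem_P.2 (by simp)))
  set u : Fin 2 → Poly := fun j =>
    ∑ i, edgeVec (v i) (v (i + 1)) j • (edgeBubble v i * dE v i r) with hu
  -- Chosen so that `κ` times the moment `-2 ∫ b` of the curl cancels the moment of `u`.
  set κ : ℝ := rotMoment T u / (2 * cellInt T (cubicBubble v)) with hκ
  have hb := cellInt_cubicBubble_ne_zero hT hv
  have hudiv : divP u = q := by
    rw [divP_apply, ← e]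
    simp only [hu, map_sum, pderiv_smul, ← Finset.sum_add_distrib]
    rfl
  -- By parts, the mean of `u j` is minus the moment of `q` against the coordinate `xⱼ`. This is
  -- where orthogonality to all of `P₁`, and not only to constants, is needed.
  have hum : ∀ j, cellInt T (u j) = 0 := fun j => by
    have h1 := h0 (X j) (X_mem_P j)
    rw [← e, mul_comm, Finset.mul_sum, map_sum] at h1
    simp only [cellInt_mul_dE hT hv, Finset.sum_neg_distrib, neg_eq_zero] at h1
    rw [← h1]
    simp only [hu, map_sum]
    refine Finset.sum_congr rfl fun i _ => ?_
    have : dE v i (X j) = C (edgeVec (v i) (v (i + 1)) j) := by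
      rw [dirD_apply]
      fin_cases j <;> simp [smul_eq_C_mul]
    rw [this, smul_eq_C_mul]
    ring_nf
  refine ⟨u + κ • curlP (cubicBubble v), (PVec _).add_mem ?_ ((PVec _).smul_mem _ ?_), ?_, ?_, ?_,
    fun i => ?_⟩
  · refine mem_PVec.2 fun j => Submodule.sum_mem _ fun i _ => (P _).smul_mem _ ?_
    exact P_mono (by omega) (mul_mem_P (edgeBubble_mem v i) (dirD_mem _ hr))
  · have h2 := fun i => P_mono (show 2 ≤ l + 2 by omega) (pderiv_mem_P i (cubicBubble_mem v))
    refine mem_PVec.2 fun j => ?_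
    fin_cases j
    · exact (P _).neg_mem (h2 1)
    · exact h2 0
  · rw [map_add, map_smul, divP_curlP, smul_zero, add_zero, hudiv]
  · intro j
    rw [Pi.add_apply, Pi.smul_apply, map_add, map_smul, hum, cellInt_curlP_cubicBubble hT hv]
    simp
  · rw [map_add, map_smul, rotMoment_curlP_cubicBubble hT hv, hκ, smul_eq_mul]
    field_simp
    ring
  · have hne := vertices_ne hv (show i ≠ i + 1 by fin_cases i <;> decide)
    have h1 : res (v i) (v (i + 1)) (unitNormal (v i) (v (i + 1)) 0 • u 0 +
        unitNormal (v i) (v (i + 1)) 1 • u 1) = 0 := by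
      simp only [hu, Finset.smul_sum, ← Finset.sum_add_distrib, smul_smul, ← add_smul, map_sum,
        map_smul, map_mul]
      refine Finset.sum_eq_zero fun m _ => ?_
      by_cases hm : i = m
      · rw [hm, unitNormal_dot_edgeVec, zero_smul]
      · rw [res_edgeBubble_of_ne v hm, zero_mul, smul_zero]
    -- The normal component of a curl is minus a tangential derivative, and the cubic bubble is zero
    -- along the whole edge.
    have h2 : dist (v i) (v (i + 1)) • (unitNormal (v i) (v (i + 1)) 0 • curlP (cubicBubble v) 0 +
        unitNormal (v i) (v (i + 1)) 1 • curlP (cubicBubble v) 1) = -dE v i (cubicBubble v) := by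
      have hd := dist_ne_zero.2 hne
      rw [dirD_apply, smul_add, smul_smul, smul_smul]
      simp only [unitNormal, curlP, edgeVec, Matrix.cons_val_zero, Matrix.cons_val_one]
      rw [mul_div_cancel₀ _ hd, mul_div_cancel₀ _ hd]
      module
    have h3 : res (v i) (v (i + 1)) (unitNormal (v i) (v (i + 1)) 0 • curlP (cubicBubble v) 0 +
        unitNormal (v i) (v (i + 1)) 1 • curlP (cubicBubble v) 1) = 0 := by
      refine res_smul_eq_zero (dist_ne_zero.2 hne) ?_
      rw [h2, map_neg, ← derivative_res, res_cubicBubble]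
      simp
    have h4 : unitNormal (v i) (v (i + 1)) 0 • (u + κ • curlP (cubicBubble v)) 0 +
        unitNormal (v i) (v (i + 1)) 1 • (u + κ • curlP (cubicBubble v)) 1 =
        (unitNormal (v i) (v (i + 1)) 0 • u 0 + unitNormal (v i) (v (i + 1)) 1 • u 1) +
        κ • (unitNormal (v i) (v (i + 1)) 0 • curlP (cubicBubble v) 0 +
          unitNormal (v i) (v (i + 1)) 1 • curlP (cubicBubble v) 1) := by
      simp only [Pi.add_apply, Pi.smul_apply]
      module
    rw [h4, map_add, map_smul, h1, h3, smul_zero, add_zero]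

/-- Write `q = div w` and `w = div σ` with `σ = ∑ bᵢ pᵢ tᵢ tᵢᵀ`. On an edge, `tᵢ · n = 0` for its
own index and `bᵢ = 0` for the others, so `σn = 0`; moreover `div σ · n = w · n = 0` by the choice
of `w`. With `k = l + 3`, the `pᵢ` have degree `l + 1` and the bubbles supply the other two. -/
theorem exists_bubbleS_divDivP_eq {k : ℕ} (hk : 3 ≤ k) (hT : IsTriangle T) {q : Poly}
    (hq : q ∈ bubbleP k T) : ∃ σ ∈ bubbleS k T, divDivP σ = q := by
  obtain ⟨l, rfl⟩ : ∃ l, k = l + 3 := ⟨k - 3, by omega⟩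
  obtain ⟨v, hv, hv0⟩ := hT.exists_vertices
  obtain ⟨w, hw, hdiv, hm, hr, hn⟩ := exists_divP_eq hv hv0 hq.1 hq.2
  obtain ⟨p, hp, e⟩ := exists_rowDivP_tangentTensor_eq hv hv0 hw hm hr
  have hmem : tangentTensor v (fun i => edgeBubble v i * p i) ∈ PSym (l + 3) :=
    tangentTensor_mem fun i => P_mono (by omega) (mul_mem_P (edgeBubble_mem v i) (hp i))
  refine ⟨tangentTensor v fun i => edgeBubble v i * p i, ⟨hmem, ?_⟩, ?_⟩
  · refine SDofsAgree_zero_of_edges hk hv hmem (fun l i j => ?_) (fun l i => ?_) fun l => ?_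
    · rw [tangentTensor_apply, ev_sum]
      refine Finset.sum_eq_zero fun m _ => ?_
      rw [ev_smul, ev_mul, ev_edgeBubble, zero_mul, mul_zero]
    · rw [normalTrace_tangentTensor, map_sum]
      refine Finset.sum_eq_zero fun m _ => ?_
      by_cases hml : l = m
      · rw [hml, unitNormal_dot_edgeVec, mul_zero, zero_smul, map_zero]
      · rw [map_smul, map_mul, res_edgeBubble_of_ne v hml, zero_mul, smul_zero]
    · rw [divNormalTrace_apply, e]
      exact hn l
  · exact (congrArg divP e).trans hdiv

theorem isExactSeq_bubble {k : ℕ} (hk : 3 ≤ k) (hT : IsTriangle T) :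
    IsExactSeq ⊥ (bubbleV k T) (bubbleS k T) (bubbleP k T)
      (symCurlP.domRestrict (bubbleV k T)) (divDivP.domRestrict (bubbleS k T)) := by
  obtain ⟨v, hv, hv0⟩ := hT.exists_vertices
  have hmem : ∀ i, v i ∈ (T : Set E) := fun i => by rw [hv]; exact ⟨i, rfl⟩
  have h₁ : ∀ w ∈ bubbleV k T, symCurlP w ∈ bubbleS k T := fun w hw =>
    ⟨symCurlP_mem_PSym hw.1, by
      simpa using SDofsAgree_symCurlP hk hw.1 (PVec _).zero_mem hw.2⟩
  refine isExactSeq_of bot_le (fun w => h₁ w w.2) (fun σ => divDivP_mem_bubbleP hk hT σ.2)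
    (fun w => ?_) (fun w => divDivP_symCurlP _) (fun σ h => ?_) fun q hq => ?_
  · rw [Submodule.mem_bot, LinearMap.domRestrict_apply]
    constructor
    · intro h
      have hev := fun i => (w.2.2.1 (v i) (hmem i))
      simp only [Pi.zero_apply, ev_zero] at hev
      exact eq_zero_of_mem_RTPoly ((symCurlP_eq_zero_iff _).1 h)
        (vertices_ne hv0 (show (0 : Fin 3) ≠ 1 by decide)) (fun i => (hev 0 i).1)
        fun i => (hev 1 i).1
    · intro h
      rw [h, map_zero]
  · obtain ⟨l, rfl⟩ : ∃ l, k = l + 1 := ⟨k - 1, by omega⟩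
    obtain ⟨w, hw, e⟩ := exists_symCurlP_eq σ.2.1 h
    have hσ := σ.2.2
    rw [← e] at hσ
    -- The germs of the potential at all three vertices coincide, so subtracting a single
    -- Raviart–Thomas field makes it a bubble.
    have hg := VDofsAgree_of_germ hk hw hσ
      (fun a ha => germ_eq_of_SDofsAgree hk hw hσ ha (hmem 0)) (germ_mem _ _)
    refine ⟨⟨w - germ (v 0) w, (PVec _).sub_mem hw (RTPoly_le_PVec _ (germ_mem _ _)),
      VDofsAgree_sub_iff.2 hg⟩, ?_⟩
    rw [LinearMap.domRestrict_apply, map_sub, (symCurlP_eq_zero_iff _).2 (germ_mem _ _), sub_zero, e]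
  · obtain ⟨σ, hσ, e⟩ := exists_bubbleS_divDivP_eq hk hT hq
    exact ⟨⟨σ, hσ⟩, e⟩

end bubbleComplex

/-! ### Topology of Lipschitz domains and of punctured plane sets -/

section domain

variable {Ω : TopologicalSpace.Opens E}

theorem continuous_coord (Φ : E ≃ᵃⁱ[ℝ] E) (i : Fin 2) : Continuous fun y => Φ y i :=
  (EuclideanSpace.proj (𝕜 := ℝ) i).continuous.comp Φ.continuous

theorem notMem_closure_of_graph_lt {x : E} {U : Set E} (hU : U ∈ 𝓝 x) {Φ : E ≃ᵃⁱ[ℝ] E} {g : ℝ → ℝ}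
    (hg : Continuous g) (h : ∀ y ∈ U, y ∈ Ω ↔ Φ y 1 < g (Φ y 0)) (hx : g (Φ x 0) < Φ x 1) :
    x ∉ closure (Ω : Set E) := by
  have hV : {y | g (Φ y 0) < Φ y 1} ∈ 𝓝 x :=
    (isOpen_lt (hg.comp (continuous_coord Φ 0)) (continuous_coord Φ 1)).mem_nhds hx
  intro hc
  obtain ⟨y, ⟨hyU, hyV⟩, hy⟩ := mem_closure_iff_nhds.1 hc _ (Filter.inter_mem hU hV)
  exact lt_asymm ((h y hyU).1 hy) hyV

/-- A Lipschitz domain is the interior of its closure. -/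
theorem IsLipschitzDomain.interior_closure_subset (hΩ : IsLipschitzDomain Ω) :
    interior (closure (Ω : Set E)) ⊆ Ω := by
  intro x hx
  by_contra hxΩ
  have hfr : x ∈ frontier (Ω : Set E) := by
    rw [Ω.isOpen.frontier_eq]
    exact ⟨interior_subset hx, hxΩ⟩
  obtain ⟨U, hU, Φ, g, L, hg, h⟩ := hΩ.boundary x hfr
  have hx1 : g (Φ x 0) ≤ Φ x 1 := by
    by_contra! hlt
    exact hxΩ ((h x (mem_of_mem_nhds hU)).2 hlt)
  -- A frontier point lies on or above the graph. The points `y ε` lie strictly above it, hence off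
  -- the closure; yet they tend to `x`, which is interior to the closure.
  let y : ℝ → E := fun ε => Φ.symm (Φ x + ε • EuclideanSpace.single 1 1)
  have hy : Filter.Tendsto y (𝓝[>] 0) (𝓝 x) := by
    have hc : Continuous y := Φ.symm.continuous.comp (by fun_prop)
    have := hc.tendsto 0
    simp only [y, zero_smul, add_zero, AffineIsometryEquiv.symm_apply_apply] at this
    exact this.mono_left nhdsWithin_le_nhds
  have hmem := hy (Filter.inter_mem (interior_mem_nhds.2 hU) (isOpen_interior.mem_nhds hx))
  obtain ⟨ε, ⟨hε1, hε2⟩, hε⟩ := (Filter.inter_mem hmem self_mem_nhdsWithin : _ ∈ 𝓝[>] (0 : ℝ))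
    |> fun h => (Filter.nonempty_of_mem h)
  refine notMem_closure_of_graph_lt (mem_interior_iff_mem_nhds.1 hε1) hg.continuous h ?_
    (interior_subset hε2)
  have hε' : (0 : ℝ) < ε := hε
  simp only [y, AffineIsometryEquiv.apply_symm_apply, PiLp.add_apply, PiLp.smul_apply,
    PiLp.single_apply]
  simp
  linarith

theorem convex_box (Φ : E ≃ᵃⁱ[ℝ] E) {S₀ S₁ : Set ℝ} (h₀ : Convex ℝ S₀) (h₁ : Convex ℝ S₁) :
    Convex ℝ {y | Φ y 0 ∈ S₀ ∧ Φ y 1 ∈ S₁} := by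
  have h : Convex ℝ {z : E | z 0 ∈ S₀ ∧ z 1 ∈ S₁} :=
    (h₀.linear_preimage (EuclideanSpace.proj (𝕜 := ℝ) (0 : Fin 2)).toLinearMap).inter
      (h₁.linear_preimage (EuclideanSpace.proj (𝕜 := ℝ) (1 : Fin 2)).toLinearMap)
  exact h.affine_preimage Φ.toAffineEquiv.toAffineMap

/-- Small neighbourhoods of boundary points meet a Lipschitz domain in connected sets. -/
theorem IsLipschitzDomain.exists_preconnected_nhds (hΩ : IsLipschitzDomain Ω) {a : E}
    (ha : a ∈ closure (Ω : Set E)) {N : Set E} (hN : N ∈ 𝓝 a) :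
    ∃ W ∈ 𝓝 a, W ⊆ N ∧ IsPreconnected (W ∩ Ω) := by
  by_cases haΩ : a ∈ Ω
  · obtain ⟨ε, hε, hb⟩ := Metric.mem_nhds_iff.1 (Filter.inter_mem hN (Ω.isOpen.mem_nhds haΩ))
    refine ⟨Metric.ball a ε, Metric.ball_mem_nhds _ hε, fun x hx => (hb hx).1, ?_⟩
    rw [Set.inter_eq_left.2 fun x hx => (hb hx).2]
    exact (convex_ball a ε).isPreconnected
  have hfr : a ∈ frontier (Ω : Set E) := by
    rw [Ω.isOpen.frontier_eq]
    exact ⟨ha, haΩ⟩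
  obtain ⟨U, hU, Φ, g, L, hg, h⟩ := hΩ.boundary a hfr
  have hga : g (Φ a 0) = Φ a 1 := by
    refine le_antisymm ?_ ?_
    · by_contra! hlt
      exact haΩ ((h a (mem_of_mem_nhds hU)).2 hlt)
    · by_contra! hlt
      exact notMem_closure_of_graph_lt hU hg.continuous h hlt ha
  set s₀ := Φ a 0 with hs₀
  set t₀ := Φ a 1 with ht₀
  obtain ⟨η, hη, hb⟩ := Metric.mem_nhds_iff.1 (Filter.inter_mem hN hU)
  have hL : (0 : ℝ) ≤ L := L.2
  -- The box has half-width `δ` and half-height `(L + 2) δ`; since `(L + 3) δ = η / 2` it fits into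
  -- the ball of radius `η`. Over it the graph stays at height at least `t₀ - L δ`, hence above the
  -- level `t₁ = t₀ - (L + 1) δ`. The horizontal segment at that level therefore lies in `Ω`, and
  -- every point of `Ω` in the box is joined to it vertically.
  set δ := η / (2 * (L + 3)) with hδ
  have hδ0 : 0 < δ := by positivity
  have hW : ∀ y, Φ y 0 ∈ Set.Ioo (s₀ - δ) (s₀ + δ) →
      Φ y 1 ∈ Set.Ioo (t₀ - (L + 2) * δ) (t₀ + (L + 2) * δ) → y ∈ N ∩ U := by
    intro y h0 h1
    refine hb ?_
    rw [Metric.mem_ball, ← Φ.dist_map, EuclideanSpace.dist_eq, Fin.sum_univ_two,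
      Real.dist_eq, Real.dist_eq, ← hs₀, ← ht₀]
    have e0 : |Φ y 0 - s₀| < δ := abs_lt.2 ⟨by linarith [h0.1], by linarith [h0.2]⟩
    have e1 : |Φ y 1 - t₀| < (L + 2) * δ := abs_lt.2 ⟨by linarith [h1.1], by linarith [h1.2]⟩
    have e2 : (L + 3) * δ = η / 2 := by rw [hδ]; field_simp
    refine lt_of_le_of_lt (Real.sqrt_le_iff.2 ⟨by positivity, ?_⟩)
      (show |Φ y 0 - s₀| + |Φ y 1 - t₀| < η by nlinarith)
    nlinarith [abs_nonneg (Φ y 0 - s₀), abs_nonneg (Φ y 1 - t₀)]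
  set t₁ := t₀ - (L + 1) * δ with ht₁
  have hgs : ∀ s ∈ Set.Ioo (s₀ - δ) (s₀ + δ), t₁ < g s := by
    intro s hs
    have h1 := hg.dist_le_mul s s₀
    rw [Real.dist_eq, Real.dist_eq, hga] at h1
    have h2 : |s - s₀| < δ := abs_lt.2 ⟨by linarith [hs.1], by linarith [hs.2]⟩
    have h3 := (abs_le.1 h1).1
    nlinarith
  have ht₁' : t₁ ∈ Set.Ioo (t₀ - (L + 2) * δ) (t₀ + (L + 2) * δ) :=
    ⟨by nlinarith, by nlinarith⟩
  refine ⟨{y | Φ y 0 ∈ Set.Ioo (s₀ - δ) (s₀ + δ) ∧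
    Φ y 1 ∈ Set.Ioo (t₀ - (L + 2) * δ) (t₀ + (L + 2) * δ)}, ?_, fun y hy => (hW y hy.1 hy.2).1, ?_⟩
  · refine Filter.inter_mem
      ((isOpen_Ioo.preimage (continuous_coord Φ 0)).mem_nhds ⟨by linarith, by linarith⟩)
      ((isOpen_Ioo.preimage (continuous_coord Φ 1)).mem_nhds ⟨?_, ?_⟩) <;> nlinarith
  · refine isPreconnected_of_forall (Φ.symm !₂[s₀, t₁]) ?_
    rintro y ⟨⟨hy0, hy1⟩, hyΩ⟩
    have hyg := (h y (hW y hy0 hy1).2).1 hyΩ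
    have hA := (convex_box Φ (convex_Ioo (s₀ - δ) (s₀ + δ)) (convex_singleton t₁)).isPreconnected
    have hB := (convex_box Φ (convex_singleton (Φ y 0))
      ((convex_Ioo (t₀ - (L + 2) * δ) (t₀ + (L + 2) * δ)).inter
        (convex_Iio (g (Φ y 0))))).isPreconnected
    refine ⟨_, ?_, Or.inl ?_, Or.inr ?_, IsPreconnected.union (Φ.symm !₂[Φ y 0, t₁]) ?_ ?_ hA hB⟩
    · rintro z (⟨hz0, hz1⟩ | ⟨hz0, hz1, hz2⟩)
      · rw [Set.mem_singleton_iff] at hz1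
        have hz1' : Φ z 1 ∈ Set.Ioo (t₀ - (L + 2) * δ) (t₀ + (L + 2) * δ) := hz1 ▸ ht₁'
        exact ⟨⟨hz0, hz1'⟩, (h z (hW z hz0 hz1').2).2 (hz1 ▸ hgs _ hz0)⟩
      · rw [Set.mem_singleton_iff] at hz0
        have hz0' : Φ z 0 ∈ Set.Ioo (s₀ - δ) (s₀ + δ) := hz0 ▸ hy0
        exact ⟨⟨hz0', hz1⟩, (h z (hW z hz0' hz1).2).2 (hz0 ▸ hz2)⟩
    · constructor
      · simpa using hδ0
      · simp
    · exact ⟨rfl, hy1, hyg⟩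
    · exact ⟨by simpa using hy0, by simp⟩
    · exact ⟨by simp, by simpa using ht₁', by simpa using hgs _ hy0⟩

/-- The plane without the origin is connected, and a homeomorphism of the plane onto the ball sends
the origin to the centre. -/
theorem isPreconnected_ball_diff_singleton (x : E) (r : ℝ) :
    IsPreconnected (Metric.ball x r \ {x}) := by
  rcases le_or_gt r 0 with hr | hr
  · rw [Metric.ball_eq_empty.2 hr, Set.empty_sdiff]
    exact isPreconnected_empty
  have hrank : 1 < Module.rank ℝ E := by
    rw [← Module.finrank_eq_rank, finrank_euclideanSpace_fin]
    norm_num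
  have h1 := (isConnected_compl_singleton_of_one_lt_rank hrank (0 : E)).isPreconnected
  have h2 := h1.image (OpenPartialHomeomorph.univBall x r)
    ((OpenPartialHomeomorph.continuous_univBall x r).continuousOn)
  convert h2 using 1
  ext y
  have htgt := OpenPartialHomeomorph.univBall_target x hr
  have hsrc := OpenPartialHomeomorph.univBall_source x r
  constructor
  · rintro ⟨hy, hyx⟩
    rw [← htgt] at hy
    refine ⟨(OpenPartialHomeomorph.univBall x r).symm y, fun h0 => hyx ?_,
      (OpenPartialHomeomorph.univBall x r).right_inv hy⟩
    rw [Set.mem_singleton_iff] at h0 ⊢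
    rw [← (OpenPartialHomeomorph.univBall x r).right_inv hy, h0,
      OpenPartialHomeomorph.univBall_apply_zero]
  · rintro ⟨z, hz, rfl⟩
    have hz' : z ∈ (OpenPartialHomeomorph.univBall x r).source := hsrc ▸ Set.mem_univ z
    refine ⟨htgt ▸ (OpenPartialHomeomorph.univBall x r).map_source hz', fun h0 => hz ?_⟩
    rw [Set.mem_singleton_iff] at h0 ⊢
    refine (OpenPartialHomeomorph.univBall x r).injOn hz' (hsrc ▸ Set.mem_univ _) ?_
    rw [h0, OpenPartialHomeomorph.univBall_apply_zero]

/-- A small punctured ball around `x` is connected, so it lies on one side of any separation.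
Putting `x` on that side would separate `U`. -/
theorem isPreconnected_diff_singleton {U : Set E} (hU : IsOpen U) (hc : IsPreconnected U) (x : E) :
    IsPreconnected (U \ {x}) := by
  by_cases hx : x ∈ U
  swap
  · rwa [Set.sdiff_singleton_eq_self hx]
  obtain ⟨r, hr, hb⟩ := Metric.isOpen_iff.1 hU x hx
  have key : ∀ u v : Set E, IsOpen u → IsOpen v → U \ {x} ⊆ u ∪ v → (U \ {x} ∩ u).Nonempty →
      (U \ {x} ∩ v).Nonempty → Metric.ball x r \ {x} ⊆ u → (U \ {x} ∩ (u ∩ v)).Nonempty := by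
    intro u v hu hv huv hnu hnv hbu
    obtain ⟨y, hyU, hyv⟩ := hnv
    obtain ⟨z, hzU, hzu, hzv⟩ := hc (u ∪ Metric.ball x r) (v \ {x}) (hu.union Metric.isOpen_ball)
      (hv.sdiff isClosed_singleton) (fun z hz => by
        by_cases hzx : z = x
        · exact Or.inl (Or.inr (hzx ▸ Metric.mem_ball_self hr))
        · rcases huv ⟨hz, hzx⟩ with h | h
          · exact Or.inl (Or.inl h)
          · exact Or.inr ⟨h, hzx⟩)
      ⟨x, hx, Or.inr (Metric.mem_ball_self hr)⟩ ⟨y, hyU.1, hyv, hyU.2⟩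
    refine ⟨z, ⟨hzU, hzv.2⟩, ?_, hzv.1⟩
    rcases hzu with h | h
    · exact h
    · exact hbu ⟨h, hzv.2⟩
  intro u v hu hv huv hnu hnv
  have hsub : Metric.ball x r \ {x} ⊆ U \ {x} := Set.sdiff_subset_sdiff_left hb
  by_cases h1 : (Metric.ball x r \ {x} ∩ u).Nonempty
  · by_cases h2 : (Metric.ball x r \ {x} ∩ v).Nonempty
    · obtain ⟨z, hz, hz'⟩ := isPreconnected_ball_diff_singleton x r u v hu hv
        (hsub.trans huv) h1 h2
      exact ⟨z, hsub hz, hz'⟩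
    · refine key u v hu hv huv hnu hnv fun z hz => (huv (hsub hz)).resolve_right fun h => h2 ⟨z, hz, h⟩
  · rw [Set.inter_comm u v]
    exact key v u hv hu (Set.union_comm u v ▸ huv) hnv hnu fun z hz =>
      (huv (hsub hz)).resolve_left fun h => h1 ⟨z, hz, h⟩

theorem isPreconnected_diff_finite {U : Set E} (hU : IsOpen U) (hc : IsPreconnected U) {V : Set E}
    (hV : V.Finite) : IsPreconnected (U \ V) := by
  induction V, hV using Set.Finite.induction_on with
  | empty => rwa [Set.sdiff_empty]
  | @insert a s _ hs ih =>
    have : U \ insert a s = (U \ s) \ {a} := by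
      rw [Set.sdiff_sdiff, Set.union_singleton]
    rw [this]
    exact isPreconnected_diff_singleton (hU.sdiff hs.isClosed) ih a

end domain

/-! ### Triangles of the mesh and their adjacency -/

section mesh

theorem isCompact_cell (T : Finset E) : IsCompact (convexHull ℝ (T : Set E)) :=
  T.finite_toSet.isCompact_convexHull (𝕜 := ℝ)

theorem isClosed_cell (T : Finset E) : IsClosed (convexHull ℝ (T : Set E)) :=
  (isCompact_cell T).isClosed

theorem IsTriangle.interior_nonempty {T : Finset E} (hT : IsTriangle T) :
    (interior (convexHull ℝ (T : Set E))).Nonempty := by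
  obtain ⟨v, hTv, hv⟩ := hT.exists_vertices
  rw [hTv]
  exact DivDiv.interior_nonempty hv

theorem IsTriangle.cell_subset_closure {T : Finset E} (hT : IsTriangle T) :
    convexHull ℝ (T : Set E) ⊆ closure (interior (convexHull ℝ (T : Set E))) := by
  rw [(convex_convexHull ℝ _).closure_interior_eq_closure_of_nonempty_interior
    hT.interior_nonempty]
  exact subset_closure

/-- The convex hull of at most two points of the plane is a null set. -/
theorem volume_convexHull_eq_zero {S : Finset E} (hS : S.card ≤ 2) :
    volume (convexHull ℝ (S : Set E)) = 0 := by
  classical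
  refine measure_mono_null (convexHull_subset_affineSpan (S : Set E))
    (Measure.addHaar_affineSubspace _ _ fun htop => ?_)
  rcases S.eq_empty_or_nonempty with rfl | hne
  · simp at htop
  have h1 : Module.finrank ℝ (vectorSpan ℝ (S : Set E)) ≤ 1 := by
    have := finrank_vectorSpan_image_finset_le ℝ (id : E → E) S (n := S.card - 1)
      (by have := hne.card_pos; omega)
    rw [Finset.coe_image, Set.image_id] at this
    omega
  rw [← direction_affineSpan, htop, AffineSubspace.direction_top, finrank_top,
    finrank_euclideanSpace_fin] at h1
  omega

variable {Ω : TopologicalSpace.Opens E} (𝒯 : Triangulation Ω)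

namespace Triangulation

theorem finite_triangles : 𝒯.triangles.Finite := 𝒯.finite_faces.subset fun _ h => h.1

/-- The finite set of triangles. -/
def cells : Finset (Finset E) := 𝒯.finite_triangles.toFinset

variable {𝒯}

theorem mem_cells {T : Finset E} : T ∈ 𝒯.cells ↔ T ∈ 𝒯.triangles :=
  𝒯.finite_triangles.mem_toFinset

theorem isTriangle {T : Finset E} (hT : T ∈ 𝒯.triangles) : IsTriangle T :=
  ⟨hT.2, 𝒯.complex.indep hT.1⟩

theorem cell_subset_closure {T : Finset E} (hT : T ∈ 𝒯.triangles) :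
    convexHull ℝ (T : Set E) ⊆ closure (Ω : Set E) := by
  rw [← 𝒯.space_eq]
  exact 𝒯.complex.convexHull_subset_space hT.1

theorem interior_cell_subset (hΩ : IsLipschitzDomain Ω) {T : Finset E} (hT : T ∈ 𝒯.triangles) :
    interior (convexHull ℝ (T : Set E)) ⊆ Ω :=
  (interior_mono (cell_subset_closure hT)).trans hΩ.interior_closure_subset

theorem cell_inter_cell {T T' : Finset E} (hT : T ∈ 𝒯.triangles) (hT' : T' ∈ 𝒯.triangles) :
    convexHull ℝ (T : Set E) ∩ convexHull ℝ (T' : Set E) = convexHull ℝ ((T : Set E) ∩ T') :=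
  𝒯.complex.convexHull_inter_convexHull hT.1 hT'.1

variable (𝒯) in
theorem isClosed_biUnion_cells (s : Set (Finset E)) (hs : s ⊆ 𝒯.triangles) :
    IsClosed (⋃ T ∈ s, convexHull ℝ (T : Set E)) :=
  (𝒯.finite_triangles.subset hs).isClosed_biUnion fun T _ => isClosed_cell T

variable (𝒯) in
-- The complex is not assumed pure. But points of `Ω` outside all triangles form an open set covered
-- by faces with at most two vertices, hence an open null set, which is empty.
theorem subset_biUnion_cells : (Ω : Set E) ⊆ ⋃ T ∈ 𝒯.triangles, convexHull ℝ (T : Set E) := by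
  set C := ⋃ T ∈ 𝒯.triangles, convexHull ℝ (T : Set E) with hC
  have hopen : IsOpen ((Ω : Set E) \ C) :=
    Ω.isOpen.sdiff (𝒯.isClosed_biUnion_cells _ subset_rfl)
  have hnull : volume ((Ω : Set E) \ C) = 0 := by
    refine measure_mono_null (t := ⋃ S ∈ {S ∈ 𝒯.complex.faces | S.card ≤ 2},
      convexHull ℝ (S : Set E)) ?_ ?_
    · rintro x ⟨hx, hxC⟩
      have : x ∈ 𝒯.complex.space := 𝒯.space_eq ▸ subset_closure hx
      obtain ⟨S, hS, hxS⟩ := 𝒯.complex.mem_space_iff.1 this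
      refine Set.mem_biUnion (show S ∈ {S ∈ 𝒯.complex.faces | S.card ≤ 2} from ⟨hS, ?_⟩) hxS
      have h3 : S.card ≤ 3 := by
        have := (𝒯.complex.indep hS).card_le_finrank_succ
        have h4 := Submodule.finrank_le (vectorSpan ℝ (Set.range ((↑) : S → E)))
        rw [finrank_euclideanSpace_fin] at h4
        rw [Fintype.card_coe] at this
        omega
      by_contra h
      exact hxC (Set.mem_biUnion (show S ∈ 𝒯.triangles from ⟨hS, by omega⟩) hxS)
    · rw [measure_biUnion_null_iff (𝒯.finite_faces.subset fun _ h => h.1).countable]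
      exact fun S hS => volume_convexHull_eq_zero hS.2
  have h0 := (hopen.measure_eq_zero_iff volume).1 hnull
  exact Set.sdiff_eq_empty.1 h0

theorem card_inter_le_two [DecidableEq E] {T T' : Finset E} (hT : T ∈ 𝒯.triangles)
    (hT' : T' ∈ 𝒯.triangles) (hne : T ≠ T') : (T ∩ T').card ≤ 2 := by
  by_contra! h
  have h1 : T ∩ T' = T :=
    Finset.eq_of_subset_of_card_le Finset.inter_subset_left (by have := hT.2; omega)
  have h2 : T ∩ T' = T' :=
    Finset.eq_of_subset_of_card_le Finset.inter_subset_right (by have := hT'.2; omega)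
  exact hne (h1.symm.trans h2)

theorem volume_cell_inter_cell {T T' : Finset E} (hT : T ∈ 𝒯.triangles) (hT' : T' ∈ 𝒯.triangles)
    (hne : T ≠ T') : volume (convexHull ℝ (T : Set E) ∩ convexHull ℝ (T' : Set E)) = 0 := by
  classical
  rw [cell_inter_cell hT hT', ← Finset.coe_inter]
  exact volume_convexHull_eq_zero (card_inter_le_two hT hT' hne)

/-- A nonempty set of triangles closed under passing to neighbours across edges contains all
triangles. -/
theorem subset_of_edge_closed (hΩ : IsLipschitzDomain Ω) {s : Set (Finset E)}
    (hs : s ⊆ 𝒯.triangles) (hne : s.Nonempty)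
    (h : ∀ T ∈ s, ∀ T' ∈ 𝒯.triangles, ∀ a ∈ (T : Set E) ∩ T', ∀ b ∈ (T : Set E) ∩ T', a ≠ b →
      T' ∈ s) :
    𝒯.triangles ⊆ s := by
  set V : Set E := ⋃ T ∈ 𝒯.triangles, (T : Set E)
  have hV : V.Finite := 𝒯.finite_triangles.biUnion fun T _ => T.finite_toSet
  -- Without the finitely many vertices `Ω` is still connected. The triangles in `s` and those
  -- outside `s` give two closed sets covering it, so these must meet at a point that is no vertex.
  have hconn := isPreconnected_diff_finite Ω.isOpen hΩ.isConnected.isPreconnected hV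
  have hmeet : ∀ T ∈ 𝒯.triangles,
      (((Ω : Set E) \ V) ∩ convexHull ℝ (T : Set E)).Nonempty := by
    intro T hT
    have hinf : (interior (convexHull ℝ (T : Set E))).Infinite := fun hf => by
      have := (isOpen_interior.measure_eq_zero_iff volume).1 (hf.measure_zero volume)
      exact ((isTriangle hT).interior_nonempty).ne_empty this
    obtain ⟨x, hx, hxV⟩ := (hinf.sdiff hV).nonempty
    exact ⟨x, ⟨interior_cell_subset hΩ hT hx, hxV⟩, interior_subset hx⟩
  intro T' hT'
  by_contra hTs
  obtain ⟨T, hT⟩ := hne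
  rw [isPreconnected_closed_iff] at hconn
  have hx := hconn _ _ (𝒯.isClosed_biUnion_cells s hs)
    (𝒯.isClosed_biUnion_cells (𝒯.triangles \ s) Set.sdiff_subset) ?_ ?_ ?_
  · obtain ⟨x, ⟨hxΩ, hxV⟩, hx1, hx2⟩ := hx
    obtain ⟨T₁, hT₁, hx1⟩ := Set.mem_iUnion₂.1 hx1
    obtain ⟨T₂, hT₂, hx2⟩ := Set.mem_iUnion₂.1 hx2
    have hx : x ∈ convexHull ℝ ((T₁ : Set E) ∩ T₂) := by
      rw [← cell_inter_cell (hs hT₁) hT₂.1]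
      exact ⟨hx1, hx2⟩
    -- Two common vertices would put `T₂` into `s`. With at most one, the triangles can meet only at
    -- a vertex.
    have hsub : ((T₁ : Set E) ∩ T₂).Subsingleton := fun a ha b hb => by
      by_contra hab
      exact hT₂.2 (h T₁ hT₁ T₂ hT₂.1 a ha b hb hab)
    rw [(hsub.convex (𝕜 := ℝ)).convexHull_eq] at hx
    exact hxV (Set.mem_biUnion hT₂.1 hx.2)
  · intro x hx
    obtain ⟨T₁, hT₁, hx1⟩ := Set.mem_iUnion₂.1 (𝒯.subset_biUnion_cells hx.1)
    by_cases hs1 : T₁ ∈ s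
    · exact Or.inl (Set.mem_biUnion hs1 hx1)
    · exact Or.inr (Set.mem_biUnion ⟨hT₁, hs1⟩ hx1)
  · obtain ⟨x, hx, hx'⟩ := hmeet T (hs hT)
    exact ⟨x, hx, Set.mem_biUnion hT hx'⟩
  · obtain ⟨x, hx, hx'⟩ := hmeet T' hT'
    exact ⟨x, hx, Set.mem_biUnion (⟨hT', hTs⟩ : T' ∈ 𝒯.triangles \ s) hx'⟩

end Triangulation

end mesh
-- Piecewise polynomials in `L²` and their weak derivatives
section glue

open MvPolynomial

variable {Ω : TopologicalSpace.Opens E} {𝒯 : Triangulation Ω}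

theorem memLp_indicator_ev (T : Finset E) (p : Poly) :
    MemLp ((convexHull ℝ (T : Set E)).indicator fun x => ev x p) 2
      ((volume : Measure E).restrict Ω) := by
  obtain ⟨C, hC⟩ := (isCompact_cell T).exists_bound_of_continuousOn (continuous_ev p).continuousOn
  have hfin : IsFiniteMeasure ((volume : Measure E).restrict (convexHull ℝ (T : Set E))) :=
    ⟨by rw [Measure.restrict_apply_univ]; exact (isCompact_cell T).measure_lt_top⟩
  refine ((memLp_indicator_iff_restrict (isClosed_cell T).measurableSet).2 ?_).restrict _
  refine MemLp.of_bound (continuous_ev p).aestronglyMeasurable C ?_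
  rw [ae_restrict_iff' (isClosed_cell T).measurableSet]
  exact Filter.Eventually.of_forall hC

theorem ae_notMem_cell {T : Finset E} (hT : T ∈ 𝒯.triangles) :
    ∀ᵐ x ∂(volume : Measure E), x ∈ convexHull ℝ (T : Set E) →
      ∀ T' ∈ 𝒯.triangles, T' ≠ T → x ∉ convexHull ℝ (T' : Set E) := by
  have : ∀ T' ∈ 𝒯.triangles, ∀ᵐ x ∂(volume : Measure E), T' ≠ T →
      x ∉ convexHull ℝ (T : Set E) ∩ convexHull ℝ (T' : Set E) := by
    intro T' hT'
    by_cases h : T' = T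
    · exact Filter.Eventually.of_forall fun x h' => absurd h h'
    · filter_upwards [measure_eq_zero_iff_ae_notMem.1
        (Triangulation.volume_cell_inter_cell hT hT' (Ne.symm h))] with x hx _ using hx
  filter_upwards [(ae_ball_iff 𝒯.finite_triangles.countable).2 this] with x hx hxT T' hT' hne hxT'
  exact hx T' hT' hne ⟨hxT, hxT'⟩

theorem exists_glue (𝒯 : Triangulation Ω) (p : Finset E → Poly) :
    ∃ u : L2 Ω, ∀ T ∈ 𝒯.triangles, EqOn T u (p T) := by
  have hm : MemLp (fun x => ∑ T ∈ 𝒯.cells, (convexHull ℝ (T : Set E)).indicator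
      (fun x => ev x (p T)) x) 2 ((volume : Measure E).restrict Ω) :=
    memLp_finsetSum _ fun T _ => memLp_indicator_ev T (p T)
  refine ⟨hm.toLp _, fun T hT => ?_⟩
  filter_upwards [hm.coeFn_toLp, ae_restrict_of_ae (ae_notMem_cell hT)] with x hx hx' hxT
  rw [hx, Finset.sum_eq_single T, Set.indicator_of_mem hxT]
  · intro T' hT' hne
    exact Set.indicator_of_notMem (hx' hxT T' (Triangulation.mem_cells.1 hT') hne) _
  · exact fun h => absurd (Triangulation.mem_cells.2 hT) h

theorem ae_of_forall_cell {r : E → Prop}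
    (h : ∀ T ∈ 𝒯.triangles, ∀ᵐ x ∂((volume : Measure E).restrict Ω),
      x ∈ convexHull ℝ (T : Set E) → r x) :
    ∀ᵐ x ∂((volume : Measure E).restrict Ω), r x := by
  filter_upwards [(ae_ball_iff 𝒯.finite_triangles.countable).2 h,
    ae_restrict_mem Ω.isOpen.measurableSet] with x hx hxΩ
  obtain ⟨T, hT, hxT⟩ := Set.mem_iUnion₂.1 (𝒯.subset_biUnion_cells hxΩ)
  exact hx T hT hxT

theorem eq_of_forall_eqOn {u w : L2 Ω} {p : Finset E → Poly}
    (hu : ∀ T ∈ 𝒯.triangles, EqOn T u (p T)) (hw : ∀ T ∈ 𝒯.triangles, EqOn T w (p T)) : u = w := by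
  refine Lp.ext (ae_of_forall_cell (𝒯 := 𝒯) fun T hT => ?_)
  filter_upwards [hu T hT, hw T hT] with x h1 h2 hx
  rw [h1 hx, h2 hx]

theorem eqOn_of_ae {u : L2 Ω} {p : Poly}
    (h : ∀ᵐ x ∂((volume : Measure E).restrict Ω), u x = ev x p) (T : Finset E) : EqOn T u p := by
  filter_upwards [h] with x hx _ using hx

theorem EqOn.sub {T : Finset E} {u w : L2 Ω} {p q : Poly} (h : EqOn T u p) (h' : EqOn T w q) :
    EqOn T (u - w) (p - q) := by
  have := h.add (h'.smul (-1))
  rwa [neg_smul, one_smul, neg_smul, one_smul, ← sub_eq_add_neg, ← sub_eq_add_neg] at this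

theorem EqOn.neg {T : Finset E} {u : L2 Ω} {p : Poly} (h : EqOn T u p) : EqOn T (-u) (-p) := by
  have := h.smul (-1)
  rwa [neg_smul, one_smul, neg_smul, one_smul] at this

/-- The interior of the triangle lies in `Ω`; continuity upgrades equality almost everywhere to
equality on this open set, which determines a polynomial. -/
theorem EqOn.unique (hΩ : IsLipschitzDomain Ω) {T : Finset E} (hT : T ∈ 𝒯.triangles) {u : L2 Ω}
    {p q : Poly} (hp : EqOn T u p) (hq : EqOn T u q) : p = q := by
  have hsub := Triangulation.interior_cell_subset hΩ hT
  have hae : (fun x => ev x p) =ᵐ[volume.restrict (interior (convexHull ℝ (T : Set E)))]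
      fun x => ev x q := by
    filter_upwards [ae_restrict_of_ae_restrict_of_subset hsub hp,
      ae_restrict_of_ae_restrict_of_subset hsub hq,
      ae_restrict_mem isOpen_interior.measurableSet] with x h1 h2 hx
    rw [← h1 (interior_subset hx), ← h2 (interior_subset hx)]
  have h := Measure.eqOn_open_of_ae_eq hae isOpen_interior (continuous_ev p).continuousOn
    (continuous_ev q).continuousOn
  rw [← sub_eq_zero]
  refine eq_zero_of_ev_eq_zero isOpen_interior (Triangulation.isTriangle hT).interior_nonempty
    fun x hx => ?_
  rw [ev_sub, sub_eq_zero]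
  exact h hx

/-- The integral over `Ω` is the sum of the integrals over the triangles. -/
theorem setIntegral_eq_sum_cells (hΩ : IsLipschitzDomain Ω) (𝒯 : Triangulation Ω) {f : E → ℝ}
    (hf : Integrable f ((volume : Measure E).restrict Ω)) :
    ∫ x in Ω, f x = ∑ T ∈ 𝒯.cells, ∫ x in convexHull ℝ (T : Set E), f x := by
  have hU : (Ω : Set E) =ᵐ[volume] ⋃ T : 𝒯.cells, convexHull ℝ ((T : Finset E) : Set E) := by
    have hnull : ∀ᵐ x ∂(volume : Measure E), ∀ T ∈ 𝒯.triangles,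
        x ∉ frontier (convexHull ℝ (T : Set E)) :=
      (ae_ball_iff 𝒯.finite_triangles.countable).2 fun T _ =>
        measure_eq_zero_iff_ae_notMem.1 ((convex_convexHull ℝ (T : Set E)).addHaar_frontier volume)
    filter_upwards [hnull] with x hx
    refine propext ⟨fun h => ?_, fun h => ?_⟩
    · obtain ⟨T, hT, hxT⟩ := Set.mem_iUnion₂.1 (𝒯.subset_biUnion_cells h)
      exact Set.mem_iUnion.2 ⟨⟨T, Triangulation.mem_cells.2 hT⟩, hxT⟩
    · obtain ⟨T, hxT⟩ := Set.mem_iUnion.1 h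
      have hT := Triangulation.mem_cells.1 T.2
      refine Triangulation.interior_cell_subset hΩ hT ?_
      by_contra hi
      exact hx T hT ⟨subset_closure hxT, hi⟩
  rw [setIntegral_congr_set hU, integral_iUnion_ae, tsum_fintype,
    Finset.sum_coe_sort 𝒯.cells fun T => ∫ x in convexHull ℝ (T : Set E), f x]
  · exact fun T => (isClosed_cell T).measurableSet.nullMeasurableSet
  · intro T T' hne
    exact Triangulation.volume_cell_inter_cell (Triangulation.mem_cells.1 T.2)
      (Triangulation.mem_cells.1 T'.2) fun h => hne (Subtype.ext h)
  · rw [IntegrableOn, ← Measure.restrict_congr_set hU]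
    exact hf

theorem pairing_eq_sum (hΩ : IsLipschitzDomain Ω) {u : L2 Ω} {p : Finset E → Poly}
    (hu : ∀ T ∈ 𝒯.triangles, EqOn T u (p T)) {f : E → ℝ} (hf : Continuous f)
    (hs : HasCompactSupport f) :
    pairing u f = ∑ T ∈ 𝒯.cells, ∫ x in convexHull ℝ (T : Set E), ev x (p T) * f x := by
  rw [pairing, setIntegral_eq_sum_cells hΩ 𝒯 (integrable_pairing u hf hs)]
  refine Finset.sum_congr rfl fun T hT => ?_
  rw [Triangulation.mem_cells] at hT
  rw [setIntegral_congr_set (interior_ae_eq_of_null_frontier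
      ((convex_convexHull ℝ (T : Set E)).addHaar_frontier volume)).symm,
    setIntegral_congr_set (interior_ae_eq_of_null_frontier
      ((convex_convexHull ℝ (T : Set E)).addHaar_frontier volume)).symm]
  refine integral_congr_ae ?_
  filter_upwards [ae_restrict_of_ae_restrict_of_subset
    (Triangulation.interior_cell_subset hΩ hT) (hu T hT),
    ae_restrict_mem isOpen_interior.measurableSet] with x hx hxT
  rw [hx (interior_subset hxT)]

theorem pairing_eq_integral_of_ae {u : L2 Ω} {U : Set E} {p : Poly}
    (hu : ∀ᵐ x ∂((volume : Measure E).restrict Ω), x ∈ U → u x = ev x p)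
    {f : E → ℝ} (hf : tsupport f ⊆ U) (hU : U ⊆ Ω) : pairing u f = ∫ x, ev x p * f x := by
  have h0 : ∀ x, x ∉ (Ω : Set E) → ev x p * f x = 0 := fun x hx => by
    rw [image_eq_zero_of_notMem_tsupport fun h' => hx (hU (hf h')), mul_zero]
  rw [pairing, ← setIntegral_eq_integral_of_forall_compl_eq_zero h0]
  refine integral_congr_ae ?_
  filter_upwards [hu] with x hx
  by_cases h : x ∈ U
  · rw [hx h]
  · rw [image_eq_zero_of_notMem_tsupport fun h' => h (hf h'), mul_zero, mul_zero]

theorem integral_ev_mul_pd (p : Poly) {f : E → ℝ} (hf : ContDiff ℝ 1 f) (hs : HasCompactSupport f)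
    (i : Fin 2) : ∫ x, ev x p * pd i f x = -∫ x, ev x (pderiv i p) * f x := by
  have hd : Continuous (pd i f) := continuous_pd hf i
  have h := integral_mul_fderiv_eq_neg_fderiv_mul_of_integrable (μ := (volume : Measure E))
    (f := fun x => ev x p) (g := f) (v := EuclideanSpace.single i 1) ?_ ?_ ?_
    (fun x _ => (contDiff_ev p (n := 1)).differentiable one_ne_zero x)
    (fun x _ => hf.differentiable one_ne_zero x)
  · have e := pd_ev i p
    simp only [funext_iff, pd] at e ⊢
    simp only [h, e]
  · have e := pd_ev i p
    simp only [funext_iff, pd] at e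
    simp only [e]
    exact ((continuous_ev _).mul hf.continuous).integrable_of_hasCompactSupport hs.mul_left
  · exact ((continuous_ev _).mul hd).integrable_of_hasCompactSupport
      (hs.fderiv_apply (𝕜 := ℝ) (EuclideanSpace.single i 1)).mul_left
  · exact ((continuous_ev _).mul hf.continuous).integrable_of_hasCompactSupport hs.mul_left

theorem tsupport_pd_subset (i : Fin 2) (f : E → ℝ) : tsupport (pd i f) ⊆ tsupport f :=
  tsupport_fderiv_apply_subset ℝ _

/-- The fundamental lemma of the calculus of variations on the interior of the triangle, whose
frontier is null. It makes weak operators on piecewise polynomials computable triangle by triangle.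
-/
theorem EqOn.of_pairing (hΩ : IsLipschitzDomain Ω) {T : Finset E} (hT : T ∈ 𝒯.triangles)
    {w : L2 Ω} {q : Poly}
    (h : ∀ φ : 𝓓(Ω, ℝ), tsupport φ ⊆ interior (convexHull ℝ (T : Set E)) →
      pairing w φ = ∫ x, ev x q * φ x) : EqOn T w q := by
  have hsub := Triangulation.interior_cell_subset hΩ hT
  have key : ∀ᵐ x ∂(volume : Measure E), x ∈ interior (convexHull ℝ (T : Set E)) →
      w x - ev x q = 0 := by
    refine isOpen_interior.ae_eq_zero_of_integral_contDiff_smul_eq_zero ?_ ?_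
    · have h1 : LocallyIntegrable (fun x => w x - ev x q) ((volume : Measure E).restrict Ω) :=
        ((Lp.memLp w).locallyIntegrable (by norm_num)).sub (continuous_ev q).locallyIntegrable
      exact (locallyIntegrableOn_of_locallyIntegrable_restrict h1).mono_set hsub
    · intro g hg hc hs
      have h1 := h ⟨g, hg, hc, hs.trans hsub⟩ hs
      have e : ∀ x, g x • (w x - ev x q) = w x * g x - ev x q * g x := fun x => by
        rw [smul_eq_mul]; ring
      have h0 : ∀ x, x ∉ Ω → g x = 0 := fun x hx =>
        image_eq_zero_of_notMem_tsupport fun h' => hx (hsub (hs h'))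
      have i1 : Integrable (fun x => ev x q * g x) (volume : Measure E) :=
        ((continuous_ev _).mul hg.continuous).integrable_of_hasCompactSupport hc.mul_left
      rw [← setIntegral_eq_integral_of_forall_compl_eq_zero (s := (Ω : Set E))]
      · simp only [e]
        rw [integral_sub (integrable_pairing w hg.continuous hc) i1.restrict, sub_eq_zero,
          setIntegral_eq_integral_of_forall_compl_eq_zero
            (f := fun x => ev x q * g x) fun x hx => by rw [h0 x hx, mul_zero]]
        exact h1
      · intro x hx
        rw [h0 x hx, zero_smul]
  have hfr := measure_eq_zero_iff_ae_notMem.1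
    ((convex_convexHull ℝ (T : Set E)).addHaar_frontier volume)
  refine ae_restrict_of_ae ?_
  filter_upwards [key, hfr] with x hx hx' hxT
  refine sub_eq_zero.1 (hx ?_)
  by_contra hi
  exact hx' ⟨subset_closure hxT, hi⟩

/-- A weak derivative of a piecewise polynomial is the piecewise derivative. -/
theorem EqOn.of_hasWeakDeriv (hΩ : IsLipschitzDomain Ω) {T : Finset E} (hT : T ∈ 𝒯.triangles)
    {u w : L2 Ω} {p : Poly} {i : Fin 2} (hu : EqOn T u p) (h : HasWeakDeriv i u w) :
    EqOn T w (pderiv i p) := by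
  refine EqOn.of_pairing hΩ hT fun φ hφ => ?_
  have hsub := Triangulation.interior_cell_subset hΩ hT
  have h1 := h φ
  rw [pairing_eq_integral_of_ae (hu.mono fun x hx hxT => hx (interior_subset hxT))
    ((tsupport_pd_subset i φ).trans hφ) hsub,
    integral_ev_mul_pd p (φ.contDiff.of_le (by simp)) φ.hasCompactSupport] at h1
  linarith

theorem integral_divDivP_mul (σ : Matrix (Fin 2) (Fin 2) Poly) {φ : E → ℝ} (hφ : ContDiff ℝ 2 φ)
    (hs : HasCompactSupport φ) :
    ∑ i, ∑ j, ∫ x, ev x (σ i j) * pd i (pd j φ) x = ∫ x, ev x (divDivP σ) * φ x := by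
  have h2 : ∀ i j, ∫ x, ev x (σ i j) * pd i (pd j φ) x =
      ∫ x, ev x (pderiv j (pderiv i (σ i j))) * φ x := by
    intro i j
    rw [integral_ev_mul_pd _ (contDiff_pd_one hφ j) (hasCompactSupport_pd hs),
      integral_ev_mul_pd _ (hφ.of_le (by norm_num)) hs, neg_neg]
  have hi : ∀ q : Poly, Integrable (fun x => ev x q * φ x) (volume : Measure E) := fun q =>
    ((continuous_ev _).mul hφ.continuous).integrable_of_hasCompactSupport hs.mul_left
  have hadd : ∀ q q' : Poly, ∫ x, ev x (q + q') * φ x =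
      (∫ x, ev x q * φ x) + ∫ x, ev x q' * φ x := fun q q' => by
    rw [← integral_add (hi q) (hi q')]
    simp only [ev_add, add_mul]
  rw [divDivP_apply, hadd, map_add, map_add, hadd, hadd]
  simp only [h2, Fin.sum_univ_two]
  rw [pderiv_pderiv_comm 1 0 (σ 0 1), pderiv_pderiv_comm 0 1 (σ 1 0)]

/-- The weak `div div` of a piecewise polynomial is the piecewise `div div`. -/
theorem EqOn.of_hasWeakDivDiv (hΩ : IsLipschitzDomain Ω) {T : Finset E} (hT : T ∈ 𝒯.triangles)
    {τ : Matrix (Fin 2) (Fin 2) (L2 Ω)} {f : L2 Ω} {σ : Matrix (Fin 2) (Fin 2) Poly}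
    (hτ : ∀ i j, EqOn T (τ i j) (σ i j)) (h : HasWeakDivDiv τ f) :
    EqOn T f (divDivP σ) := by
  refine EqOn.of_pairing hΩ hT fun φ hφ => ?_
  have hsub := Triangulation.interior_cell_subset hΩ hT
  rw [← h φ, ← integral_divDivP_mul σ (contDiff_infty.1 φ.contDiff 2) φ.hasCompactSupport]
  refine Finset.sum_congr rfl fun i _ => Finset.sum_congr rfl fun j _ => ?_
  exact pairing_eq_integral_of_ae ((hτ i j).mono fun x hx hxT => hx (interior_subset hxT))
    ((tsupport_pd_subset i _).trans ((tsupport_pd_subset j φ).trans hφ)) hsub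

theorem hasWeakDeriv_of_ae {u w : L2 Ω} {p : Poly} {i : Fin 2}
    (hu : ∀ᵐ x ∂((volume : Measure E).restrict Ω), u x = ev x p)
    (hw : ∀ᵐ x ∂((volume : Measure E).restrict Ω), w x = ev x (pderiv i p)) :
    HasWeakDeriv i u w := fun φ => by
  rw [pairing_eq_integral_of_ae (U := Ω) (hu.mono fun x hx _ => hx)
      ((tsupport_pd_subset i φ).trans φ.tsupport_subset) subset_rfl,
    pairing_eq_integral_of_ae (U := Ω) (hw.mono fun x hx _ => hx) φ.tsupport_subset subset_rfl,
    integral_ev_mul_pd p (contDiff_infty.1 φ.contDiff 1) φ.hasCompactSupport]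

theorem ae_of_forall_eqOn {u : L2 Ω} {p : Poly} (h : ∀ T ∈ 𝒯.triangles, EqOn T u p) :
    ∀ᵐ x ∂((volume : Measure E).restrict Ω), u x = ev x p :=
  ae_of_forall_cell h

end glue
-- The finite element complex and its kernel at `V_h`
section complex

open MvPolynomial

variable {Ω : TopologicalSpace.Opens E} {𝒯 : Triangulation Ω}

theorem symRot_zero_zero {M : Type*} [AddCommGroup M] [Module ℝ M] (G : Matrix (Fin 2) (Fin 2) M) :
    symRot M G 0 0 = -G 0 1 := by
  simp [symRot]
  module

theorem symRot_one_one {M : Type*} [AddCommGroup M] [Module ℝ M] (G : Matrix (Fin 2) (Fin 2) M) :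
    symRot M G 1 1 = G 1 0 := by
  simp [symRot]
  module

theorem symRot_zero_one {M : Type*} [AddCommGroup M] [Module ℝ M] (G : Matrix (Fin 2) (Fin 2) M) :
    symRot M G 0 1 = (1 / 2 : ℝ) • (G 0 0 - G 1 1) := by
  simp [symRot]
  module

theorem symRot_one_zero {M : Type*} [AddCommGroup M] [Module ℝ M] (G : Matrix (Fin 2) (Fin 2) M) :
    symRot M G 1 0 = (1 / 2 : ℝ) • (G 0 0 - G 1 1) := by
  simp [symRot]
  module

theorem hasWeakDeriv_weakGrad (v : H1Vec Ω) (i j : Fin 2) :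
    HasWeakDeriv j (v.1 i) (weakGrad Ω v i j) := (v.2 i j).choose_spec

theorem hasWeakDivDiv_divDiv (τ : HDivDiv Ω) : HasWeakDivDiv τ.1 (divDiv Ω τ) :=
  τ.2.2.choose_spec

theorem pd_pd_comm {φ : E → ℝ} (hφ : ContDiff ℝ ∞ φ) (i j : Fin 2) :
    pd i (pd j φ) = pd j (pd i φ) := by
  have hd : Differentiable ℝ (fderiv ℝ φ) :=
    (hφ.fderiv_right (m := ∞) (by simp)).differentiable (by simp)
  have h : ∀ (i j : Fin 2) (x : E), pd i (pd j φ) x =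
      fderiv ℝ (fderiv ℝ φ) x (EuclideanSpace.single i 1) (EuclideanSpace.single j 1) := by
    intro i j x
    unfold pd
    rw [fderiv_clm_apply (hd x) (differentiableAt_const _)]
    simp
  funext x
  rw [h, h]
  exact ((contDiff_infty.1 hφ 2).contDiffAt.isSymmSndFDerivAt (by simp)) _ _

theorem HasWeakDeriv.pairing_pd {u w : L2 Ω} {i : Fin 2} (h : HasWeakDeriv i u w) {f : E → ℝ}
    (hf : ContDiff ℝ ∞ f) (hs : HasCompactSupport f) (hsub : tsupport f ⊆ Ω) :
    pairing u (pd i f) = -pairing w f :=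
  h ⟨f, hf, hs, hsub⟩

theorem pairing_neg (u : L2 Ω) (f : E → ℝ) : pairing (-u) f = -pairing u f := by
  have := pairing_smul (-1) u f
  rwa [neg_smul, one_smul, neg_one_mul] at this

theorem pairing_sub {u w : L2 Ω} {f : E → ℝ} (hf : Continuous f) (hs : HasCompactSupport f) :
    pairing (u - w) f = pairing u f - pairing w f := by
  rw [sub_eq_add_neg, pairing_add u (-w) hf hs, pairing_neg, ← sub_eq_add_neg]

/-- `div div sym curl = 0` in the weak sense. -/
theorem hasWeakDivDiv_symCurl (v : H1Vec Ω) : HasWeakDivDiv (symCurl Ω v) 0 := fun φ => by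
  have hc : ∀ i j : Fin 2, ContDiff ℝ ∞ (pd i (pd j φ)) := fun i j =>
    contDiff_pd (contDiff_pd φ.contDiff)
  have hs : ∀ i j : Fin 2, HasCompactSupport (pd i (pd j φ)) := fun i j =>
    hasCompactSupport_pd (hasCompactSupport_pd φ.hasCompactSupport)
  -- Moving the weak derivative to the smooth test function reduces the claim to commuting third
  -- derivatives.
  have hw : ∀ i j a b : Fin 2, pairing (weakGrad Ω v i j) (pd a (pd b φ)) =
      -pairing (v.1 i) (pd j (pd a (pd b φ))) := fun i j a b => by
    rw [(hasWeakDeriv_weakGrad v i j).pairing_pd (hc a b) (hs a b)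
      ((tsupport_pd_subset a _).trans ((tsupport_pd_subset b φ).trans φ.tsupport_subset)), neg_neg]
  have e1 : pd 1 (pd 0 φ) = pd 0 (pd 1 φ) := pd_pd_comm φ.contDiff 1 0
  have e2 : ∀ a, pd 1 (pd 0 (pd a φ)) = pd 0 (pd 1 (pd a φ)) := fun a =>
    pd_pd_comm (contDiff_pd φ.contDiff) 1 0
  have h00 : symCurl Ω v 0 0 = -weakGrad Ω v 0 1 := symRot_zero_zero _
  have h11 : symCurl Ω v 1 1 = weakGrad Ω v 1 0 := symRot_one_one _
  have h01 : symCurl Ω v 0 1 = (1 / 2 : ℝ) • (weakGrad Ω v 0 0 - weakGrad Ω v 1 1) :=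
    symRot_zero_one _
  have h10 : symCurl Ω v 1 0 = (1 / 2 : ℝ) • (weakGrad Ω v 0 0 - weakGrad Ω v 1 1) :=
    symRot_one_zero _
  simp only [Fin.sum_univ_two]
  rw [h00, h01, h10, h11, pairing_zero, pairing_neg, pairing_smul, pairing_smul,
    pairing_sub (hc 0 1).continuous (hs 0 1), pairing_sub (hc 1 0).continuous (hs 1 0)]
  simp only [hw, e2, e1]
  ring

theorem isSymm_symCurl (v : H1Vec Ω) : (symCurl Ω v).IsSymm := by
  have h01 : symCurl Ω v 0 1 = symCurl Ω v 1 0 := (symRot_zero_one _).trans (symRot_one_zero _).symm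
  exact matrix_ext_fin_two rfl h01.symm h01 rfl

theorem symCurl_mem_HDivDiv (v : H1Vec Ω) : symCurl Ω v ∈ HDivDiv Ω :=
  ⟨isSymm_symCurl v, 0, hasWeakDivDiv_symCurl v⟩

theorem EqOn.symCurl (hΩ : IsLipschitzDomain Ω) {T : Finset E} (hT : T ∈ 𝒯.triangles)
    {v : H1Vec Ω} {p : Fin 2 → Poly} (h : ∀ i, EqOn T (v.1 i) (p i)) (i j : Fin 2) :
    EqOn T (symCurl Ω v i j) (symCurlP p i j) := by
  have hg : ∀ i j, EqOn T (weakGrad Ω v i j) (pderiv j (p i)) := fun i j =>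
    (h i).of_hasWeakDeriv hΩ hT (hasWeakDeriv_weakGrad v i j)
  have h00 : DivDiv.symCurl Ω v 0 0 = -weakGrad Ω v 0 1 := symRot_zero_zero _
  have h11 : DivDiv.symCurl Ω v 1 1 = weakGrad Ω v 1 0 := symRot_one_one _
  have h01 : DivDiv.symCurl Ω v 0 1 = (1 / 2 : ℝ) • (weakGrad Ω v 0 0 - weakGrad Ω v 1 1) :=
    symRot_zero_one _
  have h10 : DivDiv.symCurl Ω v 1 0 = (1 / 2 : ℝ) • (weakGrad Ω v 0 0 - weakGrad Ω v 1 1) :=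
    symRot_one_zero _
  fin_cases i <;> fin_cases j
  · exact h00 ▸ symCurlP_zero_zero p ▸ (hg 0 1).neg
  · exact h01 ▸ symCurlP_zero_one p ▸ ((hg 0 0).sub (hg 1 1)).smul _
  · exact h10 ▸ symCurlP_one_zero p ▸ ((hg 0 0).sub (hg 1 1)).smul _
  · exact h11 ▸ symCurlP_one_one p ▸ hg 1 0

theorem symCurlVh_mem {k : ℕ} (hk : 3 ≤ k) (hΩ : IsLipschitzDomain Ω) (v : Vh k 𝒯) :
    symCurlVh k 𝒯 v ∈ Sh k 𝒯 := by
  obtain ⟨v, hv, p, hp, hd⟩ := v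
  refine ⟨symCurl_mem_HDivDiv ⟨v, hv⟩, fun T => symCurlP (p T), fun T hT => ⟨?_, fun i j => ?_⟩,
    fun T hT T' hT' => ?_⟩
  · exact symCurlP_mem_PSym (hp T hT).1
  · exact EqOn.symCurl (v := ⟨v, hv⟩) hΩ hT (hp T hT).2 i j
  · exact SDofsAgree_symCurlP hk (hp T hT).1 (hp T' hT').1 (hd T hT T' hT')

theorem divDivSh_symCurlVh {k : ℕ} (v : Vh k 𝒯) (h : symCurlVh k 𝒯 v ∈ Sh k 𝒯) :
    divDivSh k 𝒯 ⟨symCurlVh k 𝒯 v, h⟩ = 0 :=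
  (hasWeakDivDiv_divDiv _).unique (hasWeakDivDiv_symCurl _)

theorem divDivSh_mem {k : ℕ} (hk : 3 ≤ k) (hΩ : IsLipschitzDomain Ω) (σ : Sh k 𝒯) :
    divDivSh k 𝒯 σ ∈ Ph k 𝒯 := by
  obtain ⟨σ, hσ, p, hp, hd⟩ := σ
  obtain ⟨l, rfl⟩ : ∃ l, k = l + 2 := ⟨k - 2, by omega⟩
  exact fun T hT => ⟨divDivP (p T), divDivP_mem (hp T hT).1.2,
    EqOn.of_hasWeakDivDiv hΩ hT (hp T hT).2 (hasWeakDivDiv_divDiv ⟨σ, hσ⟩)⟩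

theorem RT_le_Vh (k : ℕ) (𝒯 : Triangulation Ω) : RT Ω ≤ Vh k 𝒯 := by
  rintro v ⟨c, b, h⟩
  set r : Fin 2 → Poly := fun i => C (c i) + b • X i with hr
  have hr' : r ∈ RTPoly := ⟨c, b, fun _ => rfl⟩
  have hv : ∀ i, ∀ᵐ x ∂((volume : Measure E).restrict Ω), v i x = ev x (r i) := fun i => by
    filter_upwards [h i] with x hx
    rw [hx, hr, ev_add, ev_C, ev_smul, ev_X]
  refine ⟨fun i j => ?_, fun _ => r, fun T _ => ⟨RTPoly_le_PVec k hr', fun i => eqOn_of_ae (hv i) T⟩,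
    fun T _ T' _ => VDofsAgree.refl _ _ _⟩
  obtain ⟨w, hw⟩ := exists_glue 𝒯 fun _ => pderiv j (r i)
  exact ⟨w, hasWeakDeriv_of_ae (hv i) (ae_of_forall_eqOn hw)⟩

/-- Piecewise Raviart-Thomas fields that agree at shared vertices are globally Raviart-Thomas. -/
theorem exists_eq_of_agree (hΩ : IsLipschitzDomain Ω) {p : Finset E → Fin 2 → Poly}
    (hp : ∀ T ∈ 𝒯.triangles, p T ∈ RTPoly)
    (h : ∀ T ∈ 𝒯.triangles, ∀ T' ∈ 𝒯.triangles, ∀ a ∈ (T : Set E) ∩ T', ∀ i,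
      ev a (p T i) = ev a (p T' i)) :
    ∃ r ∈ RTPoly, ∀ T ∈ 𝒯.triangles, p T = r := by
  rcases 𝒯.triangles.eq_empty_or_nonempty with h0 | ⟨T₀, hT₀⟩
  · exact ⟨0, RTPoly.zero_mem, fun T hT => absurd hT (h0 ▸ Set.notMem_empty T)⟩
  refine ⟨p T₀, hp T₀ hT₀, fun T hT => ?_⟩
  refine (𝒯.subset_of_edge_closed hΩ (s := {T ∈ 𝒯.triangles | p T = p T₀}) (fun T h => h.1)
    ⟨T₀, hT₀, rfl⟩ ?_ hT).2
  rintro T ⟨hT, hTp⟩ T' hT' a ha b hb hab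
  refine ⟨hT', ?_⟩
  rw [← hTp, ← sub_eq_zero]
  refine eq_zero_of_mem_RTPoly (RTPoly.sub_mem (hp T' hT') (hp T hT)) hab ?_ ?_ <;> intro i <;>
    rw [Pi.sub_apply, ev_sub, sub_eq_zero]
  · exact (h T hT T' hT' a ha i).symm
  · exact (h T hT T' hT' b hb i).symm

/-- On each triangle the kernel is Raviart–Thomas, and single-valued vertex values make the pieces
agree at the ends of common edges. Such pieces form one global field. -/
theorem symCurlVh_eq_zero_iff {k : ℕ} (hΩ : IsLipschitzDomain Ω) (v : Vh k 𝒯) :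
    symCurlVh k 𝒯 v = 0 ↔ v.1 ∈ RT Ω := by
  obtain ⟨v, hv, p, hp, hd⟩ := v
  constructor
  · intro h
    have hRT : ∀ T ∈ 𝒯.triangles, p T ∈ RTPoly := fun T hT => by
      rw [← symCurlP_eq_zero_iff]
      ext1 i j
      have h1 := EqOn.symCurl (v := ⟨v, hv⟩) hΩ hT (hp T hT).2 i j
      have h2 : symCurl Ω ⟨v, hv⟩ i j = 0 := congrFun (congrFun h i) j
      rw [h2] at h1
      exact h1.unique hΩ hT EqOn.zero
    obtain ⟨r, ⟨c, b, hr⟩, h1⟩ := exists_eq_of_agree hΩ hRT fun T hT T' hT' a ha i =>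
      ((hd T hT T' hT').1 a ha i).1
    refine ⟨c, b, fun i => ?_⟩
    have h2 : ∀ T ∈ 𝒯.triangles, EqOn T (v i) (r i) := fun T hT => h1 T hT ▸ (hp T hT).2 i
    filter_upwards [ae_of_forall_eqOn h2] with x hx
    rw [hx, hr, ev_add, ev_C, ev_smul, ev_X]
  · rintro ⟨c, b, h⟩
    set r : Fin 2 → Poly := fun i => C (c i) + b • X i with hr
    have hr' : r ∈ RTPoly := ⟨c, b, fun _ => rfl⟩
    have h1 : ∀ i j, symCurl Ω ⟨v, hv⟩ i j = 0 := fun i j => by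
      refine eq_of_forall_eqOn (𝒯 := 𝒯) (p := fun _ => 0) (fun T hT => ?_) fun _ _ => EqOn.zero
      have h2 := EqOn.symCurl (v := ⟨v, hv⟩) hΩ hT (p := r) (fun i => eqOn_of_ae (by
        filter_upwards [h i] with x hx
        rw [hx, hr, ev_add, ev_C, ev_smul, ev_X]) T) i j
      rwa [(symCurlP_eq_zero_iff r).2 hr'] at h2
    ext1 i j
    exact h1 i j

end complex
-- Removing constant jumps on a simply connected domain
section cocycle

open MvPolynomial

theorem exists_affine_eq {p : Poly} (hp : p ∈ P 1) :
    ∃ (c : ℝ) (d : Fin 2 → ℝ), p = C c + ∑ i, C (d i) * X i := by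
  have h1 : ∀ i, ∃ d : ℝ, pderiv i p = C d := fun i =>
    eq_C_of_pderiv_eq_zero fun j => pderiv_eq_zero_of_mem_P_zero (pderiv_mem_P i hp) j
  choose d hd using h1
  obtain ⟨c, hc⟩ := eq_C_of_pderiv_eq_zero (p := p - ∑ i, C (d i) * X i) (by
    intro i
    fin_cases i <;> simp [hd, Fin.sum_univ_two, pderiv_X])
  exact ⟨c, d, by rw [← hc, sub_add_cancel]⟩

/-- Polynomials of degree one are affine. -/
theorem ev_combo {p : Poly} (hp : p ∈ P 1) (x y : E) {s t : ℝ} (hst : s + t = 1) :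
    ev (s • x + t • y) p = s * ev x p + t * ev y p := by
  obtain ⟨c, d, rfl⟩ := exists_affine_eq hp
  simp only [ev_add, ev_C, Fin.sum_univ_two, ev_mul, ev_X, PiLp.add_apply, PiLp.smul_apply,
    smul_eq_mul]
  linear_combination (-c) * hst

theorem ev_eq_of_mem_convexHull {p : Poly} (hp : p ∈ P 1) {S : Set E} {c : ℝ}
    (h : ∀ a ∈ S, ev a p = c) {x : E} (hx : x ∈ convexHull ℝ S) : ev x p = c := by
  have hconv : Convex ℝ {x : E | ev x p = c} := by
    intro x hx y hy s t _ _ hst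
    rw [Set.mem_ofPred_eq] at hx hy ⊢
    rw [ev_combo hp x y hst, hx, hy, ← add_mul, hst, one_mul]
  exact convexHull_min h hconv hx

theorem IsTriangle.exists_interp {T : Finset E} (hT : IsTriangle T) (c : E → ℝ) :
    ∃ q ∈ P 1, ∀ a ∈ T, ev a q = c a := by
  obtain ⟨v, hTv, hv⟩ := hT.exists_vertices
  refine ⟨∑ i, c (v i) • lam v i, Submodule.sum_mem _ fun i _ =>
    (P 1).smul_mem _ (lam_mem v i), fun a ha => ?_⟩
  have ha' : a ∈ Set.range v := hTv ▸ ha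
  obtain ⟨j, rfl⟩ := ha'
  rw [ev_sum, Finset.sum_eq_single j, ev_smul, ev_lam_self hv, mul_one]
  · intro i _ hij
    rw [ev_smul, ev_lam_of_ne v (Ne.symm hij), mul_zero]
  · exact fun h => absurd (Finset.mem_univ j) h

/-- A continuous function on a preconnected set that is everywhere near a translate of `ℤ` stays
near one point of this translate. -/
theorem exists_int_near {X : Type*} [TopologicalSpace X] {s : Set X} (hs : IsPreconnected s)
    {f : X → ℝ} (hf : ContinuousOn f s) {α : ℝ} (h : ∀ x ∈ s, ∃ n : ℤ, |f x - α - n| < 1 / 4) :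
    ∃ n : ℤ, ∀ x ∈ s, |f x - α - n| < 1 / 4 := by
  have key : ∀ x ∈ s, ∀ y ∈ s, ∀ n m : ℤ, |f x - α - n| < 1 / 4 → |f y - α - m| < 1 / 4 →
      m ≤ n := by
    intro x hx y hy n m hn hm
    by_contra! hlt
    have hlt' : (n : ℝ) + 1 ≤ m := by exact_mod_cast hlt
    rw [abs_lt] at hn hm
    -- The intermediate value `α + n + 1/2` is at distance at least `1/2` from every point of `α +
    -- ℤ`.
    obtain ⟨z, hz, hfz⟩ := hs.intermediate_value hx hy hf
      (show α + n + 1 / 2 ∈ Set.Icc (f x) (f y) from ⟨by linarith, by linarith⟩)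
    obtain ⟨l, hl⟩ := h z hz
    rw [hfz, abs_lt] at hl
    have h1 : (n : ℝ) < l := by linarith
    have h2 : (l : ℝ) < n + 1 := by linarith
    have h3 : n < l := by exact_mod_cast h1
    have h4 : l < n + 1 := by exact_mod_cast h2
    omega
  rcases s.eq_empty_or_nonempty with rfl | ⟨x, hx⟩
  · exact ⟨0, fun x hx => absurd hx (Set.notMem_empty x)⟩
  obtain ⟨n, hn⟩ := h x hx
  refine ⟨n, fun y hy => ?_⟩
  obtain ⟨m, hm⟩ := h y hy
  rwa [le_antisymm (key y hy x hx m n hm hn) (key x hx y hy n m hn hm)]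

variable {Ω : TopologicalSpace.Opens E} {𝒯 : Triangulation Ω}

/-- Piecewise affine functions that match up to integer constants are, on a simply connected
domain, the pieces of one continuous function up to integer constants. -/
theorem exists_lift [SimplyConnectedSpace Ω] (hΩ : IsLipschitzDomain Ω) {L : Finset E → Poly}
    (hL : ∀ T, L T ∈ P 1)
    (h : ∀ T ∈ 𝒯.triangles, ∀ T' ∈ 𝒯.triangles, ∃ n : ℤ, ∀ a ∈ (T : Set E) ∩ T',
      ev a (L T) - ev a (L T') = n) :
    ∃ (Θ : E → ℝ) (s : Finset E → ℤ), ContinuousOn Θ Ω ∧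
      ∀ T ∈ 𝒯.triangles, ∀ x ∈ Ω, x ∈ convexHull ℝ (T : Set E) → Θ x = ev x (L T) - s T := by
  classical
  have hex : ∀ x : Ω, ∃ T ∈ 𝒯.triangles, (x : E) ∈ convexHull ℝ (T : Set E) := fun x => by
    simpa using 𝒯.subset_biUnion_cells x.2
  choose t ht hxt using hex
  -- Modulo `ℤ` the affine pieces agree on intersections, so they form one continuous map to the
  -- circle, independent of the chosen triangle. Simple connectedness lifts it through the covering
  -- `ℝ → ℝ/ℤ`.
  let θ : Ω → AddCircle (1 : ℝ) := fun x => (ev (x : E) (L (t x)) : ℝ)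
  have hθ : ∀ T ∈ 𝒯.triangles, ∀ x : Ω, (x : E) ∈ convexHull ℝ (T : Set E) →
      θ x = (ev (x : E) (L T) : ℝ) := by
    intro T hT x hx
    obtain ⟨n, hn⟩ := h (t x) (ht x) T hT
    have hx' : (x : E) ∈ convexHull ℝ ((t x : Set E) ∩ T) := by
      rw [← Triangulation.cell_inter_cell (ht x) hT]
      exact ⟨hxt x, hx⟩
    have h1 := ev_eq_of_mem_convexHull ((P 1).sub_mem (hL (t x)) (hL T)) (c := n)
      (fun a ha => by rw [ev_sub, hn a ha]) hx'
    rw [ev_sub] at h1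
    change ((ev (x : E) (L (t x)) : ℝ) : AddCircle (1 : ℝ)) = _
    rw [← sub_eq_zero, ← AddCircle.coe_sub, h1, AddCircle.coe_eq_zero_iff]
    exact ⟨n, by simp⟩
  have hcont : Continuous θ := by
    refine (locallyFinite_of_finite fun T : 𝒯.cells =>
      {x : Ω | (x : E) ∈ convexHull ℝ ((T : Finset E) : Set E)}).continuous ?_ ?_ ?_
    · refine Set.eq_univ_of_forall fun x => Set.mem_iUnion.2
        ⟨⟨t x, Triangulation.mem_cells.2 (ht x)⟩, hxt x⟩
    · exact fun T => (isClosed_cell T).preimage continuous_subtype_val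
    · intro T
      have h1 : Continuous fun x : Ω => ((ev (x : E) (L T) : ℝ) : AddCircle (1 : ℝ)) :=
        (AddCircle.continuous_mk' 1).comp ((continuous_ev _).comp continuous_subtype_val)
      exact h1.continuousOn.congr fun x hx => hθ T (Triangulation.mem_cells.1 T.2) x hx
  have hloc : LocallyPathConnectedSpace Ω := Ω.isOpen.locallyPathConnectedSpace
  obtain ⟨x₀⟩ : Nonempty Ω := hΩ.isConnected.nonempty.to_subtype
  obtain ⟨Θ, ⟨-, hΘ⟩, -⟩ := (AddCircle.isCoveringMap_coe (1 : ℝ)).existsUnique_continuousMap_lifts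
    ⟨θ, hcont⟩ x₀ (ev (x₀ : E) (L (t x₀))) rfl
  let Θ' : E → ℝ := fun x => if hx : x ∈ Ω then Θ ⟨x, hx⟩ else 0
  have hΘ' : ContinuousOn Θ' Ω := by
    have h1 : (Ω : Set E).domRestrict Θ' = Θ := funext fun x => dif_pos x.2
    rw [continuousOn_iff_continuous_domRestrict, h1]
    exact Θ.continuous
  have hint : ∀ T ∈ 𝒯.triangles, ∀ x ∈ (Ω : Set E) ∩ convexHull ℝ (T : Set E),
      ∃ n : ℤ, Θ' x - ev x (L T) = n := by
    rintro T hT x ⟨hx, hxT⟩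
    have h1 : ((Θ ⟨x, hx⟩ : ℝ) : AddCircle (1 : ℝ)) = (ev x (L T) : ℝ) :=
      (congrFun hΘ ⟨x, hx⟩).trans (hθ T hT ⟨x, hx⟩ hxT)
    rw [← sub_eq_zero, ← AddCircle.coe_sub, AddCircle.coe_eq_zero_iff] at h1
    obtain ⟨n, hn⟩ := h1
    refine ⟨n, ?_⟩
    rw [show Θ' x = Θ ⟨x, hx⟩ from dif_pos hx, ← hn]
    simp
  have hs : ∀ T ∈ 𝒯.triangles, ∃ n : ℤ, ∀ x ∈ (Ω : Set E) ∩ convexHull ℝ (T : Set E),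
      Θ' x - ev x (L T) = n := by
    intro T hT
    -- This set lies between the convex interior of the triangle and its closure. Being connected,
    -- it carries only one value of the integer-valued difference of the lift and the affine piece.
    have hpre : IsPreconnected ((Ω : Set E) ∩ convexHull ℝ (T : Set E)) := by
      refine ((convex_convexHull ℝ (T : Set E)).interior.isPreconnected).subset_closure ?_ ?_
      · exact fun x hx => ⟨Triangulation.interior_cell_subset hΩ hT hx, interior_subset hx⟩
      · exact fun x hx => (Triangulation.isTriangle hT).cell_subset_closure hx.2
    obtain ⟨n, hn⟩ := exists_int_near hpre (f := fun x => Θ' x - ev x (L T)) (α := 0)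
      ((hΘ'.mono Set.inter_subset_left).sub (continuous_ev _).continuousOn) (fun x hx => by
        obtain ⟨n, hn⟩ := hint T hT x hx
        exact ⟨n, by rw [hn]; simp⟩)
    refine ⟨n, fun x hx => ?_⟩
    obtain ⟨m, hm⟩ := hint T hT x hx
    have h1 := hn x hx
    rw [hm, sub_zero, ← Int.cast_sub, ← Int.cast_abs] at h1
    have h2 : |m - n| < 1 := by
      have : ((|m - n| : ℤ) : ℝ) < 1 := by linarith
      exact_mod_cast this
    rw [hm, show m = n by rw [Int.abs_lt_one_iff] at h2; omega]
  choose! s hs using hs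
  refine ⟨Θ', fun T => -s T, hΘ', fun T hT x hx hxT => ?_⟩
  have := hs T hT x ⟨hx, hxT⟩
  push_cast
  linarith

/-- The lift is controlled only inside `Ω`, whereas a vertex may lie on the boundary. Near `a` a
connected part of `Ω` keeps the lift within `1/4` of a single value `ev a (L T) + m`. Every triangle
at `a` is reached through that part, so its shifted affine piece takes this same value at `a`. -/
theorem exists_int_shift [SimplyConnectedSpace Ω] (hΩ : IsLipschitzDomain Ω) {L : Finset E → Poly}
    (hL : ∀ T, L T ∈ P 1)
    (h : ∀ T ∈ 𝒯.triangles, ∀ T' ∈ 𝒯.triangles, ∃ n : ℤ, ∀ a ∈ (T : Set E) ∩ T',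
      ev a (L T) - ev a (L T') = n) :
    ∃ s : Finset E → ℤ, ∀ T ∈ 𝒯.triangles, ∀ T' ∈ 𝒯.triangles, ∀ a ∈ (T : Set E) ∩ T',
      ev a (L T) - s T = ev a (L T') - s T' := by
  obtain ⟨Θ, s, hΘ, hs⟩ := exists_lift hΩ hL h
  refine ⟨s, fun T hT T' hT' a ⟨haT, haT'⟩ => ?_⟩
  -- Close to `a` only triangles having `a` as a vertex occur, and their affine pieces vary by less
  -- than `1/4`.
  have hN : {x : E | ∀ S ∈ 𝒯.triangles, (a ∈ S → |ev x (L S) - ev a (L S)| < 1 / 4) ∧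
      (a ∉ S → x ∉ convexHull ℝ (S : Set E))} ∈ 𝓝 a := by
    simp only [Set.ofPred_forall]
    refine (Filter.biInter_mem 𝒯.finite_triangles).2 fun S hS => Filter.inter_mem ?_ ?_
    · by_cases haS : a ∈ S
      · have h1 : Continuous fun x => |ev x (L S) - ev a (L S)| :=
          ((continuous_ev _).sub continuous_const).abs
        filter_upwards [(isOpen_lt h1 continuous_const).mem_nhds
          (show |ev a (L S) - ev a (L S)| < 1 / 4 by simp)] with x hx _ using hx
      · exact Filter.Eventually.of_forall fun x h => absurd h haS
    · by_cases haS : a ∈ S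
      · exact Filter.Eventually.of_forall fun x h => absurd haS h
      · have h1 : a ∉ convexHull ℝ (S : Set E) := by
          rw [𝒯.complex.vertex_mem_convexHull_iff (𝒯.complex.down_closed hT.1
            (Finset.singleton_subset_iff.2 haT) (Finset.singleton_nonempty a)) hS.1]
          exact haS
        filter_upwards [(isClosed_cell S).isOpen_compl.mem_nhds h1] with x hx _ using hx
  have hcl : a ∈ closure (Ω : Set E) :=
    Triangulation.cell_subset_closure hT (subset_convexHull ℝ _ haT)
  obtain ⟨W, hW, hWN, hpre⟩ := hΩ.exists_preconnected_nhds hcl hN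
  obtain ⟨m, hm⟩ := exists_int_near hpre (hΘ.mono Set.inter_subset_right) (α := ev a (L T)) (by
    rintro x ⟨hxW, hxΩ⟩
    obtain ⟨S, hS, hxS⟩ := Set.mem_iUnion₂.1 (𝒯.subset_biUnion_cells hxΩ)
    have haS : a ∈ S := by
      by_contra haS
      exact (hWN hxW S hS).2 haS hxS
    obtain ⟨n, hn⟩ := h S hS T hT
    refine ⟨n - s S, ?_⟩
    have h1 := (hWN hxW S hS).1 haS
    have h2 := hn a ⟨haS, haT⟩
    rw [hs S hS x hxΩ hxS]
    push_cast
    convert h1 using 2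
    linarith)
  have key : ∀ S ∈ 𝒯.triangles, a ∈ S → ev a (L S) - s S = ev a (L T) + m := by
    intro S hS haS
    obtain ⟨x, hxW, hxS⟩ := mem_closure_iff_nhds.1 ((Triangulation.isTriangle hS).cell_subset_closure
      (subset_convexHull ℝ _ haS)) W hW
    have hxΩ := Triangulation.interior_cell_subset hΩ hS hxS
    have h1 := (hWN hxW S hS).1 haS
    have h2 := hm x ⟨hxW, hxΩ⟩
    rw [hs S hS x hxΩ (interior_subset hxS)] at h2
    obtain ⟨n, hn⟩ := h S hS T hT
    have h3 := hn a ⟨haS, haT⟩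
    rw [abs_lt] at h1 h2
    have h4 : ((n - s S - m : ℤ) : ℝ) < 1 := by push_cast; linarith
    have h5 : (-1 : ℝ) < ((n - s S - m : ℤ) : ℝ) := by push_cast; linarith
    have h6 : n - s S - m < 1 := by exact_mod_cast h4
    have h7 : -1 < n - s S - m := by exact_mod_cast h5
    have h8 : (n : ℝ) - s S - m = 0 := by exact_mod_cast (by omega : n - s S - m = 0)
    linarith
  rw [key T hT haT, key T' hT' haT']

/-- On a simply connected domain, values at the vertices of the triangles whose jumps between
neighbours are constant can be matched by subtracting one constant for each triangle. -/
theorem exists_shift [SimplyConnectedSpace Ω] (hΩ : IsLipschitzDomain Ω) (𝒯 : Triangulation Ω)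
    {g : Finset E → E → ℝ}
    (h : ∀ T ∈ 𝒯.triangles, ∀ T' ∈ 𝒯.triangles, ∀ a ∈ (T : Set E) ∩ T', ∀ b ∈ (T : Set E) ∩ T',
      g T a - g T' a = g T b - g T' b) :
    ∃ s : Finset E → ℝ, ∀ T ∈ 𝒯.triangles, ∀ T' ∈ 𝒯.triangles, ∀ a ∈ (T : Set E) ∩ T',
      g T a - s T = g T' a - s T' := by
  classical
  set A : Set ℝ := ⋃ T ∈ 𝒯.triangles, g T '' (T : Set E)
  have hA : A.Finite := 𝒯.finite_triangles.biUnion fun T _ => T.finite_toSet.image _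
  -- The finitely many values generate a finitely generated torsion-free group, which is free. In
  -- coordinates with respect to a basis the constant jumps become integers, so the integral result
  -- applies coordinate by coordinate to the affine interpolants `L`.
  let M : Submodule ℤ ℝ := Submodule.span ℤ A
  have hfin : Module.Finite ℤ M := Module.Finite.span_of_finite ℤ hA
  let b := Module.finBasis ℤ M
  let G : Finset E → E → M := fun T a =>
    if hTa : T ∈ 𝒯.triangles ∧ a ∈ T then
      ⟨g T a, Submodule.subset_span (Set.mem_biUnion hTa.1 ⟨a, hTa.2, rfl⟩)⟩ else 0
  have hG : ∀ T ∈ 𝒯.triangles, ∀ a ∈ T, ((G T a : M) : ℝ) = g T a := fun T hT a ha => by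
    simp only [G, dif_pos (And.intro hT ha)]
  have hGG : ∀ T ∈ 𝒯.triangles, ∀ T' ∈ 𝒯.triangles, ∀ a ∈ (T : Set E) ∩ T',
      ∀ c ∈ (T : Set E) ∩ T', G T a - G T' a = G T c - G T' c := by
    intro T hT T' hT' a ha c hc
    refine Subtype.ext ?_
    push_cast
    rw [hG T hT a ha.1, hG T' hT' a ha.2, hG T hT c hc.1, hG T' hT' c hc.2]
    exact h T hT T' hT' a ha c hc
  have hLex : ∀ i, ∀ T, ∃ q ∈ P 1, T ∈ 𝒯.triangles → ∀ a ∈ T, ev a q = b.repr (G T a) i := by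
    intro i T
    by_cases hT : T ∈ 𝒯.triangles
    · obtain ⟨q, hq, hq'⟩ := (Triangulation.isTriangle hT).exists_interp fun a => b.repr (G T a) i
      exact ⟨q, hq, fun _ => hq'⟩
    · exact ⟨0, (P 1).zero_mem, fun h => absurd h hT⟩
  choose L hL hLv using hLex
  have hsh : ∀ i, ∃ s : Finset E → ℤ, ∀ T ∈ 𝒯.triangles, ∀ T' ∈ 𝒯.triangles,
      ∀ a ∈ (T : Set E) ∩ T', b.repr (G T a) i - s T = b.repr (G T' a) i - s T' := by
    intro i
    obtain ⟨s, hs⟩ := exists_int_shift (𝒯 := 𝒯) hΩ (hL i) (by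
      intro T hT T' hT'
      rcases ((T : Set E) ∩ T').eq_empty_or_nonempty with h0 | ⟨c, hc⟩
      · exact ⟨0, fun a ha => absurd ha (h0 ▸ Set.notMem_empty a)⟩
      · refine ⟨b.repr (G T c - G T' c) i, fun a ha => ?_⟩
        rw [← hGG T hT T' hT' a ha c hc, hLv i T hT a ha.1, hLv i T' hT' a ha.2, map_sub,
          Finsupp.sub_apply]
        push_cast
        rfl)
    refine ⟨s, fun T hT T' hT' a ha => ?_⟩
    have h1 := hs T hT T' hT' a ha
    rw [hLv i T hT a ha.1, hLv i T' hT' a ha.2] at h1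
    exact_mod_cast h1
  choose s hs using hsh
  refine ⟨fun T => ((∑ i, s i T • b i : M) : ℝ), fun T hT T' hT' a ha => ?_⟩
  rw [← hG T hT a ha.1, ← hG T' hT' a ha.2]
  have key : G T a - ∑ i, s i T • b i = G T' a - ∑ i, s i T' • b i := by
    conv_lhs => rw [← b.sum_repr (G T a)]
    conv_rhs => rw [← b.sum_repr (G T' a)]
    rw [← Finset.sum_sub_distrib, ← Finset.sum_sub_distrib]
    refine Finset.sum_congr rfl fun i _ => ?_
    rw [← sub_smul, ← sub_smul, hs i T hT T' hT' a ha]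
  exact congrArg Subtype.val key

end cocycle
-- Weak differentiability of continuous piecewise polynomials
section sobolev

open MvPolynomial

/-- A function that is Lipschitz on each piece of a finite closed cover is Lipschitz. -/
theorem lipschitzWith_of_finite_cover {ι : Type*} [Finite ι] {C : ι → Set E}
    (hC : ∀ i, IsClosed (C i)) (hcov : ⋃ i, C i = Set.univ) {f : E → ℝ} {K : ℝ≥0}
    (hf : ∀ i, LipschitzOnWith K f (C i)) : LipschitzWith K f := by
  have hcont : Continuous f := (locallyFinite_of_finite C).continuous hcov hC
    fun i => (hf i).continuousOn
  have key : ∀ x y : E, f y ≤ f x + K * dist x y := by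
    intro x y
    let γ : ℝ → E := AffineMap.lineMap x y
    have hγ : Continuous γ := AffineMap.lineMap_continuous
    have hfγ : Continuous fun t => f (γ t) := hcont.comp hγ
    have h := image_le_of_liminf_slope_right_le_deriv_boundary (f := fun t => f (γ t)) (a := 0)
      (b := 1) (B := fun t => f x + K * dist x y * t) (B' := fun _ => K * dist x y)
      hfγ.continuousOn (by simp [γ]) (by fun_prop) (fun t _ => by
        have h1 := ((hasDerivWithinAt_id t (Set.Ici t)).const_mul (K * dist x y)).const_add (f x)
        simpa using h1) (fun t _ r hr => by
        -- Finitely many pieces cover the segment, so one of them contains points arbitrarily close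
        -- to `t` on the right, and by closedness `γ t` too. On this piece the difference quotient
        -- is bounded by `K * dist x y`.
        have h1 : ∃ᶠ z in 𝓝[>] t, ∃ i, γ z ∈ C i :=
          (Filter.Eventually.of_forall fun z => by
            have : γ z ∈ ⋃ i, C i := hcov ▸ Set.mem_univ _
            exact Set.mem_iUnion.1 this).frequently
        rw [Filter.frequently_exists] at h1
        obtain ⟨i, hi⟩ := h1
        have ht : γ t ∈ C i := by
          have h2 : ∃ᶠ z in 𝓝 t, z ∈ γ ⁻¹' C i := hi.filter_mono nhdsWithin_le_nhds
          exact ((hC i).preimage hγ).mem_of_frequently_of_tendsto h2 Filter.tendsto_id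
        refine (hi.and_eventually self_mem_nhdsWithin).mono fun z hz => lt_of_le_of_lt ?_ hr
        have hzt : 0 < z - t := sub_pos.2 hz.2
        have h2 := (hf i).dist_le_mul _ hz.1 _ ht
        rw [Real.dist_eq, dist_lineMap_lineMap, Real.dist_eq, abs_of_pos hzt] at h2
        rw [slope_def_field, div_le_iff₀ hzt]
        linarith [le_abs_self (f (γ z) - f (γ t))])
    have h1 := h (x := 1) ⟨zero_le_one, le_rfl⟩
    simpa [γ] using h1
  refine LipschitzWith.of_dist_le_mul fun x y => ?_
  rw [Real.dist_eq, abs_le]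
  have h1 := key x y
  have h2 := key y x
  rw [dist_comm y x] at h2
  constructor <;> linarith

/-- Integration by parts against the constant function `1`. -/
theorem LipschitzWith.integral_lineDeriv_eq_zero {f : E → ℝ} {K : ℝ≥0} (hf : LipschitzWith K f)
    (hs : HasCompactSupport f) (v : E) : ∫ x, lineDeriv ℝ f x v = 0 := by
  have h := LipschitzWith.integral_lineDeriv_mul_eq (μ := (volume : Measure E))
    (LipschitzWith.const (1 : ℝ)) hf hs (-v)
  simpa [lineDeriv] using h.symm

variable {Ω : TopologicalSpace.Opens E} {𝒯 : Triangulation Ω}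

/-- Continuous piecewise polynomials are weakly differentiable. -/
theorem exists_hasWeakDeriv {p : Finset E → Poly}
    (hp : ∀ T ∈ 𝒯.triangles, ∀ T' ∈ 𝒯.triangles, ∀ x ∈ convexHull ℝ ((T : Set E) ∩ T'),
      ev x (p T) = ev x (p T'))
    {u : L2 Ω} (hu : ∀ T ∈ 𝒯.triangles, EqOn T u (p T)) (i : Fin 2) :
    ∃ w, HasWeakDeriv i u w := by
  classical
  obtain ⟨w, hw⟩ := exists_glue 𝒯 fun T => pderiv i (p T)
  refine ⟨w, fun φ => ?_⟩
  -- The product of the piecewise polynomial with the test function, extended by zero. It is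
  -- Lipschitz with compact support, so its directional derivative integrates to zero; the product
  -- rule on each triangle turns this into the weak derivative identity.
  let F : E → ℝ := fun x =>
    if h : ∃ T ∈ 𝒯.triangles, x ∈ convexHull ℝ (T : Set E) then ev x (p h.choose) * φ x else 0
  have hF : ∀ T ∈ 𝒯.triangles, ∀ x ∈ convexHull ℝ (T : Set E), F x = ev x (p T) * φ x := by
    intro T hT x hx
    have h : ∃ T ∈ 𝒯.triangles, x ∈ convexHull ℝ (T : Set E) := ⟨T, hT, hx⟩
    simp only [F, dif_pos h]
    rw [hp _ h.choose_spec.1 T hT x]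
    rw [← Triangulation.cell_inter_cell h.choose_spec.1 hT]
    exact ⟨h.choose_spec.2, hx⟩
  have hF0 : ∀ x, φ x = 0 → F x = 0 := by
    intro x hx
    by_cases h : ∃ T ∈ 𝒯.triangles, x ∈ convexHull ℝ (T : Set E)
    · obtain ⟨T, hT, hxT⟩ := h
      rw [hF T hT x hxT, hx, mul_zero]
    · exact dif_neg h
  have hφ0 : ∀ x, x ∉ Ω → φ x = 0 := fun x hx =>
    image_eq_zero_of_notMem_tsupport fun h => hx (φ.tsupport_subset h)
  have hsupp : HasCompactSupport F :=
    φ.hasCompactSupport.mono fun x hx h => hx (hF0 x h)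
  have hsm : ∀ T, ContDiff ℝ 1 fun x => ev x (p T) * φ x := fun T =>
    (contDiff_ev (p T)).mul (contDiff_infty.1 φ.contDiff 1)
  have hlip : ∃ K : ℝ≥0, LipschitzWith K F := by
    have h1 : ∀ T, ∃ K : ℝ≥0, LipschitzWith K fun x => ev x (p T) * φ x := fun T =>
      ⟨_, (hsm T).lipschitzWith_of_hasCompactSupport φ.hasCompactSupport.mul_left
        one_ne_zero |>.choose_spec⟩
    choose K hK using h1
    refine ⟨∑ T ∈ 𝒯.cells, K T, ?_⟩
    refine lipschitzWith_of_finite_cover (ι := Option 𝒯.cells)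
      (C := fun o => o.elim ((Ω : Set E)ᶜ) fun T => convexHull ℝ ((T : Finset E) : Set E)) ?_ ?_ ?_
    · rintro (_ | T)
      · exact Ω.isOpen.isClosed_compl
      · exact isClosed_cell T
    · refine Set.eq_univ_of_forall fun x => Set.mem_iUnion.2 ?_
      by_cases hx : x ∈ (Ω : Set E)
      · obtain ⟨T, hT, hxT⟩ := Set.mem_iUnion₂.1 (𝒯.subset_biUnion_cells hx)
        exact ⟨some ⟨T, Triangulation.mem_cells.2 hT⟩, hxT⟩
      · exact ⟨none, hx⟩
    · rintro (_ | T)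
      · refine LipschitzOnWith.of_dist_le_mul fun x hx y hy => ?_
        rw [hF0 x (hφ0 x hx), hF0 y (hφ0 y hy), dist_self]
        positivity
      · have h2 : LipschitzOnWith (K T) F (convexHull ℝ ((T : Finset E) : Set E)) := by
          intro x hx y hy
          rw [hF T (Triangulation.mem_cells.1 T.2) x hx, hF T (Triangulation.mem_cells.1 T.2) y hy]
          exact hK T x y
        exact h2.weaken (Finset.single_le_sum (f := K) (fun _ _ => zero_le) T.2)
  obtain ⟨K, hK⟩ := hlip
  have hint := LipschitzWith.integral_lineDeriv_eq_zero hK hsupp (EuclideanSpace.single i 1)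
  have hout : ∀ x, x ∉ (Ω : Set E) → lineDeriv ℝ F x (EuclideanSpace.single i 1) = 0 := by
    intro x hx
    have h1 : F =ᶠ[𝓝 x] fun _ => 0 := by
      filter_upwards [(isClosed_tsupport φ).isOpen_compl.mem_nhds
        fun h => hx (φ.tsupport_subset h)] with y hy
      exact hF0 y (image_eq_zero_of_notMem_tsupport hy)
    rw [h1.lineDeriv_eq]
    simp [lineDeriv]
  have hin : ∀ᵐ x ∂((volume : Measure E).restrict Ω),
      lineDeriv ℝ F x (EuclideanSpace.single i 1) = u x * pd i φ x + w x * φ x := by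
    refine ae_of_forall_cell (𝒯 := 𝒯) fun T hT => ?_
    filter_upwards [hu T hT, hw T hT, ae_restrict_of_ae (measure_eq_zero_iff_ae_notMem.1
      ((convex_convexHull ℝ (T : Set E)).addHaar_frontier volume))] with x h1 h2 h3 hx
    have hxi : x ∈ interior (convexHull ℝ (T : Set E)) := by
      by_contra hi
      exact h3 ⟨subset_closure hx, hi⟩
    have h4 : F =ᶠ[𝓝 x] fun x => ev x (p T) * φ x := by
      filter_upwards [mem_interior_iff_mem_nhds.1 hxi] with y hy using hF T hT y hy
    have h5 := pd_mul ((contDiff_ev (p T) (n := 1)).differentiable one_ne_zero)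
      ((contDiff_infty.1 φ.contDiff 1).differentiable one_ne_zero) i x
    rw [pd_ev] at h5
    rw [h4.lineDeriv_eq, ((hsm T).differentiable one_ne_zero x).lineDeriv_eq_fderiv, h1 hx, h2 hx]
    exact h5.trans (by ring)
  rw [← setIntegral_eq_integral_of_forall_compl_eq_zero hout, integral_congr_ae hin,
    integral_add (integrable_pairing u (contDiff_pd φ.contDiff).continuous
      (hasCompactSupport_pd φ.hasCompactSupport))
      (integrable_pairing w φ.continuous φ.hasCompactSupport)] at hint
  exact eq_neg_of_add_eq_zero_left hint

end sobolev

/-! ### Exactness at the tensor space -/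

section exactness

open MvPolynomial

variable {Ω : TopologicalSpace.Opens E} {𝒯 : Triangulation Ω}

/-- Fields with the same degrees of freedom on an edge agree there. -/
theorem VDofsAgree.ev_eq {k : ℕ} (hk : 3 ≤ k) {S : Finset E} (hS : S.card ≤ 2)
    {v w : Fin 2 → Poly} (hv : v ∈ PVec (k + 1)) (hw : w ∈ PVec (k + 1))
    (h : VDofsAgree k (S : Set E) v w) (i : Fin 2) {x : E} (hx : x ∈ convexHull ℝ (S : Set E)) :
    ev x (v i) = ev x (w i) := by
  rw [← VDofsAgree_sub_iff, VDofsAgree_zero_iff hk ((PVec _).sub_mem hv hw)] at h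
  rw [← sub_eq_zero, ← ev_sub]
  have hcard : S.card = 0 ∨ S.card = 1 ∨ S.card = 2 := by omega
  rcases hcard with h0 | h1 | h2
  · rw [Finset.card_eq_zero] at h0
    simp [h0] at hx
  · obtain ⟨a, rfl⟩ := Finset.card_eq_one.1 h1
    rw [Finset.coe_singleton, convexHull_singleton, Set.mem_singleton_iff] at hx
    rw [hx]
    exact (h.1 a (by simp) i).1
  · classical
    obtain ⟨a, b, hab, rfl⟩ := Finset.card_eq_two.1 h2
    rw [Finset.coe_pair, convexHull_pair, segment_eq_image_lineMap] at hx
    obtain ⟨s, -, rfl⟩ := hx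
    have h3 := (h.2 a (by simp) b (by simp) hab).1 i
    rw [← eval_res]
    rw [Pi.sub_apply] at h3
    rw [h3, Polynomial.eval_zero]

theorem ev_eq_of_VDofsAgree {k : ℕ} (hk : 3 ≤ k) {p : Finset E → Fin 2 → Poly}
    (hp : ∀ T ∈ 𝒯.triangles, p T ∈ PVec (k + 1))
    (hd : ∀ T ∈ 𝒯.triangles, ∀ T' ∈ 𝒯.triangles, VDofsAgree k ((T : Set E) ∩ T') (p T) (p T'))
    (i : Fin 2) : ∀ T ∈ 𝒯.triangles, ∀ T' ∈ 𝒯.triangles, ∀ x ∈ convexHull ℝ ((T : Set E) ∩ T'),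
      ev x (p T i) = ev x (p T' i) := by
  classical
  intro T hT T' hT' x hx
  by_cases hne : T = T'
  · rw [hne]
  have h := hd T hT T' hT'
  rw [← Finset.coe_inter] at hx h
  refine h.ev_eq hk ?_ (hp T hT) (hp T' hT') i hx
  exact Triangulation.card_inter_le_two hT hT' hne

/-- Local potentials `v T` exist on every triangle. The jump of two of them has a `sym curl` without
degrees of freedom on the intersection, so its germ there is a single Raviart–Thomas field. Matching
these fields by one correction per triangle makes the potentials single-valued, hence continuous,
and the glued field lies in `H¹`. -/
theorem exists_symCurlVh_eq [SimplyConnectedSpace Ω] {k : ℕ} (hk : 3 ≤ k)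
    (hΩ : IsLipschitzDomain Ω) (σ : Sh k 𝒯) (h : divDivSh k 𝒯 σ = 0) :
    ∃ v, symCurlVh k 𝒯 v = σ := by
  obtain ⟨σ, hσ, p, hp, hd⟩ := σ
  obtain ⟨l, rfl⟩ : ∃ l, k = l + 1 := ⟨k - 1, by omega⟩
  have hdiv : ∀ T ∈ 𝒯.triangles, divDivP (p T) = 0 := fun T hT => by
    have h1 := EqOn.of_hasWeakDivDiv hΩ hT (hp T hT).2 (hasWeakDivDiv_divDiv ⟨σ, hσ⟩)
    have h2 : divDiv Ω ⟨σ, hσ⟩ = 0 := h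
    rw [h2] at h1
    exact h1.unique hΩ hT EqOn.zero
  have hv : ∀ T, ∃ v ∈ PVec (l + 1 + 1), T ∈ 𝒯.triangles → symCurlP v = p T := fun T => by
    by_cases hT : T ∈ 𝒯.triangles
    · obtain ⟨v, hv, hv'⟩ := exists_symCurlP_eq (hp T hT).1 (hdiv T hT)
      exact ⟨v, hv, fun _ => hv'⟩
    · exact ⟨0, Submodule.zero_mem _, fun h => absurd h hT⟩
  choose v hv hvp using hv
  have hS : ∀ T ∈ 𝒯.triangles, ∀ T' ∈ 𝒯.triangles,
      SDofsAgree (l + 1) ((T : Set E) ∩ T') (symCurlP (v T - v T')) 0 := fun T hT T' hT' => by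
    rw [map_sub, SDofsAgree_sub_iff, hvp T hT, hvp T' hT']
    exact hd T hT T' hT'
  have hgerm : ∀ T ∈ 𝒯.triangles, ∀ T' ∈ 𝒯.triangles, ∀ a ∈ (T : Set E) ∩ T',
      ∀ b ∈ (T : Set E) ∩ T', germ a (v T - v T') = germ b (v T - v T') :=
    fun T hT T' hT' a ha b hb =>
      germ_eq_of_SDofsAgree hk (Submodule.sub_mem _ (hv T) (hv T')) (hS T hT T' hT') ha hb
  -- A Raviart–Thomas field is coded by its divergence and its two components at the origin. These
  -- three scalars are matched separately.
  obtain ⟨s, hs⟩ := exists_shift hΩ 𝒯 (g := fun T a => ev a (divP (v T)))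
    (fun T hT T' hT' a ha b hb => by
      have h1 := congrArg (fun r => ev 0 (divP r)) (hgerm T hT T' hT' a ha b hb)
      simpa only [divP_germ, ev_C, map_sub, ev_sub] using h1)
  have hc : ∀ i, ∃ c : Finset E → ℝ, ∀ T ∈ 𝒯.triangles, ∀ T' ∈ 𝒯.triangles,
      ∀ a ∈ (T : Set E) ∩ T', ev 0 (germ a (v T) i) - c T = ev 0 (germ a (v T') i) - c T' := by
    intro i
    refine exists_shift hΩ 𝒯 (g := fun T a => ev 0 (germ a (v T) i))
      fun T hT T' hT' a ha b hb => ?_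
    have h1 := congrArg (fun r => ev 0 (r i)) (hgerm T hT T' hT' a ha b hb)
    simpa only [germ_sub, Pi.sub_apply, ev_sub] using h1
  choose c hc using hc
  -- The factor `1/2` gives the correction the divergence `s T`, because `x` has divergence two.
  let r : Finset E → Fin 2 → Poly := fun T i => C (c i T) + (1 / 2 * s T) • X i
  have hr : ∀ T, r T ∈ RTPoly := fun T => ⟨fun i => c i T, _, fun _ => rfl⟩
  have hq : ∀ T, v T - r T ∈ PVec (l + 1 + 1) := fun T =>
    Submodule.sub_mem _ (hv T) (RTPoly_le_PVec _ (hr T))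
  have hgr : ∀ T ∈ 𝒯.triangles, ∀ T' ∈ 𝒯.triangles, ∀ a ∈ (T : Set E) ∩ T',
      germ a (v T - r T - (v T' - r T')) = 0 := by
    intro T hT T' hT' a ha
    rw [germ_sub, germ_sub, germ_sub, germ_of_mem (hr T), germ_of_mem (hr T')]
    funext i
    have h1 := hs T hT T' hT' a ha
    have h2 := hc i T hT T' hT' a ha
    simp only [germ, ev_add, ev_C, ev_smul, ev_X, PiLp.zero_apply, mul_zero, add_zero] at h2
    have h3 : ev a (divP (v T)) = ev a (divP (v T')) + (s T - s T') := by linarith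
    have h4 : ev a (v T i) = ev a (v T' i) + 1 / 2 * (s T - s T') * a i + (c i T - c i T') := by
      rw [h3] at h2
      linarith
    simp only [Pi.sub_apply, Pi.zero_apply, germ, r, h3, h4, smul_eq_C_mul, C_add, C_mul, C_sub]
    ring
  have hagree : ∀ T ∈ 𝒯.triangles, ∀ T' ∈ 𝒯.triangles,
      VDofsAgree (l + 1) ((T : Set E) ∩ T') (v T - r T) (v T' - r T') := by
    intro T hT T' hT'
    rw [← VDofsAgree_sub_iff]
    refine VDofsAgree_of_germ hk (Submodule.sub_mem _ (hq T) (hq T')) ?_ (hgr T hT T' hT')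
      RTPoly.zero_mem
    have h1 : symCurlP (v T - r T - (v T' - r T')) = symCurlP (v T - v T') := by
      simp only [map_sub, (symCurlP_eq_zero_iff _).2 (hr _), sub_zero]
    rw [h1]
    exact hS T hT T' hT'
  have hu := fun i => exists_glue 𝒯 fun T => (v T - r T) i
  choose u hu using hu
  have hH : u ∈ H1Vec Ω := fun i j =>
    exists_hasWeakDeriv (ev_eq_of_VDofsAgree hk (fun T _ => hq T) hagree i) (hu i) j
  refine ⟨⟨u, hH, fun T => v T - r T, fun T hT => ⟨hq T, fun i => hu i T hT⟩, hagree⟩, ?_⟩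
  ext1 i j
  refine eq_of_forall_eqOn (𝒯 := 𝒯) (p := fun T => p T i j) (fun T hT => ?_)
    fun T hT => (hp T hT).2 i j
  have h1 := EqOn.symCurl (v := ⟨u, hH⟩) hΩ hT (fun i => hu i T hT) i j
  rwa [map_sub, (symCurlP_eq_zero_iff _).2 (hr T), sub_zero, hvp T hT] at h1

end exactness
-- Explicit cubic tensors attached to an edge
section edgeTensor

open MvPolynomial

theorem PSym_mono {l m : ℕ} (h : l ≤ m) : PSym l ≤ PSym m := fun _ hσ =>
  ⟨hσ.1, fun i j => P_mono h (hσ.2 i j)⟩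

theorem sum_rotate {M : Type*} [AddCommMonoid M] (f : Fin 3 → M) (l : Fin 3) :
    ∑ i, f i = f l + f (l + 1) + f (l + 2) := by
  rw [Fin.sum_univ_three]
  fin_cases l
  · rfl
  · exact (add_rotate (f 0) (f 1) (f 2))
  · exact (add_rotate (f 0) (f 1) (f 2)).trans (add_rotate (f 1) (f 2) (f 0))

theorem unitNormal_dot_succ (v : Fin 3 → E) (l : Fin 3) :
    unitNormal (v l) (v (l + 1)) 0 * edgeVec (v (l + 1)) (v (l + 1 + 1)) 0 +
      unitNormal (v l) (v (l + 1)) 1 * edgeVec (v (l + 1)) (v (l + 1 + 1)) 1 =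
      -(ori v / dist (v l) (v (l + 1))) := by
  fin_cases l <;> simp [unitNormal, edgeVec, ori, orient] <;> ring

theorem unitNormal_dot_opp (v : Fin 3 → E) (l : Fin 3) :
    unitNormal (v l) (v (l + 1)) 0 * edgeVec (v (l + 2)) (v (l + 2 + 1)) 0 +
      unitNormal (v l) (v (l + 1)) 1 * edgeVec (v (l + 2)) (v (l + 2 + 1)) 1 =
      ori v / dist (v l) (v (l + 1)) := by
  fin_cases l <;> simp [unitNormal, edgeVec, ori, orient] <;> ring

/-- The tangent of the edge is orthogonal to its normal, and the other two tangents have opposite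
normal components of size twice the area divided by the length. -/
theorem normalTrace_tangentTensor_edge (v : Fin 3 → E) (p : Fin 3 → Poly) (l : Fin 3)
    (j : Fin 2) :
    normalTrace (v l) (v (l + 1)) (tangentTensor v p) j = (ori v / dist (v l) (v (l + 1))) •
      (edgeVec (v (l + 2)) (v (l + 2 + 1)) j • p (l + 2) -
        edgeVec (v (l + 1)) (v (l + 1 + 1)) j • p (l + 1)) := by
  rw [normalTrace_tangentTensor, sum_rotate _ l, unitNormal_dot_edgeVec, unitNormal_dot_succ,
    unitNormal_dot_opp]
  module

theorem divNormalTrace_tangentTensor_edge (v : Fin 3 → E) (p : Fin 3 → Poly) (l : Fin 3) :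
    divNormalTrace (v l) (v (l + 1)) (tangentTensor v p) = (ori v / dist (v l) (v (l + 1))) •
      (dE v (l + 2) (p (l + 2)) - dE v (l + 1) (p (l + 1))) := by
  rw [divNormalTrace_tangentTensor, sum_rotate _ l, unitNormal_dot_edgeVec, unitNormal_dot_succ,
    unitNormal_dot_opp]
  module

variable {v : Fin 3 → E}

theorem ev_lineMap_lam (hv : ori v ≠ 0) (l i : Fin 3) (s : ℝ) :
    ev (AffineMap.lineMap (v l) (v (l + 1)) s) (lam v i) =
      if i = l then 1 - s else if i = l + 1 then s else 0 := by
  rw [AffineMap.lineMap_apply_module, ev_lam_combo v i _ _ (by ring)]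
  have h : l ≠ l + 1 := by fin_cases l <;> decide
  by_cases h1 : i = l
  · rw [if_pos h1, h1, ev_lam_self hv, ev_lam_of_ne v h.symm]
    ring
  · rw [if_neg h1, ev_lam_of_ne v (Ne.symm h1)]
    by_cases h2 : i = l + 1
    · rw [if_pos h2, h2, ev_lam_self hv]
      ring
    · rw [if_neg h2, ev_lam_of_ne v (Ne.symm h2)]
      ring

theorem dE_lam (hv : ori v ≠ 0) (l i : Fin 3) :
    dE v l (lam v i) = if i = l then -1 else if i = l + 1 then 1 else 0 := by
  have h : l ≠ l + 1 := by fin_cases l <;> decide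
  by_cases h1 : i = l
  · rw [if_pos h1, h1, dE_lam_self hv]
  · rw [if_neg h1]
    by_cases h2 : i = l + 1
    · rw [if_pos h2, h2, dE_lam_succ hv]
    · rw [if_neg h2]
      have h3 : i = l + 2 := by revert h1 h2; fin_cases i <;> fin_cases l <;> decide
      rw [h3, dE_lam_opp]

/-- Coefficients of a cubic tangential tensor whose normal traces vanish on all edges but the
first. -/
def edgeCoeff (v : Fin 3 → E) (α β γ x : ℝ) : Fin 3 → Poly :=
  ![γ • (lam v 0 * lam v 1 * (-(x • lam v 0) - (1 - x) • lam v 1) - lam v 0 * lam v 1 * lam v 2),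
    γ • (-(lam v 0 * lam v 1 * (-(x • lam v 0) - (1 - x) • lam v 1)) +
      (2 * x - 1) • (lam v 1 * lam v 1 * lam v 0) + (1 - x) • (lam v 1 * lam v 1 * lam v 2) +
      lam v 0 * lam v 1 * lam v 2) + α • (lam v 1 * lam v 1 * lam v 2),
    γ • (-(lam v 0 * lam v 1 * (-(x • lam v 0) - (1 - x) • lam v 1)) +
      (1 - 2 * x) • (lam v 0 * lam v 0 * lam v 1) + x • (lam v 0 * lam v 0 * lam v 2) +
      lam v 0 * lam v 1 * lam v 2) + β • (lam v 0 * lam v 0 * lam v 2)]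

theorem edgeCoeff_mem (v : Fin 3 → E) (α β γ x : ℝ) (i : Fin 3) :
    edgeCoeff v α β γ x i ∈ P 3 := by
  have h3 : ∀ a b c, lam v a * lam v b * lam v c ∈ P 3 := fun a b c =>
    mul_mem_P (mul_mem_P (lam_mem v a) (lam_mem v b)) (lam_mem v c)
  have h4 : lam v 0 * lam v 1 * (-(x • lam v 0) - (1 - x) • lam v 1) ∈ P 3 :=
    mul_mem_P (mul_mem_P (lam_mem v 0) (lam_mem v 1)) ((P 1).sub_mem
      ((P 1).neg_mem ((P 1).smul_mem _ (lam_mem v 0))) ((P 1).smul_mem _ (lam_mem v 1)))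
  have hs := fun c a b d => (P 3).smul_mem c (h3 a b d)
  fin_cases i
  · exact (P 3).smul_mem _ ((P 3).sub_mem h4 (h3 _ _ _))
  · exact (P 3).add_mem ((P 3).smul_mem _ ((P 3).add_mem ((P 3).add_mem ((P 3).add_mem
      ((P 3).neg_mem h4) (hs _ _ _ _)) (hs _ _ _ _)) (h3 _ _ _))) (hs _ _ _ _)
  · exact (P 3).add_mem ((P 3).smul_mem _ ((P 3).add_mem ((P 3).add_mem ((P 3).add_mem
      ((P 3).neg_mem h4) (hs _ _ _ _)) (hs _ _ _ _)) (h3 _ _ _))) (hs _ _ _ _)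

theorem ev_edgeCoeff_vertex (hv : ori v ≠ 0) (α β γ x : ℝ) (l i : Fin 3) :
    ev (v l) (edgeCoeff v α β γ x i) = 0 := by
  have h : ∀ i, ev (v l) (lam v i) = if i = l then 1 else 0 := fun i => by
    split_ifs with hi
    · rw [hi, ev_lam_self hv]
    · exact ev_lam_of_ne v (Ne.symm hi)
  fin_cases i <;> simp only [edgeCoeff, Fin.zero_eta, Fin.mk_one, Fin.reduceFinMk,
    Matrix.cons_val_zero, Matrix.cons_val_one, Matrix.cons_val, ev_smul, ev_add, ev_sub, ev_mul,
    ev_neg, h] <;> fin_cases l <;> simp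

/-- The parameter `x` splits `γ s (1 - s)` between the two tangents that leave the edge; a suitable
value makes their combination normal to it. -/
theorem ev_edgeCoeff_lineMap (hv : ori v ≠ 0) (α β γ x s : ℝ) :
    ev (AffineMap.lineMap (v 0) (v 1) s) (edgeCoeff v α β γ x 1) = γ * x * (s * (1 - s)) ∧
    ev (AffineMap.lineMap (v 0) (v 1) s) (edgeCoeff v α β γ x 2) = γ * (1 - x) * (s * (1 - s)) := by
  have h := fun i => ev_lineMap_lam hv 0 i s
  simp only [zero_add] at h
  constructor <;> simp [edgeCoeff, ev_smul, ev_add, ev_sub, ev_mul, ev_neg, h] <;> ring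

/-- The `α` and `β` terms contain `λ₂`, so they vanish on the first edge, but their derivatives
there leave `s²` and `(1 - s)²`. The `γ` terms are arranged to cancel, so the two traces can be
prescribed independently. -/
theorem ev_dE_edgeCoeff_lineMap (hv : ori v ≠ 0) (α β γ x s : ℝ) :
    ev (AffineMap.lineMap (v 0) (v 1) s) (dE v 2 (edgeCoeff v α β γ x 2) -
      dE v 1 (edgeCoeff v α β γ x 1)) = -(α * s ^ 2) - β * (1 - s) ^ 2 := by
  have h := fun i => ev_lineMap_lam hv 0 i s
  simp only [zero_add] at h
  simp [edgeCoeff, ev_smul, ev_add, ev_sub, ev_mul, ev_neg, h, Derivation.leibniz, dE_lam hv]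
  ring

theorem ev_edgeCoeff_lineMap_of_ne (hv : ori v ≠ 0) (α β γ x s : ℝ) {l : Fin 3} (hl : l ≠ 0) :
    ev (AffineMap.lineMap (v l) (v (l + 1)) s) (edgeCoeff v α β γ x (l + 1)) = 0 ∧
    ev (AffineMap.lineMap (v l) (v (l + 1)) s) (edgeCoeff v α β γ x (l + 2)) = 0 ∧
    ev (AffineMap.lineMap (v l) (v (l + 1)) s) (dE v (l + 2) (edgeCoeff v α β γ x (l + 2)) -
      dE v (l + 1) (edgeCoeff v α β γ x (l + 1))) = 0 := by
  have h1 : ∀ i, ev (AffineMap.lineMap (v 1) (v 2) s) (lam v i) =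
      if i = 1 then 1 - s else if i = 2 then s else 0 := fun i => ev_lineMap_lam hv 1 i s
  have h2 : ∀ i, ev (AffineMap.lineMap (v 2) (v 0) s) (lam v i) =
      if i = 2 then 1 - s else if i = 0 then s else 0 := fun i => ev_lineMap_lam hv 2 i s
  fin_cases l
  · exact absurd rfl hl
  all_goals
    simp [edgeCoeff, ev_smul, ev_add, ev_sub, ev_mul, ev_neg, h1, h2, Derivation.leibniz,
      dE_lam hv, ev_one]
  all_goals ring

end edgeTensor
-- Edge tensors detect the jump of an affine function
section edgeJump

open MvPolynomial

/-- A cubic symmetric tensor on the triangle with vertices `v` that vanishes at the vertices, whose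
normal traces vanish on all edges but the first, and whose normal traces on the first edge are
prescribed independently of the opposite vertex. -/
structure IsEdgeTensor (v : Fin 3 → E) (α β γ : ℝ) (σ : Matrix (Fin 2) (Fin 2) Poly) : Prop where
  mem : σ ∈ PSym 3
  vertex : ∀ l i j, ev (v l) (σ i j) = 0
  normalTrace_of_ne : ∀ l ≠ 0, ∀ i, res (v l) (v (l + 1)) (normalTrace (v l) (v (l + 1)) σ i) = 0
  divNormalTrace_of_ne : ∀ l ≠ 0,
    res (v l) (v (l + 1)) (divNormalTrace (v l) (v (l + 1)) σ) = 0
  ev_normalTrace : ∀ s i, ev (AffineMap.lineMap (v 0) (v 1) s) (normalTrace (v 0) (v 1) σ i) =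
    γ * (s * (1 - s)) * unitNormal (v 0) (v 1) i
  ev_divNormalTrace : ∀ s, ev (AffineMap.lineMap (v 0) (v 1) s) (divNormalTrace (v 0) (v 1) σ) =
    α * s ^ 2 + β * (1 - s) ^ 2

variable {v v' : Fin 3 → E}

theorem exists_isEdgeTensor (hv : ori v ≠ 0) (α β γ : ℝ) : ∃ σ, IsEdgeTensor v α β γ σ := by
  have hab : v 0 ≠ v 1 := vertices_ne hv (by decide)
  set d := dist (v 0) (v 1) with hd
  have hd0 : d ≠ 0 := dist_ne_zero.2 hab
  have hd2 : d ^ 2 = (v 0 0 - v 1 0) ^ 2 + (v 0 1 - v 1 1) ^ 2 := by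
    rw [hd, EuclideanSpace.dist_eq, Real.sq_sqrt (by positivity), Fin.sum_univ_two, Real.dist_eq,
      Real.dist_eq, sq_abs, sq_abs]
  set κ := ori v / d with hκ
  have hκ0 : κ ≠ 0 := div_ne_zero hv hd0
  -- The relative position on the first edge of the foot of the altitude from `v 2`. The combination
  -- of tangents in `hN` runs from `v 2` to this foot, so it is normal to the edge, with length
  -- `|κ|`.
  set x := ((v 2 0 - v 0 0) * (v 1 0 - v 0 0) + (v 2 1 - v 0 1) * (v 1 1 - v 0 1)) / d ^ 2 with hx
  have hN : ∀ j, edgeVec (v 2) (v 0) j * (1 - x) - edgeVec (v 1) (v 2) j * x =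
      κ * unitNormal (v 0) (v 1) j := by
    intro j
    have h1 : x * d ^ 2 =
        (v 2 0 - v 0 0) * (v 1 0 - v 0 0) + (v 2 1 - v 0 1) * (v 1 1 - v 0 1) := by
      rw [hx]
      field_simp
    have h2 : κ * d = ori v := by
      rw [hκ]
      field_simp
    have h3 : d * unitNormal (v 0) (v 1) j =
        ![v 1 1 - v 0 1, -(v 1 0 - v 0 0)] j := by
      rw [unitNormal, ← hd]
      fin_cases j <;> simp <;> field_simp
    refine mul_right_cancel₀ (pow_ne_zero 2 hd0) ?_
    have h4 : κ * unitNormal (v 0) (v 1) j * d ^ 2 =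
        ori v * ![v 1 1 - v 0 1, -(v 1 0 - v 0 0)] j := by
      rw [← h2, ← h3]
      ring
    have h5 : (edgeVec (v 2) (v 0) j * (1 - x) - edgeVec (v 1) (v 2) j * x) * d ^ 2 =
        edgeVec (v 2) (v 0) j * d ^ 2 -
          (edgeVec (v 2) (v 0) j + edgeVec (v 1) (v 2) j) * (x * d ^ 2) := by
      ring
    rw [h4, h5, h1, hd2, ori, orient]
    fin_cases j <;> simp [edgeVec] <;> ring
  -- The divergence trace carries one factor `κ`, and the normal trace a second one from `hN`.
  -- Dividing them out leaves traces independent of `v 2`, so tensors on two neighbours can match.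
  refine ⟨tangentTensor v (edgeCoeff v (-α / κ) (-β / κ) (γ / κ ^ 2) x),
    tangentTensor_mem (edgeCoeff_mem v _ _ _ _), fun l i j => ?_, fun l hl i => ?_, fun l hl => ?_,
    fun s i => ?_, fun s => ?_⟩
  · rw [tangentTensor_apply, ev_sum]
    exact Finset.sum_eq_zero fun m _ => by rw [ev_smul, ev_edgeCoeff_vertex hv, mul_zero]
  · refine Polynomial.funext fun s => ?_
    obtain ⟨h1, h2, -⟩ := ev_edgeCoeff_lineMap_of_ne hv (-α / κ) (-β / κ) (γ / κ ^ 2) x s hl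
    rw [eval_res, normalTrace_tangentTensor_edge, ev_smul, ev_sub, ev_smul, ev_smul, h1, h2]
    simp
  · refine Polynomial.funext fun s => ?_
    obtain ⟨-, -, h3⟩ := ev_edgeCoeff_lineMap_of_ne hv (-α / κ) (-β / κ) (γ / κ ^ 2) x s hl
    rw [eval_res, divNormalTrace_tangentTensor_edge, ev_smul, h3]
    simp
  · obtain ⟨h1, h2⟩ := ev_edgeCoeff_lineMap hv (-α / κ) (-β / κ) (γ / κ ^ 2) x s
    have h3 := normalTrace_tangentTensor_edge v (edgeCoeff v (-α / κ) (-β / κ) (γ / κ ^ 2) x) 0 i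
    simp only [zero_add, show (1 : Fin 3) + 1 = 2 from rfl, show (2 : Fin 3) + 1 = 0 from rfl] at h3
    rw [h3, ev_smul, ev_sub, ev_smul, ev_smul, h1, h2, ← hd, ← hκ]
    have h4 : κ * (edgeVec (v 2) (v 0) i * (γ / κ ^ 2 * (1 - x) * (s * (1 - s))) -
        edgeVec (v 1) (v 2) i * (γ / κ ^ 2 * x * (s * (1 - s)))) =
        κ * (γ / κ ^ 2 * (s * (1 - s))) *
          (edgeVec (v 2) (v 0) i * (1 - x) - edgeVec (v 1) (v 2) i * x) := by ring
    rw [h4, hN]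
    field_simp
  · have h1 := ev_dE_edgeCoeff_lineMap hv (-α / κ) (-β / κ) (γ / κ ^ 2) x s
    have h3 := divNormalTrace_tangentTensor_edge v (edgeCoeff v (-α / κ) (-β / κ) (γ / κ ^ 2) x) 0
    simp only [zero_add] at h3
    rw [h3, ev_smul, h1, ← hd, ← hκ]
    field_simp
    ring

variable {α β γ : ℝ} {σ σ' : Matrix (Fin 2) (Fin 2) Poly}

theorem IsEdgeTensor.edgeTerm_eq (h : IsEdgeTensor v α β γ σ) (φ : E → ℝ) :
    edgeTerm (v 0) (v 1) σ φ = dist (v 0) (v 1) * ∫ s in (0 : ℝ)..1,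
      (φ (AffineMap.lineMap (v 0) (v 1) s) * (α * s ^ 2 + β * (1 - s) ^ 2) -
        ∑ j, pd j φ (AffineMap.lineMap (v 0) (v 1) s) *
          (γ * (s * (1 - s)) * unitNormal (v 0) (v 1) j)) := by
  simp only [edgeTerm, eval_res, h.ev_normalTrace, h.ev_divNormalTrace]

/-- The defect of Green's formula for `div div` on the triangle `T`. -/
def greenDefect (T : Finset E) (σ : Matrix (Fin 2) (Fin 2) Poly) (φ : E → ℝ) : ℝ :=
  ∫ x in convexHull ℝ (T : Set E),
    (ev x (divDivP σ) * φ x - ∑ i, ∑ j, ev x (σ i j) * pd i (pd j φ) x)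

theorem IsEdgeTensor.greenDefect_eq (h : IsEdgeTensor v α β γ σ) (hv : ori v ≠ 0) {T : Finset E}
    (hT : (T : Set E) = Set.range v) {φ : E → ℝ} (hφ : ContDiff ℝ 2 φ) :
    greenDefect T σ φ = |ori v| / ori v * edgeTerm (v 0) (v 1) σ φ := by
  rw [greenDefect, hT, integral_divDiv_triangle hv h.mem.1 hφ, Fin.sum_univ_three,
    edgeTerm_eq_zero (h.normalTrace_of_ne 1 (by decide)) (h.divNormalTrace_of_ne 1 (by decide)),
    edgeTerm_eq_zero (h.normalTrace_of_ne 2 (by decide)) (h.divNormalTrace_of_ne 2 (by decide)),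
    add_zero, add_zero, zero_add]

theorem cellInt_divDivP_mul {T : Finset E} {q : Poly} (hq : q ∈ P 1) :
    cellInt T (divDivP σ * q) = greenDefect T σ fun x => ev x q := by
  have h : ∀ i j, pd i (pd j fun x => ev x q) = fun _ => 0 := fun i j => by
    rw [pd_ev, pd_ev, pderiv_eq_zero_of_mem_P_zero (pderiv_mem_P j hq)]
    simp only [ev_zero]
  simp only [cellInt_apply, greenDefect, h, mul_zero, Finset.sum_const_zero, sub_zero, ev_mul]

theorem abs_div_add_abs_div_eq_zero {r s : ℝ} (h : r * s < 0) : |r| / r + |s| / s = 0 := by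
  rcases mul_neg_iff.1 h with ⟨hr, hs⟩ | ⟨hr, hs⟩
  · rw [abs_of_pos hr, abs_of_neg hs, div_self hr.ne', neg_div, div_self hs.ne]
    ring
  · rw [abs_of_neg hr, abs_of_pos hs, neg_div, div_self hr.ne, div_self hs.ne']
    ring

theorem integral_cubic (a b c d : ℝ) : ∫ s in (0 : ℝ)..1, (a + b * s + c * s ^ 2 + d * s ^ 3) =
    a + b / 2 + c / 3 + d / 4 := by
  have h : ∀ s : ℝ, HasDerivAt (fun s => a * s + b / 2 * s ^ 2 + c / 3 * s ^ 3 + d / 4 * s ^ 4)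
      (a + b * s + c * s ^ 2 + d * s ^ 3) s := fun s => by
    have h1 := ((((hasDerivAt_id s).const_mul a).add ((hasDerivAt_pow 2 s).const_mul (b / 2))).add
      ((hasDerivAt_pow 3 s).const_mul (c / 3))).add ((hasDerivAt_pow 4 s).const_mul (d / 4))
    exact h1.congr_deriv (by simp; ring)
  rw [intervalIntegral.integral_eq_sub_of_hasDerivAt (fun s _ => h s)
    (Continuous.intervalIntegrable (by fun_prop) _ _)]
  ring

/-- Affine functions on two neighbouring triangles that are orthogonal to `div div` of all pairs of
matching edge tensors coincide. -/
theorem eq_of_edgeTensors (hv : ori v ≠ 0) (hv' : ori v' ≠ 0) (h0 : v' 0 = v 0) (h1 : v' 1 = v 1)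
    (hneg : ori v * ori v' < 0) {T T' : Finset E} (hT : (T : Set E) = Set.range v)
    (hT' : (T' : Set E) = Set.range v') {q q' : Poly} (hq : q ∈ P 1) (hq' : q' ∈ P 1)
    (h : ∀ α β γ σ σ', IsEdgeTensor v α β γ σ → IsEdgeTensor v' α β γ σ' →
      cellInt T (divDivP σ * q) + cellInt T' (divDivP σ' * q') = 0) : q = q' := by
  have hab : v 0 ≠ v 1 := vertices_ne hv (by decide)
  have hd0 : dist (v 0) (v 1) ≠ 0 := dist_ne_zero.2 hab
  obtain ⟨c, d, hcd⟩ := exists_affine_eq ((P 1).sub_mem hq hq')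
  have hsub : ∀ i, C (d i) = pderiv i q - pderiv i q' := fun i => by
    rw [← map_sub, hcd]
    fin_cases i <;> simp [Fin.sum_univ_two, pderiv_X]
  set A := ev (v 0) (q - q') with hA
  set B := ev (v 1) (q - q') with hB
  set D := d 0 * unitNormal (v 0) (v 1) 0 + d 1 * unitNormal (v 0) (v 1) 1 with hD
  -- The orientation signs of the two triangles are opposite, so only the jump `(1 - s) A + s B` and
  -- its normal derivative `D` remain. The coefficients are the integrals of these against `s²`, `(1
  -- - s)²` and `s (1 - s)`.
  have key : ∀ α β γ : ℝ,
      α * (A / 12 + B / 4) + β * (A / 4 + B / 12) - γ * (D / 6) = 0 := by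
    intro α β γ
    obtain ⟨σ, hσ⟩ := exists_isEdgeTensor hv α β γ
    obtain ⟨σ', hσ'⟩ := exists_isEdgeTensor hv' α β γ
    have h2 := h α β γ σ σ' hσ hσ'
    rw [cellInt_divDivP_mul hq, cellInt_divDivP_mul hq', hσ.greenDefect_eq hv hT (contDiff_ev q),
      hσ'.greenDefect_eq hv' hT' (contDiff_ev q'),
      show |ori v'| / ori v' = -(|ori v| / ori v) by
        linarith [abs_div_add_abs_div_eq_zero hneg], hσ.edgeTerm_eq, hσ'.edgeTerm_eq, h0, h1] at h2
    have hs0 : |ori v| / ori v ≠ 0 := div_ne_zero (abs_ne_zero.2 hv) hv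
    have hcont : ∀ q : Poly, Continuous fun s : ℝ =>
        ev (AffineMap.lineMap (v 0) (v 1) s) q := fun q =>
      (continuous_ev q).comp AffineMap.lineMap_continuous
    have hint : ∀ q : Poly, IntervalIntegrable (fun s : ℝ =>
        ev (AffineMap.lineMap (v 0) (v 1) s) q * (α * s ^ 2 + β * (1 - s) ^ 2) -
        ∑ j, pd j (fun x => ev x q) (AffineMap.lineMap (v 0) (v 1) s) *
          (γ * (s * (1 - s)) * unitNormal (v 0) (v 1) j)) volume 0 1 := fun q => by
      simp only [pd_ev]
      refine Continuous.intervalIntegrable (((hcont q).mul (by fun_prop)).sub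
        (continuous_finsetSum _ fun j _ => (hcont _).mul (by fun_prop))) _ _
    have h3 := (mul_eq_zero.1 (show |ori v| / ori v * (dist (v 0) (v 1) * _) = 0 by
      rw [neg_mul, ← sub_eq_add_neg, ← mul_sub, ← mul_sub,
        ← intervalIntegral.integral_sub (hint q) (hint q')] at h2
      exact h2)).resolve_left hs0
    have h4 := (mul_eq_zero.1 h3).resolve_left hd0
    rw [← h4, intervalIntegral.integral_congr (g := fun s => (β * A - γ * 0) +
      (β * (B - 3 * A) - γ * D) * s + (α * A + β * (3 * A - 2 * B) + γ * D) * s ^ 2 +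
      (α * (B - A) + β * (B - A)) * s ^ 3), integral_cubic]
    · ring
    · intro s _
      have e1 : ev (AffineMap.lineMap (v 0) (v 1) s) q - ev (AffineMap.lineMap (v 0) (v 1) s) q' =
          (1 - s) * A + s * B := by
        rw [← ev_sub, AffineMap.lineMap_apply_module, ev_combo ((P 1).sub_mem hq hq') _ _ (by ring)]
      have e2 : ∀ j, ev (AffineMap.lineMap (v 0) (v 1) s) (pderiv j q) =
          ev (AffineMap.lineMap (v 0) (v 1) s) (pderiv j q') + d j := fun j => by
        rw [← sub_eq_iff_eq_add', ← ev_sub, ← hsub, ev_C]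
      simp only [pd_ev, Fin.sum_univ_two, e2]
      rw [hD, show ev (AffineMap.lineMap (v 0) (v 1) s) q =
        ev (AffineMap.lineMap (v 0) (v 1) s) q' + ((1 - s) * A + s * B) by linarith]
      ring
  have hA0 : A = 0 := by linarith [key 1 0 0, key 0 1 0]
  have hB0 : B = 0 := by linarith [key 1 0 0, key 0 1 0]
  have hD0 : D = 0 := by linarith [key 0 0 1]
  -- With tangential and normal derivatives both zero, the gradient of the affine jump vanishes, and
  -- then its constant.
  have hBA : d 0 * (v 1 0 - v 0 0) + d 1 * (v 1 1 - v 0 1) = 0 := by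
    rw [hA, hcd] at hA0
    rw [hB, hcd] at hB0
    simp only [ev_add, ev_C, Fin.sum_univ_two, ev_mul, ev_X] at hA0 hB0
    linarith
  have hDD : d 0 * (v 1 1 - v 0 1) - d 1 * (v 1 0 - v 0 0) = 0 := by
    have : D * dist (v 0) (v 1) = d 0 * (v 1 1 - v 0 1) - d 1 * (v 1 0 - v 0 0) := by
      rw [hD]
      simp [unitNormal]
      field_simp
      ring
    rw [← this, hD0, zero_mul]
  have hlen : (v 1 0 - v 0 0) ^ 2 + (v 1 1 - v 0 1) ^ 2 ≠ 0 := by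
    intro h0
    refine hab ?_
    ext i
    have e0 : v 1 0 - v 0 0 = 0 := by nlinarith [sq_nonneg (v 1 0 - v 0 0), sq_nonneg (v 1 1 - v 0 1)]
    have e1 : v 1 1 - v 0 1 = 0 := by nlinarith [sq_nonneg (v 1 0 - v 0 0), sq_nonneg (v 1 1 - v 0 1)]
    fin_cases i
    · exact (sub_eq_zero.1 e0).symm
    · exact (sub_eq_zero.1 e1).symm
  have hd0' : d 0 = 0 := by
    refine (mul_eq_zero.1 (show d 0 * ((v 1 0 - v 0 0) ^ 2 + (v 1 1 - v 0 1) ^ 2) = 0 by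
      linear_combination (v 1 0 - v 0 0) * hBA + (v 1 1 - v 0 1) * hDD)).resolve_right hlen
  have hd1' : d 1 = 0 := by
    refine (mul_eq_zero.1 (show d 1 * ((v 1 0 - v 0 0) ^ 2 + (v 1 1 - v 0 1) ^ 2) = 0 by
      linear_combination (v 1 1 - v 0 1) * hBA - (v 1 0 - v 0 0) * hDD)).resolve_right hlen
  have hc : c = 0 := by
    rw [hA, hcd] at hA0
    simpa [ev_add, ev_C, Fin.sum_univ_two, ev_mul, hd0', hd1', ev_zero] using hA0
  rw [← sub_eq_zero, hcd, hc]
  simp [Fin.sum_univ_two, hd0', hd1']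

end edgeJump

/-! ### Two triangles at a common edge -/

section neighbours

variable {Ω : TopologicalSpace.Opens E} {𝒯 : Triangulation Ω}

/-- A rotation or a reflection of the three indices brings the edge to the front; the area changes
at most its sign. -/
theorem IsTriangle.exists_vertices_of_edge {T : Finset E} (hT : IsTriangle T) {a b : E} (ha : a ∈ T)
    (hb : b ∈ T) (hab : a ≠ b) :
    ∃ v : Fin 3 → E, (T : Set E) = Set.range v ∧ ori v ≠ 0 ∧ v 0 = a ∧ v 1 = b := by
  classical
  obtain ⟨v, hTv, hv⟩ := hT.exists_vertices
  have ha' : a ∈ Set.range v := hTv ▸ ha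
  have hb' : b ∈ Set.range v := hTv ▸ hb
  obtain ⟨i, rfl⟩ := ha'
  obtain ⟨j, rfl⟩ := hb'
  have hij : i ≠ j := fun h => hab (h ▸ rfl)
  have hj : j = i + 1 ∨ j = i - 1 := by
    revert hij
    fin_cases i <;> fin_cases j <;> decide
  rcases hj with rfl | rfl
  · refine ⟨fun l => v (i + l), ?_, ?_, by simp, rfl⟩
    · rw [hTv]
      exact ((Equiv.addLeft i).surjective.range_comp v).symm
    · have : ori (fun l => v (i + l)) = ori v := by
        fin_cases i <;> simp [ori, orient] <;> ring
      rwa [this]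
  · refine ⟨fun l => v (i - l), ?_, ?_, by simp, rfl⟩
    · rw [hTv]
      exact ((Equiv.subLeft i).surjective.range_comp v).symm
    · have : ori (fun l => v (i - l)) = -ori v := by
        fin_cases i <;> simp [ori, orient, show (-1 : Fin 3) = 2 from rfl,
          show (-2 : Fin 3) = 1 from rfl, show (1 - 2 : Fin 3) = 2 from rfl] <;> ring
      rw [this]
      exact neg_ne_zero.2 hv

/-- Two triangles of a triangulation with a common edge lie on different sides of it. -/
theorem Triangulation.ori_mul_ori_neg {T T' : Finset E} (hT : T ∈ 𝒯.triangles)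
    (hT' : T' ∈ 𝒯.triangles) (hne : T ≠ T') {v v' : Fin 3 → E} (hTv : (T : Set E) = Set.range v)
    (hTv' : (T' : Set E) = Set.range v') (hv : ori v ≠ 0) (hv' : ori v' ≠ 0) (h0 : v' 0 = v 0)
    (h1 : v' 1 = v 1) : ori v * ori v' < 0 := by
  by_contra! hnn
  have hpos : 0 < ori v * ori v' := lt_of_le_of_ne hnn (mul_ne_zero hv hv').symm
  -- If the orientations agreed, `v 2` would lie on the inner side of the edge for the other
  -- triangle too. Points slightly off the midpoint of the edge towards `v 2` would be interior to
  -- both triangles, whose intersection is null.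
  have hc : 0 < ev (v 2) (lam v' 2) := by
    have h2 : ev (v 2) (lam v' 2) = (ori v')⁻¹ * ori v := by
      rw [ev_lam, ori, orient]
      simp only [show (2 : Fin 3) + 1 = 0 from rfl, show (2 : Fin 3) + 2 = 1 from rfl, h0, h1]
      rw [ori, orient]
      ring
    rw [h2, show (ori v')⁻¹ * ori v = ori v * ori v' * ((ori v')⁻¹) ^ 2 by field_simp]
    positivity
  let y : ℝ → E := fun ε => AffineMap.lineMap (AffineMap.lineMap (v 0) (v 1) (1 / 2 : ℝ)) (v 2) ε
  have hy : Continuous y := AffineMap.lineMap_continuous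
  have hev : ∀ (p : Poly), p ∈ P 1 → ∀ ε,
      ev (y ε) p = (1 - ε) * (1 / 2 * ev (v 0) p + 1 / 2 * ev (v 1) p) + ε * ev (v 2) p := by
    intro p hp ε
    simp only [y]
    rw [AffineMap.lineMap_apply_module, AffineMap.lineMap_apply_module, ev_combo hp _ _ (by ring),
      ev_combo hp _ _ (by ring)]
    ring
  have hsmall : ∀ᶠ ε in 𝓝[>] (0 : ℝ), ∀ i, i ≠ 2 → 0 < ev (y ε) (lam v' i) := by
    refine Filter.Eventually.filter_mono nhdsWithin_le_nhds ?_
    rw [Filter.eventually_all]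
    intro i
    by_cases hi : i = 2
    · exact Filter.Eventually.of_forall fun _ h => absurd hi h
    have h3 : 0 < ev (y 0) (lam v' i) := by
      rw [hev _ (lam_mem v' i), ← h0, ← h1]
      fin_cases i
      · simp [ev_lam_self hv', ev_lam_of_ne v' (show (1 : Fin 3) ≠ 0 by decide)]
      · simp [ev_lam_self hv', ev_lam_of_ne v' (show (0 : Fin 3) ≠ 1 by decide)]
      · exact absurd rfl hi
    filter_upwards [(isOpen_lt continuous_const ((continuous_ev (lam v' i)).comp hy)).mem_nhds h3]
      with ε hε _ using hε
  obtain ⟨ε, hε, hε0, hε1⟩ := (hsmall.and (Ioo_mem_nhdsGT (show (0 : ℝ) < 1 by norm_num))).exists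
  have hin : y ε ∈ {x | ∀ i, 0 < ev x (lam v i)} ∩ {x | ∀ i, 0 < ev x (lam v' i)} := by
    refine ⟨fun i => ?_, fun i => ?_⟩
    · rw [hev _ (lam_mem v i)]
      fin_cases i <;> simp [ev_lam_self hv, ev_lam_of_ne] <;> linarith
    · by_cases hi : i = 2
      · rw [hi, hev _ (lam_mem v' 2), ← h0, ← h1, ev_lam_of_ne v' (by decide),
          ev_lam_of_ne v' (by decide)]
        have := mul_pos hε0 hc
        linarith
      · exact hε i hi
  have hopen := (isOpen_lam_pos v).inter (isOpen_lam_pos v')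
  have hnull : volume ({x | ∀ i, 0 < ev x (lam v i)} ∩ {x | ∀ i, 0 < ev x (lam v' i)}) = 0 := by
    refine measure_mono_null (Set.inter_subset_inter ?_ ?_)
      (Triangulation.volume_cell_inter_cell hT hT' hne)
    · rw [hTv]
      exact (lam_pos_subset hv).trans interior_subset
    · rw [hTv']
      exact (lam_pos_subset hv').trans interior_subset
  have hempty := (hopen.measure_eq_zero_iff volume).1 hnull
  exact (hempty ▸ hin : y ε ∈ (∅ : Set E))

/-- At most two triangles share an edge. -/
theorem Triangulation.eq_or_eq_of_edge {T T' S : Finset E} (hT : T ∈ 𝒯.triangles)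
    (hT' : T' ∈ 𝒯.triangles) (hS : S ∈ 𝒯.triangles) (hne : T ≠ T') {a b : E} (hab : a ≠ b)
    (ha : a ∈ T ∧ a ∈ T' ∧ a ∈ S) (hb : b ∈ T ∧ b ∈ T' ∧ b ∈ S) : S = T ∨ S = T' := by
  by_contra! h
  obtain ⟨u, hu, hu0, e0, e1⟩ := (isTriangle hT).exists_vertices_of_edge ha.1 hb.1 hab
  obtain ⟨v, hv, hv0, f0, f1⟩ := (isTriangle hT').exists_vertices_of_edge ha.2.1 hb.2.1 hab
  obtain ⟨w, hw, hw0, g0, g1⟩ := (isTriangle hS).exists_vertices_of_edge ha.2.2 hb.2.2 hab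
  have h1 := ori_mul_ori_neg hT hT' hne hu hv hu0 hv0 (f0.trans e0.symm) (f1.trans e1.symm)
  have h2 := ori_mul_ori_neg hT hS h.1.symm hu hw hu0 hw0 (g0.trans e0.symm) (g1.trans e1.symm)
  have h3 := ori_mul_ori_neg hT' hS h.2.symm hv hw hv0 hw0 (g0.trans f0.symm) (g1.trans f1.symm)
  -- Three real numbers cannot have pairwise negative products.
  nlinarith [mul_pos_of_neg_of_neg h1 h2, sq_nonneg (ori u), sq_pos_of_ne_zero hu0]

end neighbours
-- Restriction and symmetry of agreement
section dofs

theorem SDofsAgree.mono {k : ℕ} {S S' : Set E} {σ τ : Matrix (Fin 2) (Fin 2) Poly} (hS : S' ⊆ S)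
    (h : SDofsAgree k S σ τ) : SDofsAgree k S' σ τ :=
  ⟨fun a ha => h.1 a (hS ha), fun a ha b hb => h.2 a (hS ha) b (hS hb)⟩

theorem SDofsAgree.symm {k : ℕ} {S : Set E} {σ τ : Matrix (Fin 2) (Fin 2) Poly}
    (h : SDofsAgree k S σ τ) : SDofsAgree k S τ σ :=
  ⟨fun a ha i j => (h.1 a ha i j).symm, fun a ha b hb hab =>
    ⟨fun φ hφ => ((h.2 a ha b hb hab).1 φ hφ).symm, fun q hq => ((h.2 a ha b hb hab).2 q hq).symm⟩⟩

end dofs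

/-! ### Surjectivity of the global `div div` -/

section surjectivity

open MvPolynomial

variable {Ω : TopologicalSpace.Opens E} {𝒯 : Triangulation Ω} {k : ℕ}

/-- Uniqueness of the polynomial on each triangle makes its choice linear, which embeds the space
into a finite product of polynomial spaces. -/
theorem finiteDimensional_Ph (hΩ : IsLipschitzDomain Ω) (k : ℕ) (𝒯 : Triangulation Ω) :
    FiniteDimensional ℝ (Ph k 𝒯) := by
  have hq : ∀ (z : Ph k 𝒯) (T : 𝒯.cells), ∃ p : P (k - 2), EqOn T z.1 p := fun z T => by
    obtain ⟨p, hp, h⟩ := z.2 T (Triangulation.mem_cells.1 T.2)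
    exact ⟨⟨p, hp⟩, h⟩
  choose q hq using hq
  let f : Ph k 𝒯 →ₗ[ℝ] (𝒯.cells → P (k - 2)) :=
    { toFun := q
      map_add' := fun z w => funext fun T => Subtype.ext <|
        (hq (z + w) T).unique hΩ (Triangulation.mem_cells.1 T.2) ((hq z T).add (hq w T))
      map_smul' := fun c z => funext fun T => Subtype.ext <|
        (hq (c • z) T).unique hΩ (Triangulation.mem_cells.1 T.2) ((hq z T).smul c) }
  refine FiniteDimensional.of_injective f ?_
  rw [← LinearMap.ker_eq_bot, LinearMap.ker_eq_bot']
  intro z hz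
  refine Subtype.ext (eq_of_forall_eqOn (𝒯 := 𝒯) (p := fun _ => 0) (fun T hT => ?_)
    fun _ _ => EqOn.zero)
  have h1 := hq z ⟨T, Triangulation.mem_cells.2 hT⟩
  have h2 : q z ⟨T, Triangulation.mem_cells.2 hT⟩ = 0 := congrFun hz _
  rwa [h2] at h1

theorem inner_eq_sum_cellInt (hΩ : IsLipschitzDomain Ω) {u w : L2 Ω} {p q : Finset E → Poly}
    (hu : ∀ T ∈ 𝒯.triangles, EqOn T u (p T)) (hw : ∀ T ∈ 𝒯.triangles, EqOn T w (q T)) :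
    inner ℝ u w = ∑ T ∈ 𝒯.cells, cellInt T (p T * q T) := by
  have h1 : inner ℝ u w = ∫ x in Ω, u x * w x := by
    rw [L2.inner_def]
    exact integral_congr_ae (Filter.Eventually.of_forall fun x => mul_comm _ _)
  have hi : Integrable (fun x => u x * w x) ((volume : Measure E).restrict Ω) :=
    MemLp.integrable_mul (Lp.memLp u) (Lp.memLp w)
  rw [h1, setIntegral_eq_sum_cells hΩ 𝒯 hi]
  refine Finset.sum_congr rfl fun T hT => ?_
  rw [Triangulation.mem_cells] at hT
  have hae := interior_ae_eq_of_null_frontier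
    ((convex_convexHull ℝ (T : Set E)).addHaar_frontier volume)
  rw [cellInt_apply, ← setIntegral_congr_set hae, ← setIntegral_congr_set hae]
  have hsub := Triangulation.interior_cell_subset hΩ hT
  refine integral_congr_ae ?_
  filter_upwards [ae_restrict_of_ae_restrict_of_subset hsub (hu T hT),
    ae_restrict_of_ae_restrict_of_subset hsub (hw T hT),
    ae_restrict_mem isOpen_interior.measurableSet] with x h1 h2 hx
  rw [h1 (interior_subset hx), h2 (interior_subset hx), ev_mul]

theorem integrableOn_cell_mul (T : Finset E) (q : Poly) {f : E → ℝ} (hf : Continuous f) :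
    IntegrableOn (fun x => ev x q * f x) (convexHull ℝ (T : Set E)) :=
  ((continuous_ev q).mul hf).continuousOn.integrableOn_compact (isCompact_cell T)

/-- A piecewise polynomial tensor satisfying Green's formula is in `H(div div)`. -/
theorem hasWeakDivDiv_of_sum_greenDefect (hΩ : IsLipschitzDomain Ω)
    {τ : Matrix (Fin 2) (Fin 2) (L2 Ω)} {f : L2 Ω} {p : Finset E → Matrix (Fin 2) (Fin 2) Poly}
    (hτ : ∀ T ∈ 𝒯.triangles, ∀ i j, EqOn T (τ i j) (p T i j))
    (hf : ∀ T ∈ 𝒯.triangles, EqOn T f (divDivP (p T)))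
    (h : ∀ φ : 𝓓(Ω, ℝ), ∑ T ∈ 𝒯.cells, greenDefect T (p T) φ = 0) : HasWeakDivDiv τ f := by
  intro φ
  have hc : ∀ i j, Continuous (pd i (pd j φ)) := fun i j =>
    (contDiff_pd (contDiff_pd φ.contDiff)).continuous
  have h1 := h φ
  have h2 : ∀ T, greenDefect T (p T) φ =
      (∫ x in convexHull ℝ (T : Set E), ev x (divDivP (p T)) * φ x) -
        ∑ i, ∑ j, ∫ x in convexHull ℝ (T : Set E), ev x (p T i j) * pd i (pd j φ) x := fun T => by
    have hi := fun i j => integrableOn_cell_mul T (p T i j) (hc i j)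
    rw [greenDefect, integral_sub (integrableOn_cell_mul T _ φ.continuous)
      (integrable_finsetSum _ fun i _ => integrable_finsetSum _ fun j _ => hi i j),
      integral_finsetSum _ fun i _ => integrable_finsetSum _ fun j _ => hi i j]
    congr 1
    exact Finset.sum_congr rfl fun i _ => integral_finsetSum _ fun j _ => hi i j
  simp only [h2, Finset.sum_sub_distrib] at h1
  have h3 : ∀ i j, pairing (τ i j) (pd i (pd j φ)) =
      ∑ T ∈ 𝒯.cells, ∫ x in convexHull ℝ (T : Set E), ev x (p T i j) * pd i (pd j φ) x :=
    fun i j => pairing_eq_sum hΩ (fun T hT => hτ T hT i j) (hc i j)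
      (hasCompactSupport_pd (hasCompactSupport_pd φ.hasCompactSupport))
  rw [pairing_eq_sum hΩ hf φ.continuous φ.hasCompactSupport, sub_eq_zero.1 h1]
  simp only [h3, Fin.sum_univ_two, Finset.sum_add_distrib]

/-- Orthogonality to the range of `div div`, tested with a piecewise polynomial tensor. -/
theorem sum_cellInt_eq_zero (hΩ : IsLipschitzDomain Ω) {z : L2 Ω} {q : Finset E → Poly}
    (hz : ∀ T ∈ 𝒯.triangles, EqOn T z (q T))
    (horth : ∀ σ : Sh k 𝒯, inner ℝ (divDivSh k 𝒯 σ) z = 0)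
    {p : Finset E → Matrix (Fin 2) (Fin 2) Poly} (hp : ∀ T ∈ 𝒯.triangles, p T ∈ PSym k)
    (hd : ∀ T ∈ 𝒯.triangles, ∀ T' ∈ 𝒯.triangles, SDofsAgree k ((T : Set E) ∩ T') (p T) (p T'))
    (h : ∀ φ : 𝓓(Ω, ℝ), ∑ T ∈ 𝒯.cells, greenDefect T (p T) φ = 0) :
    ∑ T ∈ 𝒯.cells, cellInt T (divDivP (p T) * q T) = 0 := by
  have hτ := fun i j => exists_glue 𝒯 fun T => p T i j
  choose τ hτ using hτ
  obtain ⟨f, hf⟩ := exists_glue 𝒯 fun T => divDivP (p T)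
  have hw : HasWeakDivDiv (Matrix.of τ) f :=
    hasWeakDivDiv_of_sum_greenDefect hΩ (fun T hT i j => hτ i j T hT) hf h
  have hsymm : (Matrix.of τ).IsSymm := by
    ext1 i j
    refine eq_of_forall_eqOn (𝒯 := 𝒯) (p := fun T => p T i j) (fun T hT => ?_) fun T hT => hτ i j T hT
    have h1 := hτ j i T hT
    rwa [(hp T hT).1.apply i j] at h1
  let σ : Sh k 𝒯 := ⟨Matrix.of τ, ⟨hsymm, f, hw⟩, p,
    fun T hT => ⟨hp T hT, fun i j => hτ i j T hT⟩, hd⟩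
  have hσ : divDivSh k 𝒯 σ = f := (hasWeakDivDiv_divDiv _).unique hw
  rw [← inner_eq_sum_cellInt hΩ hf hz, ← hσ]
  exact horth σ

/-- The `L²(T)`-orthogonal projection onto the affine functions. -/
theorem exists_affine_projection {T : Finset E} (hT : IsTriangle T) (q : Poly) :
    ∃ r ∈ P 1, ∀ p ∈ P 1, cellInt T ((q - r) * p) = 0 := by
  obtain ⟨v, hTv, hv⟩ := hT.exists_vertices
  let f : P 1 →ₗ[ℝ] Module.Dual ℝ (P 1) :=
    LinearMap.mk₂ ℝ (fun r p => cellInt T (r.1 * p.1))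
      (fun r r' p => by simp [add_mul]) (fun c r p => by simp)
      (fun r p p' => by simp [mul_add]) (fun c r p => by simp)
  have hinj : Function.Injective f := by
    rw [← LinearMap.ker_eq_bot, LinearMap.ker_eq_bot']
    exact fun r hr => Subtype.ext (eq_zero_of_cellInt_sq hTv hv (LinearMap.congr_fun hr r))
  obtain ⟨r, hr⟩ := (LinearMap.injective_iff_surjective_of_finrank_eq_finrank
    Subspace.dual_finrank_eq.symm).1 hinj
    ((cellInt T ∘ₗ LinearMap.mulLeft ℝ q) ∘ₗ (P 1).subtype)
  refine ⟨r, r.2, fun p hp => ?_⟩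
  have h1 : cellInt T (r.1 * p) = cellInt T (q * p) := LinearMap.congr_fun hr ⟨p, hp⟩
  rw [sub_mul, map_sub, h1, sub_self]

theorem greenDefect_zero (T : Finset E) (φ : E → ℝ) : greenDefect T 0 φ = 0 := by
  simp [greenDefect, ev_zero]

theorem greenDefect_bubble (hk : 3 ≤ k) {T : Finset E} (hT : IsTriangle T)
    {σ : Matrix (Fin 2) (Fin 2) Poly} (hσ : σ ∈ bubbleS k T) {φ : E → ℝ} (hφ : ContDiff ℝ 2 φ) :
    greenDefect T σ φ = 0 := by
  obtain ⟨v, hTv, hv⟩ := hT.exists_vertices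
  have h := hσ.2
  rw [SDofsAgree_zero_iff hk hσ.1.2, hTv] at h
  rw [greenDefect, hTv, integral_divDiv_triangle hv hσ.1.1 hφ]
  refine mul_eq_zero_of_right _ (Finset.sum_eq_zero fun i _ => ?_)
  obtain ⟨h1, h2⟩ := h.2 (v i) ⟨i, rfl⟩ (v (i + 1)) ⟨i + 1, rfl⟩
    (vertices_ne hv (by fin_cases i <;> decide))
  exact edgeTerm_eq_zero h1 h2 φ

/-- A piecewise polynomial that is orthogonal to the range of `div div` is piecewise affine. -/
theorem mem_P_one_of_orthogonal (hk : 3 ≤ k) (hΩ : IsLipschitzDomain Ω) {z : L2 Ω}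
    {q : Finset E → Poly} (hz : ∀ T ∈ 𝒯.triangles, EqOn T z (q T))
    (hq : ∀ T ∈ 𝒯.triangles, q T ∈ P (k - 2))
    (horth : ∀ σ : Sh k 𝒯, inner ℝ (divDivSh k 𝒯 σ) z = 0) {T : Finset E}
    (hT : T ∈ 𝒯.triangles) : q T ∈ P 1 := by
  classical
  have hT' := Triangulation.isTriangle hT
  obtain ⟨v, hTv, hv⟩ := hT'.exists_vertices
  obtain ⟨r, hr, hrq⟩ := exists_affine_projection hT' (q T)
  -- The non-affine part of `q T` is the `div div` of a bubble tensor. Extended by zero this tensor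
  -- is admissible, so the non-affine part is orthogonal to `q T`, hence to itself.
  have hmem : q T - r ∈ bubbleP k T :=
    ⟨(P _).sub_mem (hq T hT) (P_mono (by omega) hr), fun p hp => hrq p hp⟩
  obtain ⟨σ, hσ, hσq⟩ := exists_bubbleS_divDivP_eq hk hT' hmem
  have h1 := sum_cellInt_eq_zero hΩ hz horth (p := fun S => if S = T then σ else 0)
    (fun S _ => by
      split_ifs
      · exact hσ.1
      · exact (PSym k).zero_mem)
    (fun S hS S' hS' => by
      by_cases h1 : S = T <;> by_cases h2 : S' = T
      · rw [if_pos h1, if_pos h2]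
        exact SDofsAgree.refl _ _ _
      · rw [if_pos h1, if_neg h2]
        exact hσ.2.mono (h1 ▸ Set.inter_subset_left)
      · rw [if_neg h1, if_pos h2]
        exact (hσ.2.mono (h2 ▸ Set.inter_subset_right)).symm
      · rw [if_neg h1, if_neg h2]
        exact SDofsAgree.refl _ _ _)
    (fun φ => Finset.sum_eq_zero fun S _ => by
      by_cases h1 : S = T
      · rw [if_pos h1, h1]
        exact greenDefect_bubble hk hT' hσ (contDiff_infty.1 φ.contDiff 2)
      · rw [if_neg h1, greenDefect_zero])
  rw [Finset.sum_eq_single T, if_pos rfl, hσq] at h1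
  · have h2 := hrq r hr
    have h3 : cellInt T ((q T - r) * (q T - r)) = 0 := by
      rw [mul_sub, map_sub, h1, h2, sub_zero]
    rw [sub_eq_zero.1 (eq_zero_of_cellInt_sq hTv hv h3)]
    exact hr
  · intro S _ hS
    rw [if_neg hS, map_zero, zero_mul, map_zero]
  · exact fun h => absurd (Triangulation.mem_cells.2 hT) h

/-- An edge tensor has no degrees of freedom on the part of the boundary it shares with a triangle
not containing its edge. -/
theorem IsEdgeTensor.SDofsAgree_zero (hk : 3 ≤ k) {v : Fin 3 → E} {α β γ : ℝ}
    {σ : Matrix (Fin 2) (Fin 2) Poly} (hσ : IsEdgeTensor v α β γ σ) {S : Set E}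
    (hS : S ⊆ Set.range v) (h : ¬(v 0 ∈ S ∧ v 1 ∈ S)) : SDofsAgree k S σ 0 := by
  rw [SDofsAgree_zero_iff hk (PSym_mono hk hσ.mem).2]
  refine ⟨fun a ha => ?_, fun a ha b hb hab => ?_⟩
  · obtain ⟨l, rfl⟩ := hS ha
    exact hσ.vertex l
  have key := forall_edges (v := v) (R := fun a b => (a ∈ S ∧ b ∈ S) →
    (∀ i, res a b (normalTrace a b σ i) = 0) ∧ res a b (divNormalTrace a b σ) = 0) ?_ ?_
  · exact key a (hS ha) b (hS hb) hab ⟨ha, hb⟩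
  · intro a b hR hba
    obtain ⟨h1, h2⟩ := hR hba.symm
    refine ⟨fun i => ?_, ?_⟩
    · rw [normalTrace_symm, map_neg, res_symm (h1 i), neg_zero]
    · rw [divNormalTrace_symm, map_neg, res_symm h2, neg_zero]
  · intro l hl
    by_cases hl0 : l = 0
    · subst hl0
      exact absurd hl h
    · exact ⟨hσ.normalTrace_of_ne l hl0, hσ.divNormalTrace_of_ne l hl0⟩

/-- Matching edge tensors on two triangles have the same degrees of freedom on the common edge. -/
theorem IsEdgeTensor.SDofsAgree (hk : 3 ≤ k) {v v' : Fin 3 → E} {α β γ : ℝ}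
    {σ σ' : Matrix (Fin 2) (Fin 2) Poly} (hσ : IsEdgeTensor v α β γ σ)
    (hσ' : IsEdgeTensor v' α β γ σ') (h0 : v' 0 = v 0) (h1 : v' 1 = v 1) :
    SDofsAgree k {v 0, v 1} σ σ' := by
  rw [← SDofsAgree_sub_iff, SDofsAgree_zero_iff hk
    ((PSym k).sub_mem (PSym_mono hk hσ.mem) (PSym_mono hk hσ'.mem)).2]
  have hN : ∀ i, res (v 0) (v 1) (normalTrace (v 0) (v 1) (σ - σ') i) = 0 := fun i => by
    refine Polynomial.funext fun s => ?_
    have e := hσ'.ev_normalTrace s i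
    rw [h0, h1] at e
    rw [eval_res, map_sub, Pi.sub_apply, ev_sub, hσ.ev_normalTrace, e, sub_self,
      Polynomial.eval_zero]
  have hD : res (v 0) (v 1) (divNormalTrace (v 0) (v 1) (σ - σ')) = 0 := by
    refine Polynomial.funext fun s => ?_
    have e := hσ'.ev_divNormalTrace s
    rw [h0, h1] at e
    rw [eval_res, map_sub, ev_sub, hσ.ev_divNormalTrace, e, sub_self, Polynomial.eval_zero]
  refine ⟨?_, ?_⟩
  · have e0 := hσ'.vertex 0
    have e1 := hσ'.vertex 1
    rw [h0] at e0
    rw [h1] at e1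
    rintro a (rfl | rfl) i j <;> rw [Matrix.sub_apply, ev_sub, hσ.vertex]
    · rw [e0, sub_self]
    · rw [e1, sub_self]
  · have hs : (∀ i, res (v 1) (v 0) (normalTrace (v 1) (v 0) (σ - σ') i) = 0) ∧
        res (v 1) (v 0) (divNormalTrace (v 1) (v 0) (σ - σ')) = 0 := by
      refine ⟨fun i => ?_, ?_⟩
      · rw [normalTrace_symm, map_neg, res_symm (hN i), neg_zero]
      · rw [divNormalTrace_symm, map_neg, res_symm hD, neg_zero]
    rintro a (rfl | rfl) b (rfl | rfl) hab
    · exact absurd rfl hab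
    · exact ⟨hN, hD⟩
    · exact hs
    · exact absurd rfl hab

/-- A piecewise affine function that is orthogonal to the range of `div div` does not jump across
edges. -/
theorem eq_of_orthogonal (hk : 3 ≤ k) (hΩ : IsLipschitzDomain Ω) {z : L2 Ω}
    {q : Finset E → Poly} (hz : ∀ T ∈ 𝒯.triangles, EqOn T z (q T))
    (hq : ∀ T ∈ 𝒯.triangles, q T ∈ P 1)
    (horth : ∀ σ : Sh k 𝒯, inner ℝ (divDivSh k 𝒯 σ) z = 0) {T T' : Finset E}
    (hT : T ∈ 𝒯.triangles) (hT' : T' ∈ 𝒯.triangles) {a b : E} (ha : a ∈ (T : Set E) ∩ T')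
    (hb : b ∈ (T : Set E) ∩ T') (hab : a ≠ b) : q T = q T' := by
  classical
  by_cases hne : T = T'
  · rw [hne]
  obtain ⟨v, hTv, hv, e0, e1⟩ :=
    (Triangulation.isTriangle hT).exists_vertices_of_edge ha.1 hb.1 hab
  obtain ⟨v', hTv', hv', e0', e1'⟩ :=
    (Triangulation.isTriangle hT').exists_vertices_of_edge ha.2 hb.2 hab
  have h0 := e0'.trans e0.symm
  have h1 := e1'.trans e1.symm
  have hneg := Triangulation.ori_mul_ori_neg hT hT' hne hTv hTv' hv hv' h0 h1
  have hinter : (T : Set E) ∩ T' ⊆ {v 0, v 1} := by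
    have hsub : ({a, b} : Finset E) ⊆ T ∩ T' := by
      intro x hx
      rw [Finset.mem_insert, Finset.mem_singleton] at hx
      rw [Finset.mem_inter]
      rcases hx with rfl | rfl
      · exact ha
      · exact hb
    have heq := Finset.eq_of_subset_of_card_le hsub (by
      rw [Finset.card_pair hab]
      exact Triangulation.card_inter_le_two hT hT' hne)
    rw [← Finset.coe_inter, ← heq, e0, e1]
    simp
  refine eq_of_edgeTensors hv hv' h0 h1 hneg hTv hTv' (hq T hT) (hq T' hT')
    fun α β γ σ σ' hσ hσ' => ?_
  -- Matching edge tensors on the two neighbours, extended by zero to all other triangles.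
  let p : Finset E → Matrix (Fin 2) (Fin 2) Poly := fun S =>
    if S = T then σ else if S = T' then σ' else 0
  have hpT : p T = σ := if_pos rfl
  have hpT' : p T' = σ' := by simp only [p, if_neg (Ne.symm hne), if_true]
  have hp0 : ∀ S, S ≠ T → S ≠ T' → p S = 0 := fun S h1 h2 => by simp only [p, if_neg h1, if_neg h2]
  have hpair : ∀ f : Finset E → ℝ, (∀ S, S ≠ T → S ≠ T' → f S = 0) →
      ∑ S ∈ 𝒯.cells, f S = f T + f T' := by
    intro f hf
    rw [← Finset.sum_pair hne]
    refine (Finset.sum_subset ?_ ?_).symm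
    · intro S hS
      rw [Finset.mem_insert, Finset.mem_singleton] at hS
      rcases hS with rfl | rfl
      · exact Triangulation.mem_cells.2 hT
      · exact Triangulation.mem_cells.2 hT'
    · intro S _ hS
      rw [Finset.mem_insert, Finset.mem_singleton, not_or] at hS
      exact hf S hS.1 hS.2
  have hTT' : SDofsAgree k ((T : Set E) ∩ T') (p T) (p T') := by
    rw [hpT, hpT']
    exact (hσ.SDofsAgree hk hσ' h0 h1).mono hinter
  have hzero : ∀ S ∈ 𝒯.triangles, S ≠ T → S ≠ T' →
      SDofsAgree k ((T : Set E) ∩ S) (p T) 0 ∧ SDofsAgree k ((T' : Set E) ∩ S) (p T') 0 := by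
    intro S hS hST hST'
    -- No third triangle contains the edge, and away from it the edge tensors have no degrees of
    -- freedom.
    have hno : ¬(a ∈ S ∧ b ∈ S) := fun h =>
      (Triangulation.eq_or_eq_of_edge hT hT' hS hne hab ⟨ha.1, ha.2, h.1⟩
        ⟨hb.1, hb.2, h.2⟩).elim hST hST'
    rw [hpT, hpT']
    refine ⟨hσ.SDofsAgree_zero hk (hTv ▸ Set.inter_subset_left) ?_,
      hσ'.SDofsAgree_zero hk (hTv' ▸ Set.inter_subset_left) ?_⟩
    · rw [e0, e1]
      exact fun h => hno ⟨h.1.2, h.2.2⟩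
    · rw [e0', e1']
      exact fun h => hno ⟨h.1.2, h.2.2⟩
  have hdofs : ∀ S ∈ 𝒯.triangles, ∀ S' ∈ 𝒯.triangles,
      SDofsAgree k ((S : Set E) ∩ S') (p S) (p S') := by
    intro S hS S' hS'
    by_cases h1 : S = T
    · subst h1
      by_cases h2 : S' = S
      · subst h2
        exact SDofsAgree.refl _ _ _
      by_cases h3 : S' = T'
      · subst h3
        exact hTT'
      · rw [hp0 S' h2 h3]
        exact (hzero S' hS' h2 h3).1
    by_cases h2 : S = T'
    · subst h2
      by_cases h3 : S' = T
      · subst h3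
        rw [Set.inter_comm]
        exact hTT'.symm
      by_cases h4 : S' = S
      · subst h4
        exact SDofsAgree.refl _ _ _
      · rw [hp0 S' h3 h4]
        exact (hzero S' hS' h3 h4).2
    rw [hp0 S h1 h2, Set.inter_comm]
    by_cases h3 : S' = T
    · subst h3
      exact (hzero S hS h1 h2).1.symm
    by_cases h4 : S' = T'
    · subst h4
      exact (hzero S hS h1 h2).2.symm
    rw [hp0 S' h3 h4]
    exact SDofsAgree.refl _ _ _
  have h2 := sum_cellInt_eq_zero hΩ hz horth (p := p) (fun S _ => by
    by_cases h1 : S = T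
    · rw [h1, hpT]
      exact PSym_mono hk hσ.mem
    by_cases h2 : S = T'
    · rw [h2, hpT']
      exact PSym_mono hk hσ'.mem
    rw [hp0 S h1 h2]
    exact (PSym k).zero_mem) hdofs (fun φ => by
      -- Both tensors have the same edge term, as the edge is run through in the same direction; it
      -- enters with opposite orientation signs, so the defects cancel.
      have hφ := contDiff_infty.1 φ.contDiff 2
      rw [hpair _ fun S h1 h2 => by rw [hp0 S h1 h2, greenDefect_zero], hpT, hpT',
        hσ.greenDefect_eq hv hTv hφ, hσ'.greenDefect_eq hv' hTv' hφ, hσ.edgeTerm_eq,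
        hσ'.edgeTerm_eq, h0, h1, ← add_mul, abs_div_add_abs_div_eq_zero hneg, zero_mul])
  rwa [hpair _ fun S h1 h2 => by rw [hp0 S h1 h2, map_zero, zero_mul, map_zero], hpT, hpT'] at h2

/-- The function is affine on each triangle and does not jump across edges, so by edge connectivity
it is one affine polynomial. A single polynomial tensor with this `div div` has single-valued
degrees of freedom, and testing with it gives norm zero. -/
theorem eq_zero_of_orthogonal (hk : 3 ≤ k) (hΩ : IsLipschitzDomain Ω) {z : L2 Ω}
    (hz : z ∈ Ph k 𝒯) (horth : ∀ σ : Sh k 𝒯, inner ℝ (divDivSh k 𝒯 σ) z = 0) : z = 0 := by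
  have hz' : ∀ T, ∃ p, T ∈ 𝒯.triangles → p ∈ P (k - 2) ∧ EqOn T z p := fun T => by
    by_cases hT : T ∈ 𝒯.triangles
    · obtain ⟨p, hp, h⟩ := hz T hT
      exact ⟨p, fun _ => ⟨hp, h⟩⟩
    · exact ⟨0, fun h => absurd h hT⟩
  choose q hq using hz'
  have hzq : ∀ T ∈ 𝒯.triangles, EqOn T z (q T) := fun T hT => (hq T hT).2
  have hq1 : ∀ T ∈ 𝒯.triangles, q T ∈ P 1 := fun T hT =>
    mem_P_one_of_orthogonal hk hΩ hzq (fun T hT => (hq T hT).1) horth hT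
  refine eq_of_forall_eqOn (𝒯 := 𝒯) (p := fun _ => 0) (fun T₀ hT₀ => ?_) fun _ _ => EqOn.zero
  have hall : ∀ T ∈ 𝒯.triangles, q T = q T₀ := fun T hT =>
    (𝒯.subset_of_edge_closed hΩ (s := {T ∈ 𝒯.triangles | q T = q T₀}) (fun T h => h.1)
      ⟨T₀, hT₀, rfl⟩ (fun T hT T' hT' a ha b hb hab => ⟨hT',
        (eq_of_orthogonal hk hΩ hzq hq1 horth hT.1 hT' ha hb hab).symm.trans hT.2⟩) hT).2
  -- An affine right-hand side needs a cubic tensor, which is admissible because `3 ≤ k`.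
  obtain ⟨σ, hσ, hσq⟩ := exists_divDivP_eq (hq1 T₀ hT₀)
  have h1 := sum_cellInt_eq_zero hΩ hzq horth (p := fun _ => σ) (fun _ _ => PSym_mono hk hσ)
    (fun _ _ _ _ => SDofsAgree.refl _ _ _) (fun φ => by
      have hφ := contDiff_infty.1 φ.contDiff 2
      have hc : ∀ i j, Continuous (pd i (pd j φ)) := fun i j =>
        (contDiff_pd (contDiff_pd φ.contDiff)).continuous
      have hi : ∀ i j, Integrable (fun x => ev x (σ i j) * pd i (pd j φ) x) volume := fun i j =>
        ((continuous_ev _).mul (hc i j)).integrable_of_hasCompactSupport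
          (hasCompactSupport_pd (hasCompactSupport_pd φ.hasCompactSupport)).mul_left
      have hi0 : Integrable (fun x => ev x (divDivP σ) * φ x) volume :=
        ((continuous_ev _).mul φ.continuous).integrable_of_hasCompactSupport
          φ.hasCompactSupport.mul_left
      have hi1 : Integrable (fun x => ev x (divDivP σ) * φ x -
          ∑ i, ∑ j, ev x (σ i j) * pd i (pd j φ) x) volume :=
        hi0.sub (integrable_finsetSum _ fun i _ => integrable_finsetSum _ fun j _ => hi i j)
      have hout : ∀ x, x ∉ (Ω : Set E) → ev x (divDivP σ) * φ x -
          ∑ i, ∑ j, ev x (σ i j) * pd i (pd j φ) x = 0 := fun x hx => by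
        have h2 : ∀ i j, pd i (pd j φ) x = 0 := fun i j => image_eq_zero_of_notMem_tsupport
          fun h => hx (φ.tsupport_subset
            (((tsupport_pd_subset i _).trans (tsupport_pd_subset j φ)) h))
        rw [image_eq_zero_of_notMem_tsupport fun h => hx (φ.tsupport_subset h)]
        simp [h2]
      simp only [greenDefect]
      rw [← setIntegral_eq_sum_cells hΩ 𝒯 hi1.restrict,
        setIntegral_eq_integral_of_forall_compl_eq_zero hout, integral_sub hi0
          (integrable_finsetSum _ fun i _ => integrable_finsetSum _ fun j _ => hi i j),
        integral_finsetSum _ fun i _ => integrable_finsetSum _ fun j _ => hi i j,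
        ← integral_divDivP_mul σ hφ φ.hasCompactSupport, sub_eq_zero]
      exact Finset.sum_congr rfl fun i _ => (integral_finsetSum _ fun j _ => hi i j).symm)
  have h2 : ∀ T ∈ 𝒯.cells, 0 ≤ cellInt T (divDivP σ * q T) := fun T hT => by
    obtain ⟨v, hTv, hv⟩ :=
      (Triangulation.isTriangle (Triangulation.mem_cells.1 hT)).exists_vertices
    rw [hall T (Triangulation.mem_cells.1 hT), hσq]
    refine cellInt_nonneg hTv fun x _ => ?_
    rw [ev_mul]
    exact mul_self_nonneg _
  have h3 := (Finset.sum_eq_zero_iff_of_nonneg h2).1 h1 T₀ (Triangulation.mem_cells.2 hT₀)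
  rw [hσq] at h3
  obtain ⟨v, hTv, hv⟩ := (Triangulation.isTriangle hT₀).exists_vertices
  have h4 := hzq T₀ hT₀
  rwa [eq_zero_of_cellInt_sq hTv hv h3] at h4

/-- The range is finite-dimensional, so `q` splits into a part in the range and a part orthogonal to
it. The latter is still in `P_h`, hence zero. -/
theorem exists_divDivSh_eq (hk : 3 ≤ k) (hΩ : IsLipschitzDomain Ω) {q : L2 Ω} (hq : q ∈ Ph k 𝒯) :
    ∃ σ, divDivSh k 𝒯 σ = q := by
  have hfin := finiteDimensional_Ph hΩ k 𝒯
  have hle : LinearMap.range (divDivSh k 𝒯) ≤ Ph k 𝒯 := by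
    rintro _ ⟨σ, rfl⟩
    exact divDivSh_mem hk hΩ σ
  have hfin' : FiniteDimensional ℝ (LinearMap.range (divDivSh k 𝒯)) :=
    Submodule.finiteDimensional_of_le hle
  obtain ⟨y, hy, z, hz, e⟩ := (LinearMap.range (divDivSh k 𝒯)).exists_add_mem_mem_orthogonal q
  have hz0 : z = 0 := by
    refine eq_zero_of_orthogonal (𝒯 := 𝒯) hk hΩ ?_ fun σ => hz _ ⟨σ, rfl⟩
    rw [← sub_eq_of_eq_add' e]
    exact (Ph k 𝒯).sub_mem hq (hle hy)
  rw [hz0, add_zero] at e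
  obtain ⟨σ, hσ⟩ := hy
  exact ⟨σ, hσ.trans e.symm⟩

/-- The finite element `div div` complex is exact. -/
theorem isExactSeq_finiteElement [SimplyConnectedSpace Ω] (hk : 3 ≤ k) (hΩ : IsLipschitzDomain Ω)
    (𝒯 : Triangulation Ω) :
    IsExactSeq (RT Ω) (Vh k 𝒯) (Sh k 𝒯) (Ph k 𝒯) (symCurlVh k 𝒯) (divDivSh k 𝒯) :=
  isExactSeq_of (RT_le_Vh k 𝒯) (symCurlVh_mem hk hΩ) (divDivSh_mem hk hΩ)
    (symCurlVh_eq_zero_iff hΩ) (fun v => divDivSh_symCurlVh v _) (exists_symCurlVh_eq hk hΩ)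
    fun _ => exists_divDivSh_eq hk hΩ

end surjectivity

end DivDiv

end

theorem mainTheorem4 (k : ℕ) (hk : 3 ≤ k) :
    (∀ (Ω : TopologicalSpace.Opens DivDiv.E), DivDiv.IsLipschitzDomain Ω →
      SimplyConnectedSpace Ω → ∀ 𝒯 : DivDiv.Triangulation Ω,
        DivDiv.IsExactSeq (DivDiv.RT Ω) (DivDiv.Vh k 𝒯) (DivDiv.Sh k 𝒯) (DivDiv.Ph k 𝒯)
          (DivDiv.symCurlVh k 𝒯) (DivDiv.divDivSh k 𝒯)) ∧
    (DivDiv.IsExactSeq DivDiv.RTPoly (DivDiv.PVec (k + 1)) (DivDiv.PSym k) (DivDiv.P (k - 2))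
      (DivDiv.symCurlP.domRestrict (DivDiv.PVec (k + 1)))
      (DivDiv.divDivP.domRestrict (DivDiv.PSym k))) ∧
    (∀ T : Finset DivDiv.E, DivDiv.IsTriangle T →
      DivDiv.IsExactSeq ⊥ (DivDiv.bubbleV k T) (DivDiv.bubbleS k T) (DivDiv.bubbleP k T)
        (DivDiv.symCurlP.domRestrict (DivDiv.bubbleV k T))
        (DivDiv.divDivP.domRestrict (DivDiv.bubbleS k T))) := by
  refine ⟨fun Ω hΩ hsc 𝒯 => DivDiv.isExactSeq_finiteElement hk hΩ 𝒯,
    DivDiv.isExactSeq_polynomial hk, fun T hT => DivDiv.isExactSeq_bubble hk hT⟩
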